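/- **Theorem.** For $\beta\in(0,1)$, a $\beta$-stable subordinator is a nondecreasing, right-continuous process $(X_t)_{t\ge 0}$ with $X_0=0$ and stationary independent increments such that, for some $c>0$, $\mathbb E\,e^{-\lambda X_t}=e^{-ct\lambda^\beta}$ for all $t,\lambda\ge 0$. A $\beta$-stable regenerative set $R^{(\beta)}$ is a random closed set with the law of the closure of the range of such a process (with respect to the Borel $\sigma$-algebra of the Fell topology on closed sets). For $a>0$ let $B_{a,\beta}$ denote a random variable with the law of the overshoot $X_{T_a}-a$, where $T_a=\inf\{t: X_t>a\}$. Let $\beta_1,\beta_2\in(0,1)$ satisfy $\beta_{1,2}:=\beta_1+\beta_2-1>0$, let $R^{(\beta_1)}$ and $R^{(\beta_2)}$ be independent stable regenerative sets with indices $\beta_1$ and $\beta_2$, and for $a>0$ put $$D_{a,\beta_1,\beta_2}:=\min\bigl\{R^{(\beta_1)}\cap\bigl(a+R^{(\beta_2)}\bigr)\bigr\}-a .$$ For every $a>0$ this minimum almost surely exists, and the following hold. 1. Recursion: $D_{1,\beta_1,\beta_2}\stackrel{d}{=}B_{1,\beta_1}\,(1+D_{1,\beta_2,\beta_1})$, where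 $B_{1,\beta_1}$ and $D_{1,\beta_2,\beta_1}$ on the right-hand side are independent. 2. Scaling: $D_{a,\beta_1,\beta_2}/a\stackrel{d}{=}D_{1,\beta_1,\beta_2}$ for all $a>0$. 3. Distribution function: $\mathbb P(D_{1,\beta_1,\beta_2}\le x)=P_D^{\beta_1,\beta_2}(x\mid 1)$ for all $x>0$, where for $a,x>0$ $$P_D^{\beta_1,\beta_2}(x\mid a)=\frac{1}{\Gamma(\beta_{1,2})\Gamma(1-\beta_{1,2})}\int_0^1\Bigl(\frac ax+y\Bigr)^{\beta_1-1}y^{\beta_2-1}(1-y)^{-\beta_{1,2}}\,dy .$$ 4. Hypergeometric form: for all $a,x>0$, $$P_D^{\beta_1,\beta_2}(x\mid a)=\frac{\Gamma(\beta_2)}{\Gamma(\beta_{1,2})\Gamma(2-\beta_1)}\Bigl(\frac ax\Bigr)^{\beta_1-1}{}_2F_1\Bigl(1-\beta_1,\beta_2;2-\beta_1;-\frac xa\Bigr),$$ where ${}_2F_1$ is the holomorphic continuation to $\mathbb C\setminus[1,\infty)$ of the Gauss hypergeometric series. -/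

import Mathlib

open MeasureTheory ProbabilityTheory
open scoped NNReal

/-- A (strictly) `β`-stable subordinator: independent and stationary increments, almost surely
nondecreasing right-continuous paths started at `0`, and Laplace exponent `c * l ^ β` for some
scale `c > 0`. -/
structure IsStableSubordinator {Ω : Type*} [MeasurableSpace Ω] (β : ℝ) (X : ℝ≥0 → Ω → ℝ)
    (P : Measure Ω) : Prop where
  measurable : ∀ t, Measurable (X t)
  start_zero : ∀ᵐ ω ∂P, X 0 ω = 0
  monotone : ∀ᵐ ω ∂P, Monotone (fun t => X t ω)
  right_continuous : ∀ᵐ ω ∂P, ∀ t, ContinuousWithinAt (fun s => X s ω) (Set.Ici t) t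
  indep_increments : HasIndepIncrements X P
  stationary_increments : ∀ s t : ℝ≥0, IdentDistrib (fun ω => X (s + t) ω - X s ω) (X t) P P
  laplace : ∃ c : ℝ, 0 < c ∧ ∀ (t : ℝ≥0) (l : ℝ), 0 ≤ l →
    ∫ ω, Real.exp (-l * X t ω) ∂P = Real.exp (-c * t * l ^ β)

/-- The σ-algebra on the closed subsets of `ℝ` generated by the events that the closed set hits a
given compact set; it is the Borel σ-algebra of the Fell topology. -/
instance instMeasurableSpaceClosedsReal : MeasurableSpace (TopologicalSpace.Closeds ℝ) :=
  MeasurableSpace.generateFrom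
    {A | ∃ K : Set ℝ, IsCompact K ∧
      A = {F : TopologicalSpace.Closeds ℝ | ((F : Set ℝ) ∩ K).Nonempty}}

/-- The closure of the range of a real-valued process. -/
def closedRange {Ω : Type*} (X : ℝ≥0 → Ω → ℝ) (ω : Ω) : TopologicalSpace.Closeds ℝ :=
  TopologicalSpace.Closeds.closure (Set.range fun t => X t ω)

/-- The overshoot of a process over the level `a`: its value at the first passage time
`inf {t | X t > a}`, minus `a`. -/
noncomputable def overshoot {Ω : Type*} (X : ℝ≥0 → Ω → ℝ) (a : ℝ) (ω : Ω) : ℝ :=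
  X (sInf {t : ℝ≥0 | a < X t ω}) ω - a

/-- `R` is a `β`-stable regenerative set: a random closed set with the law of the closure of the
range of a `β`-stable subordinator. -/
def IsStableRegenerativeSet {Ω : Type*} [MeasurableSpace Ω] (β : ℝ)
    (R : Ω → TopologicalSpace.Closeds ℝ) (P : Measure Ω) : Prop :=
  ∃ (Ω₀ : Type) (_ : MeasurableSpace Ω₀) (P₀ : Measure Ω₀) (X : ℝ≥0 → Ω₀ → ℝ),
    IsProbabilityMeasure P₀ ∧ IsStableSubordinator β X P₀ ∧ IdentDistrib R (closedRange X) P P₀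

/-- `B` is a random variable with the law of the overshoot over the level `a` of a `β`-stable
subordinator. -/
def IsStableOvershoot {Ω : Type*} [MeasurableSpace Ω] (β a : ℝ) (B : Ω → ℝ) (P : Measure Ω) :
    Prop :=
  ∃ (Ω₀ : Type) (_ : MeasurableSpace Ω₀) (P₀ : Measure Ω₀) (X : ℝ≥0 → Ω₀ → ℝ),
    IsProbabilityMeasure P₀ ∧ IsStableSubordinator β X P₀ ∧ IdentDistrib B (overshoot X a) P P₀

/-- The intersection of `R₁` with the shift `a + R₂`. -/
def shiftedIntersection {Ω : Type*} (R₁ R₂ : Ω → TopologicalSpace.Closeds ℝ) (a : ℝ) (ω : Ω) :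
    Set ℝ :=
  (R₁ ω : Set ℝ) ∩ (fun r => a + r) '' (R₂ ω : Set ℝ)

/-- The first intersection time of `R₁` and `a + R₂`, measured from `a`. -/
noncomputable def firstIntersectionTime {Ω : Type*} (R₁ R₂ : Ω → TopologicalSpace.Closeds ℝ)
    (a : ℝ) (ω : Ω) : ℝ :=
  sInf (shiftedIntersection R₁ R₂ a ω) - a

/-- The function `P_D(x | a)` with indices `β₁`, `β₂`. -/
noncomputable def intersectionCDF (β₁ β₂ x a : ℝ) : ℝ :=
  1 / (Real.Gamma (β₁ + β₂ - 1) * Real.Gamma (1 - (β₁ + β₂ - 1))) *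
    ∫ y in (0 : ℝ)..1, (a / x + y) ^ (β₁ - 1) * y ^ (β₂ - 1) * (1 - y) ^ (-(β₁ + β₂ - 1))

/-- `F` is the Gauss hypergeometric function with parameters `a, b; c` on `ℂ \ [1, ∞)`: the
holomorphic continuation (necessarily unique there) of the hypergeometric series, which converges
in the open unit disc. -/
def IsGaussHypergeometric (a b c : ℂ) (F : ℂ → ℂ) : Prop :=
  DifferentiableOn ℂ F {z | 1 - z ∈ Complex.slitPlane} ∧
    ∀ z : ℂ, ‖z‖ < 1 → F z = ordinaryHypergeometric a b c z

open scoped ENNReal BoundedContinuousFunction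

/-! The two sets find each other by leapfrogging: from `a` go to the next point of `R₁`, from there
to the next point of `a + R₂`, and so on. By the regenerative property each arrival leaves a fresh
set behind, and the set that moves next has to pass a level equal to the last gap. So the gaps are
`a, a U₁, a U₁ U₂, …` with independent factors, distributed alternately as the overshoots over the
level `1` for the two indices (`lintegral_leap`). For `0 < r < β₁ + β₂ - 1` the product of the two
moments of order `r` is below `1` (`overshoot_moments_lt_one`); hence the gaps are almost surely
summable and the positions converge. No leap passes a common point, and both sets meet each interval
between consecutive positions, so the limit is the smallest common point
(`isLeast_inter_of_tendsto_iterate_leap`).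

For the law, write `G₁₂` for `hittingCDF β₁ β₂` and `μ₁` for `overshootLaw β₁`. Then `∫ G₂₁(x / b -
1) dμ₁(b) = G₁₂(x)` (`lintegral_hittingCDF_overshootLaw`). Therefore `G`, with indices alternating,
evaluated at `(z - position) / gap`, has constant expectation `G₁₂(z / a)` along the chain. The
argument tends to `∞` if `D < z` and is eventually negative if `D > z`, so Fatou's lemma in both
directions gives `P(D < z) ≤ G₁₂(z / a) ≤ P(D ≤ z)`, and continuity of `G₁₂` yields equality.
Scaling and recursion are then comparisons of distribution functions; the hypergeometric form is
Euler's integral.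

The input about subordinators is the law of the overshoot and the regenerative property of the
closed range. Both come from the strong Markov property at first passage times, proved for random
walks and carried over by dyadic grids and right continuity. It gives the renewal identity for the
potential measure, proportional to `x ^ (β - 1) dx`. Abel inversion shows that the identity has only
one probability solution (`HasPotentialIdentity.measure_eq`), and the generalized arcsine law is
one. The same identity with another test function gives the recursion for `G`. -/

/-! ### Uniqueness of Laplace transforms -/

/-- A finite measure on `ℝ` is determined by its moment generating function on `(-∞, δ)`,
provided that it is finite there. -/
theorem measure_eq_of_mgf_eqOn_Iio {μ ν : Measure ℝ} [IsFiniteMeasure μ] [IsFiniteMeasure ν]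
    {δ : ℝ} (hδ : 0 < δ)
    (hμ : ∀ t < δ, Integrable (fun x => Real.exp (t * x)) μ)
    (hν : ∀ t < δ, Integrable (fun x => Real.exp (t * x)) ν)
    (h : ∀ t < δ, mgf id μ t = mgf id ν t) : μ = ν := by
  have hsub : ∀ {κ : Measure ℝ}, (∀ t < δ, Integrable (fun x => Real.exp (t * x)) κ) →
      Set.Iio δ ⊆ interior (integrableExpSet id κ) := fun {κ} hκ =>
    interior_maximal (fun t ht => hκ t ht) isOpen_Iio
  have han : ∀ {κ : Measure ℝ}, (∀ t < δ, Integrable (fun x => Real.exp (t * x)) κ) →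
      AnalyticOnNhd ℂ (complexMGF id κ) {z | z.re ∈ Set.Iio δ} := fun {κ} hκ =>
    analyticOnNhd_complexMGF.mono fun z hz => hsub hκ hz
  -- Identity theorem on the half-plane `Re z < δ`: the two analytic functions agree at real points
  -- accumulating at `0`. Since `δ > 0`, the half-plane contains the imaginary axis, where they are
  -- the characteristic functions.
  have heq : Set.EqOn (complexMGF id μ) (complexMGF id ν) {z | z.re ∈ Set.Iio δ} := by
    refine AnalyticOnNhd.eqOn_of_preconnected_of_frequently_eq (han hμ) (han hν)
      ((convex_Iio δ).linear_preimage Complex.reLm).isPreconnected (z₀ := ((0 : ℝ) : ℂ))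
      (by simpa using hδ) ?_
    have h_real : ∃ᶠ x : ℝ in nhdsWithin 0 {0}ᶜ, complexMGF id μ x = complexMGF id ν x := by
      refine Filter.Eventually.frequently ?_
      filter_upwards [mem_nhdsWithin_of_mem_nhds (Iio_mem_nhds hδ)] with x hx
      rw [complexMGF_ofReal, complexMGF_ofReal, h x hx]
    rw [Filter.frequently_iff_seq_forall] at h_real ⊢
    obtain ⟨xs, hx_tendsto, hx_eq⟩ := h_real
    refine ⟨fun n => xs n, ?_, fun n => ?_⟩
    · rw [tendsto_nhdsWithin_iff] at hx_tendsto ⊢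
      constructor
      · rw [Filter.tendsto_ofReal_iff]
        exact hx_tendsto.1
      · simpa using hx_tendsto.2
    · simp [hx_eq]
  refine Measure.ext_of_charFun ?_
  ext t
  rw [← complexMGF_id_mul_I, ← complexMGF_id_mul_I]
  exact heq (by simpa using hδ)

/-- Measures on `ℝ` with finite and equal Laplace transforms on `(0, ∞)` are equal. -/
theorem measure_eq_of_laplace_eq {μ ν : Measure ℝ}
    (hfin : ∀ l : ℝ, 0 < l → ∫⁻ x, ENNReal.ofReal (Real.exp (-l * x)) ∂μ ≠ ∞)
    (h : ∀ l : ℝ, 0 < l → ∫⁻ x, ENNReal.ofReal (Real.exp (-l * x)) ∂μ =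
      ∫⁻ x, ENNReal.ofReal (Real.exp (-l * x)) ∂ν) : μ = ν := by
  -- Tilting by `exp (-x)` makes possibly infinite measures, such as potential measures, finite and
  -- moves the range `l > 0` to `t = 1 - l < 1`. The density is positive and finite, so the tilt can
  -- be undone.
  set g : ℝ → ℝ≥0∞ := fun x => ENNReal.ofReal (Real.exp (-x)) with hg
  have hgm : Measurable g := by fun_prop
  have hmul : ∀ t x : ℝ, g x * ENNReal.ofReal (Real.exp (t * x)) =
      ENNReal.ofReal (Real.exp (-(1 - t) * x)) := fun t x => by
    rw [hg, ← ENNReal.ofReal_mul (Real.exp_pos _).le, ← Real.exp_add]; ring_nf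
  have hl : ∀ (κ : Measure ℝ) (t : ℝ),
      ∫⁻ x, ENNReal.ofReal (Real.exp (t * x)) ∂(κ.withDensity g) =
        ∫⁻ x, ENNReal.ofReal (Real.exp (-(1 - t) * x)) ∂κ := fun κ t => by
    rw [lintegral_withDensity_eq_lintegral_mul _ hgm (by fun_prop)]
    exact lintegral_congr fun x => hmul t x
  have hfinν : ∀ l : ℝ, 0 < l → ∫⁻ x, ENNReal.ofReal (Real.exp (-l * x)) ∂ν ≠ ∞ :=
    fun l hl => h l hl ▸ hfin l hl
  have hfm : ∀ {κ : Measure ℝ},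
      (∀ l : ℝ, 0 < l → ∫⁻ x, ENNReal.ofReal (Real.exp (-l * x)) ∂κ ≠ ∞) →
      IsFiniteMeasure (κ.withDensity g) := fun {κ} hκ => by
    refine isFiniteMeasure_withDensity ?_
    simpa [hg] using hκ 1 one_pos
  have hint : ∀ {κ : Measure ℝ},
      (∀ l : ℝ, 0 < l → ∫⁻ x, ENNReal.ofReal (Real.exp (-l * x)) ∂κ ≠ ∞) →
      ∀ t < (1 : ℝ), Integrable (fun x => Real.exp (t * x)) (κ.withDensity g) :=
    fun {κ} hκ t ht => by
      refine ⟨by fun_prop, ?_⟩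
      rw [hasFiniteIntegral_iff_ofReal (Filter.Eventually.of_forall fun x => (Real.exp_pos _).le),
        hl]
      exact (hκ _ (by linarith)).lt_top
  have := hfm hfin
  have := hfm hfinν
  have key : μ.withDensity g = ν.withDensity g := by
    refine measure_eq_of_mgf_eqOn_Iio one_pos (hint hfin) (hint hfinν) fun t ht => ?_
    simp only [mgf, id]
    rw [integral_eq_lintegral_of_nonneg_ae
      (Filter.Eventually.of_forall fun x => (Real.exp_pos _).le)
      (by fun_prop), integral_eq_lintegral_of_nonneg_ae
      (Filter.Eventually.of_forall fun x => (Real.exp_pos _).le) (by fun_prop), hl, hl,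
      h _ (by linarith)]
  have hg0 : ∀ x, g x ≠ 0 := fun x => by simp [hg, Real.exp_pos]
  rw [← withDensity_inv_same (μ := μ) hgm (Filter.Eventually.of_forall hg0)
      (Filter.Eventually.of_forall fun x => ENNReal.ofReal_ne_top), key,
    withDensity_inv_same hgm (Filter.Eventually.of_forall hg0)
      (Filter.Eventually.of_forall fun x => ENNReal.ofReal_ne_top)]

/-! ### Beta integrals -/

theorem lintegral_Ioo_zero_one_beta {p q : ℝ} (hp : 0 < p) (hq : 0 < q) :
    ∫⁻ y in Set.Ioo (0 : ℝ) 1, ENNReal.ofReal (y ^ (p - 1) * (1 - y) ^ (q - 1)) =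
      ENNReal.ofReal (beta p q) := by
  have h := lintegral_betaPDF_eq_one hp hq
  rw [lintegral_betaPDF] at h
  have hb := beta_pos hp hq
  simp_rw [mul_assoc] at h
  rw [setLIntegral_congr_fun (g := fun y => ENNReal.ofReal (1 / beta p q) *
      ENNReal.ofReal (y ^ (p - 1) * (1 - y) ^ (q - 1))) measurableSet_Ioo
      (fun y _ => ENNReal.ofReal_mul (by positivity)),
    lintegral_const_mul' _ _ ENNReal.ofReal_ne_top] at h
  rw [one_div, ENNReal.ofReal_inv_of_pos hb] at h
  rw [← one_mul (ENNReal.ofReal (beta p q)), ← h, mul_comm, ← mul_assoc,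
    ENNReal.mul_inv_cancel (by simpa using hb) ENNReal.ofReal_ne_top, one_mul]

theorem setLIntegral_Ioo_mul_left {c : ℝ} (hc : 0 < c) (x : ℝ) (g : ℝ → ℝ≥0∞) :
    ∫⁻ y in Set.Ioo 0 (c * x), g y = ENNReal.ofReal c * ∫⁻ y in Set.Ioo 0 x, g (c * y) := by
  have himg : (fun y => c * y) '' Set.Ioo 0 x = Set.Ioo 0 (c * x) := by
    rw [Set.image_mul_left_Ioo hc]; simp
  rw [← himg, lintegral_image_eq_lintegral_abs_deriv_mul (f' := fun _ => c) measurableSet_Ioo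
    (fun y _ => by simpa using ((hasDerivAt_id y).const_mul c).hasDerivWithinAt)
    (fun a _ b _ hab => mul_left_cancel₀ hc.ne' hab),
    lintegral_const_mul' _ _ ENNReal.ofReal_ne_top, abs_of_pos hc]

theorem setLIntegral_Ioo_comp_mul_left {x : ℝ} (hx : 0 < x) (g : ℝ → ℝ≥0∞) :
    ∫⁻ y in Set.Ioo 0 x, g y = ENNReal.ofReal x * ∫⁻ y in Set.Ioo (0 : ℝ) 1, g (x * y) := by
  simpa using setLIntegral_Ioo_mul_left hx 1 g

theorem setLIntegral_Ioi_comp_mul_left {x : ℝ} (hx : 0 < x) (g : ℝ → ℝ≥0∞) :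
    ∫⁻ y in Set.Ioi 0, g y = ENNReal.ofReal x * ∫⁻ y in Set.Ioi (0 : ℝ), g (x * y) := by
  have himg : (fun y => x * y) '' Set.Ioi (0 : ℝ) = Set.Ioi 0 := by
    rw [Set.image_mul_left_Ioi hx]; simp
  conv_lhs => rw [← himg]
  rw [lintegral_image_eq_lintegral_abs_deriv_mul (f' := fun _ => x) measurableSet_Ioi
    (fun y _ => by simpa using ((hasDerivAt_id y).const_mul x).hasDerivWithinAt)
    (fun a _ b _ hab => mul_left_cancel₀ hx.ne' hab),
    lintegral_const_mul' _ _ ENNReal.ofReal_ne_top, abs_of_pos hx]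

theorem setLIntegral_Ioi_comp_add_left (c a : ℝ) (g : ℝ → ℝ≥0∞) :
    ∫⁻ y in Set.Ioi a, g (c + y) = ∫⁻ y in Set.Ioi (c + a), g y := by
  have himg : (fun y => c + y) '' Set.Ioi a = Set.Ioi (c + a) := by
    simp [add_comm]
  rw [← himg, lintegral_image_eq_lintegral_abs_deriv_mul (f := fun y => c + y) (f' := fun _ => 1)
    measurableSet_Ioi (fun y _ => ((hasDerivAt_id y).const_add c).hasDerivWithinAt)
    (fun a _ b _ hab => add_left_cancel hab)]
  simp

theorem lintegral_Ioo_beta {p q x : ℝ} (hp : 0 < p) (hq : 0 < q) (hx : 0 < x) :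
    ∫⁻ y in Set.Ioo 0 x, ENNReal.ofReal (y ^ (p - 1) * (x - y) ^ (q - 1)) =
      ENNReal.ofReal (x ^ (p + q - 1) * beta p q) := by
  rw [setLIntegral_Ioo_comp_mul_left hx, ENNReal.ofReal_mul (by positivity),
    ← lintegral_Ioo_zero_one_beta hp hq, ← lintegral_const_mul' _ _ ENNReal.ofReal_ne_top,
    ← lintegral_const_mul' _ _ ENNReal.ofReal_ne_top]
  refine setLIntegral_congr_fun measurableSet_Ioo fun y hy => ?_
  rw [← ENNReal.ofReal_mul hx.le, ← ENNReal.ofReal_mul (by positivity)]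
  congr 1
  have h1 : x - x * y = x * (1 - y) := by ring
  rw [h1, Real.mul_rpow hx.le hy.1.le, Real.mul_rpow hx.le (by linarith [hy.2]),
    show p + q - 1 = 1 + (p - 1) + (q - 1) by ring, Real.rpow_add hx, Real.rpow_add hx,
    Real.rpow_one]
  ring

/-- The substitution `u = v / (1 - v)` reduces this to the beta integral on `(0, 1)`. Moments of the
overshoot law have this form. -/
theorem lintegral_Ioi_beta {p q : ℝ} (hp : 0 < p) (hq : 0 < q) :
    ∫⁻ u in Set.Ioi (0 : ℝ), ENNReal.ofReal (u ^ (p - 1) * (1 + u) ^ (-(p + q))) =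
      ENNReal.ofReal (beta p q) := by
  have himg : (fun v : ℝ => v / (1 - v)) '' Set.Ioo 0 1 = Set.Ioi 0 := by
    ext u
    constructor
    · rintro ⟨v, hv, rfl⟩
      exact div_pos hv.1 (by linarith [hv.2])
    · intro hu
      have hu : 0 < u := hu
      refine ⟨u / (1 + u), ⟨by positivity, by rw [div_lt_one (by positivity)]; linarith⟩, ?_⟩
      simp only; field_simp; ring
  have hder : ∀ v ∈ Set.Ioo (0 : ℝ) 1,
      HasDerivWithinAt (fun v : ℝ => v / (1 - v)) ((1 - v) ^ (-2 : ℝ)) (Set.Ioo 0 1) v := by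
    intro v hv
    have h1 : 0 < 1 - v := by linarith [hv.2]
    have := ((hasDerivAt_id v).div ((hasDerivAt_id v).const_sub 1) h1.ne').hasDerivWithinAt
      (s := Set.Ioo 0 1)
    refine this.congr_deriv ?_
    rw [Real.rpow_neg h1.le, Real.rpow_two]
    simp only [id]; field_simp; ring
  rw [← himg, lintegral_image_eq_lintegral_abs_deriv_mul measurableSet_Ioo hder,
    ← lintegral_Ioo_zero_one_beta hp hq]
  · refine setLIntegral_congr_fun measurableSet_Ioo fun v hv => ?_
    have h1 : 0 < 1 - v := by linarith [hv.2]
    have h0 := hv.1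
    rw [abs_of_pos (by positivity), ← ENNReal.ofReal_mul (by positivity)]
    congr 1
    have h2 : 1 + v / (1 - v) = (1 - v)⁻¹ := by field_simp; ring
    have e : (1 - v) ^ (q - 1) = (1 - v) ^ (-2 : ℝ) * (1 - v) ^ (p + q) / (1 - v) ^ (p - 1) := by
      rw [← Real.rpow_add h1, ← Real.rpow_sub h1]; congr 1; ring
    rw [h2, Real.inv_rpow h1.le, Real.rpow_neg h1.le (p + q), inv_inv, Real.div_rpow h0.le h1.le, e]
    ring
  · intro v hv w hw hvw
    have h1 : 0 < 1 - v := by linarith [hv.2]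
    have h2 : 0 < 1 - w := by linarith [hw.2]
    simp only at hvw
    rw [div_eq_div_iff h1.ne' h2.ne'] at hvw
    linarith

theorem beta_one_sub {β : ℝ} : beta β (1 - β) = Real.pi / Real.sin (Real.pi * β) := by
  rw [beta, Real.Gamma_mul_Gamma_one_sub]; simp

theorem sin_pi_mul_pos {β : ℝ} (h0 : 0 < β) (h1 : β < 1) : 0 < Real.sin (Real.pi * β) :=
  Real.sin_pos_of_pos_of_lt_pi (by positivity) (by nlinarith [Real.pi_pos])

/-- The convolution of `u ^ (-β) / (1 + u)` with `u ^ (β - 1)`. -/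
theorem lintegral_Ioo_rpow_div_one_add {β t : ℝ} (h0 : 0 < β) (h1 : β < 1) (ht : 0 < t) :
    ∫⁻ u in Set.Ioo 0 t, ENNReal.ofReal (u ^ (-β) / (1 + u) * (t - u) ^ (β - 1)) =
      ENNReal.ofReal (Real.pi / Real.sin (Real.pi * β) * (1 + t) ^ (β - 1)) := by
  have hE : ∀ w ∈ Set.Ioo (0 : ℝ) 1, 0 < 1 + t - t * w := fun w hw => by nlinarith [hw.2]
  -- The Möbius map that fixes `0`, sends `1` to `t` and `∞` to the pole `u = -1`. In terms of `E =
  -- 1 + t - t * w` one has `1 + u = (1 + t) / E` and `t - u = t * (1 + t) * (1 - w) / E`; all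
  -- powers of `E` cancel against the derivative and a beta integral is left.
  have himg : (fun w : ℝ => t * w / (1 + t - t * w)) '' Set.Ioo 0 1 = Set.Ioo 0 t := by
    ext u
    constructor
    · rintro ⟨w, hw, rfl⟩
      have := hE w hw
      have h0 := hw.1
      refine ⟨by positivity, ?_⟩
      rw [div_lt_iff₀ this]; nlinarith [hw.2, mul_pos ht ht]
    · rintro ⟨hu, hut⟩
      refine ⟨u * (1 + t) / (t * (1 + u)), ⟨by positivity, ?_⟩, ?_⟩
      · rw [div_lt_one (by positivity)]; nlinarith
      · have : 1 + t - t * (u * (1 + t) / (t * (1 + u))) = (1 + t) / (1 + u) := by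
          field_simp; ring
        simp only [this]; field_simp
  have hder : ∀ w ∈ Set.Ioo (0 : ℝ) 1, HasDerivWithinAt (fun w : ℝ => t * w / (1 + t - t * w))
      (t * (1 + t) / (1 + t - t * w) ^ 2) (Set.Ioo 0 1) w := by
    intro w hw
    have hd : HasDerivAt (fun w : ℝ => t * w) t w := by
      simpa using (hasDerivAt_id w).const_mul t
    refine ((hd.div (hd.const_sub (1 + t)) (hE w hw).ne').hasDerivWithinAt).congr_deriv ?_
    congr 1; ring
  rw [← himg, lintegral_image_eq_lintegral_abs_deriv_mul measurableSet_Ioo hder,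
    ENNReal.ofReal_mul' (by positivity), ← beta_one_sub,
    show beta β (1 - β) = beta (1 - β) β by simp [beta, mul_comm],
    ← lintegral_Ioo_zero_one_beta (by linarith : 0 < 1 - β) h0,
    ← lintegral_mul_const' _ _ ENNReal.ofReal_ne_top]
  · refine setLIntegral_congr_fun measurableSet_Ioo fun w hw => ?_
    have h0 := hw.1
    have hE' := hE w hw
    have hw1 : 0 < 1 - w := by linarith [hw.2]
    have e1 : 1 + t * w / (1 + t - t * w) = (1 + t) / (1 + t - t * w) := by field_simp; ring
    have e2 : t - t * w / (1 + t - t * w) = t * (1 + t) * (1 - w) / (1 + t - t * w) := by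
      field_simp; ring
    rw [abs_of_pos (by positivity), ← ENNReal.ofReal_mul (by positivity),
      ← ENNReal.ofReal_mul (by positivity)]
    congr 1
    rw [e1, e2]
    set E := 1 + t - t * w
    rw [Real.div_rpow (by positivity) hE'.le, Real.div_rpow (by positivity) hE'.le,
      Real.mul_rpow (by positivity) hw1.le, Real.mul_rpow ht.le h0.le,
      Real.mul_rpow ht.le (by positivity), Real.rpow_neg hE'.le, Real.rpow_neg ht.le,
      Real.rpow_sub hE', Real.rpow_sub ht, Real.rpow_one, Real.rpow_one,
      show (1 : ℝ) - β - 1 = -β by ring]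
    have a1 := Real.rpow_pos_of_pos hE' β
    have a2 := Real.rpow_pos_of_pos ht β
    field_simp
  · intro v hv w hw hvw
    have h1 := hE v hv
    have h2 := hE w hw
    simp only at hvw
    rw [div_eq_div_iff h1.ne' h2.ne'] at hvw
    have : t * (1 + t) * (v - w) = 0 := by nlinarith
    have := (mul_eq_zero.mp this).resolve_left (by positivity)
    linarith

/-! ### The law of the overshoot -/

/-- The generalized arcsine density of the overshoot over the level `1`. -/
noncomputable def overshootDensity (β u : ℝ) : ℝ :=
  Real.sin (Real.pi * β) / Real.pi * (u ^ (-β) / (1 + u))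

/-- The law of the overshoot of a `β`-stable subordinator over the level `1`. -/
noncomputable def overshootLaw (β : ℝ) : Measure ℝ :=
  (volume.restrict (Set.Ioi 0)).withDensity fun u => ENNReal.ofReal (overshootDensity β u)

/-- The renewal identity `(δ₁ * ν) * U = U` on `(1, ∞)` for the potential measure
`U(dx) = x ^ (β - 1) dx`, translated by `-1`. -/
def HasPotentialIdentity (β : ℝ) (ν : Measure ℝ) : Prop :=
  ∀ φ : ℝ → ℝ≥0∞, Measurable φ →
    ∫⁻ b, (∫⁻ y in Set.Ioi (0 : ℝ), φ (b + y) * ENNReal.ofReal (y ^ (β - 1))) ∂ν =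
      ∫⁻ t in Set.Ioi (0 : ℝ), φ t * ENNReal.ofReal ((1 + t) ^ (β - 1))

@[fun_prop]
theorem measurable_overshootDensity (β : ℝ) : Measurable (overshootDensity β) := by
  unfold overshootDensity; fun_prop

theorem lintegral_overshootLaw (β : ℝ) {f : ℝ → ℝ≥0∞} (hf : Measurable f) :
    ∫⁻ u, f u ∂(overshootLaw β) =
      ∫⁻ u in Set.Ioi 0, ENNReal.ofReal (overshootDensity β u) * f u := by
  rw [overshootLaw, lintegral_withDensity_eq_lintegral_mul _ (by fun_prop) hf]
  rfl

theorem ae_overshootLaw_pos (β : ℝ) : ∀ᵐ u ∂(overshootLaw β), 0 < u :=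
  (withDensity_absolutelyContinuous _ _).ae_le (ae_restrict_mem measurableSet_Ioi)

theorem setLIntegral_triangle_swap {f : ℝ → ℝ → ℝ≥0∞} (hf : Measurable (Function.uncurry f)) :
    ∫⁻ u in Set.Ioi (0 : ℝ), ∫⁻ t in Set.Ioi u, f u t =
      ∫⁻ t in Set.Ioi (0 : ℝ), ∫⁻ u in Set.Ioo 0 t, f u t := by
  have hT : MeasurableSet {p : ℝ × ℝ | 0 < p.1 ∧ p.1 < p.2} :=
    (measurableSet_lt measurable_const measurable_fst).inter
      (measurableSet_lt measurable_fst measurable_snd)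
  set F : ℝ × ℝ → ℝ≥0∞ := Set.indicator {p : ℝ × ℝ | 0 < p.1 ∧ p.1 < p.2} (Function.uncurry f)
  have hF : Measurable F := hf.indicator hT
  have h1 : ∫⁻ u in Set.Ioi (0 : ℝ), ∫⁻ t in Set.Ioi u, f u t = ∫⁻ u, ∫⁻ t, F (u, t) := by
    rw [← lintegral_indicator measurableSet_Ioi]
    refine lintegral_congr fun u => ?_
    by_cases hu : u ∈ Set.Ioi (0 : ℝ)
    · rw [Set.indicator_of_mem hu, ← lintegral_indicator measurableSet_Ioi]
      refine lintegral_congr fun t => ?_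
      have hu' : 0 < u := hu
      simp [F, Set.indicator_apply, hu']
    · have hu' : ¬ 0 < u := hu
      simp [F, hu']
  have h2 : ∫⁻ t in Set.Ioi (0 : ℝ), ∫⁻ u in Set.Ioo 0 t, f u t = ∫⁻ t, ∫⁻ u, F (u, t) := by
    rw [← lintegral_indicator measurableSet_Ioi]
    refine lintegral_congr fun t => ?_
    by_cases ht : t ∈ Set.Ioi (0 : ℝ)
    · rw [Set.indicator_of_mem ht, ← lintegral_indicator measurableSet_Ioo]
      refine lintegral_congr fun u => ?_
      simp [F, Set.indicator_apply]
    · have ht' : ¬ 0 < t := ht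
      have : ∀ u, F (u, t) = 0 := fun u => by
        simp only [F, Set.indicator_apply]
        rw [if_neg]
        rintro ⟨h, h'⟩
        exact ht' (h.trans h')
      simp [this, ht']
  rw [h1, h2, lintegral_lintegral_swap (f := fun u t => F (u, t)) hF.aemeasurable]

/-- With `t = u + y` and Tonelli on `0 < u < t`, the factor of `φ t` becomes the convolution
`lintegral_Ioo_rpow_div_one_add`, whose constant `π / sin (π β)` cancels the normalization of the
density. -/
theorem hasPotentialIdentity_overshootLaw {β : ℝ} (h0 : 0 < β) (h1 : β < 1) :
    HasPotentialIdentity β (overshootLaw β) := by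
  intro φ hφ
  have hsin := sin_pi_mul_pos h0 h1
  have hm : Measurable fun p : ℝ × ℝ => φ (p.1 + p.2) * ENNReal.ofReal (p.2 ^ (β - 1)) := by
    fun_prop
  rw [lintegral_overshootLaw β (f := fun b => ∫⁻ y in Set.Ioi (0 : ℝ), φ (b + y) *
    ENNReal.ofReal (y ^ (β - 1))) hm.lintegral_prod_right']
  have e1 : ∀ u, ENNReal.ofReal (overshootDensity β u) *
      ∫⁻ y in Set.Ioi (0 : ℝ), φ (u + y) * ENNReal.ofReal (y ^ (β - 1)) =
      ∫⁻ t in Set.Ioi u, ENNReal.ofReal (overshootDensity β u) *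
        (φ t * ENNReal.ofReal ((t - u) ^ (β - 1))) := fun u => by
    rw [lintegral_const_mul' _ _ ENNReal.ofReal_ne_top]
    congr 1
    have := setLIntegral_Ioi_comp_add_left u 0
      (fun t => φ t * ENNReal.ofReal ((t - u) ^ (β - 1)))
    simpa using this
  simp_rw [e1]
  rw [setLIntegral_triangle_swap (f := fun u t => ENNReal.ofReal (overshootDensity β u) *
    (φ t * ENNReal.ofReal ((t - u) ^ (β - 1)))) (by simp only [Function.uncurry_def]; fun_prop)]
  refine setLIntegral_congr_fun measurableSet_Ioi fun t ht => ?_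
  have ht : 0 < t := ht
  have e2 : ∀ u ∈ Set.Ioo 0 t, ENNReal.ofReal (overshootDensity β u) *
      (φ t * ENNReal.ofReal ((t - u) ^ (β - 1))) =
      (φ t * ENNReal.ofReal (Real.sin (Real.pi * β) / Real.pi)) *
        ENNReal.ofReal (u ^ (-β) / (1 + u) * (t - u) ^ (β - 1)) := fun u hu => by
    have := hu.1
    rw [mul_left_comm, mul_assoc, ← ENNReal.ofReal_mul (by unfold overshootDensity; positivity),
      ← ENNReal.ofReal_mul (by positivity), overshootDensity, mul_assoc]
  rw [setLIntegral_congr_fun measurableSet_Ioo e2, lintegral_const_mul _ (by fun_prop),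
    lintegral_Ioo_rpow_div_one_add h0 h1 ht, mul_assoc, ← ENNReal.ofReal_mul (by positivity)]
  congr 2
  field_simp

/-- Abel inversion: the test function `(x - t) ^ (-β)` on `t < x` is chosen because its convolution
with `y ^ (β - 1)` is constant on `(-∞, x)`. The right-hand side does not involve `ν`, so the
identity determines `ν (Iio x)`. -/
theorem HasPotentialIdentity.measure_Iio {β : ℝ} (h0 : 0 < β) (h1 : β < 1) {ν : Measure ℝ}
    (h : HasPotentialIdentity β ν) (x : ℝ) :
    ν (Set.Iio x) * ENNReal.ofReal (beta β (1 - β)) =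
      ∫⁻ t in Set.Ioi (0 : ℝ), (Set.Iio x).indicator (fun t => ENNReal.ofReal ((x - t) ^ (-β))) t *
        ENNReal.ofReal ((1 + t) ^ (β - 1)) := by
  rw [← h _ ((by fun_prop : Measurable fun t : ℝ => ENNReal.ofReal ((x - t) ^ (-β))).indicator
    measurableSet_Iio)]
  have key : ∀ b, ∫⁻ y in Set.Ioi (0 : ℝ),
      (Set.Iio x).indicator (fun t => ENNReal.ofReal ((x - t) ^ (-β))) (b + y) *
        ENNReal.ofReal (y ^ (β - 1)) =
      (Set.Iio x).indicator (fun _ => ENNReal.ofReal (beta β (1 - β))) b := by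
    intro b
    have e : ∀ y ∈ Set.Ioi (0 : ℝ),
        (Set.Iio x).indicator (fun t => ENNReal.ofReal ((x - t) ^ (-β))) (b + y) *
          ENNReal.ofReal (y ^ (β - 1)) = (Set.Iio (x - b)).indicator
          (fun y => ENNReal.ofReal (y ^ (β - 1) * (x - b - y) ^ ((1 - β) - 1))) y := by
      intro y hy
      have hy : 0 < y := hy
      by_cases hb : b + y < x
      · rw [Set.indicator_of_mem (by exact hb), Set.indicator_of_mem (by simp; linarith),
          ENNReal.ofReal_mul (by positivity), mul_comm]
        congr 3 <;> ring
      · rw [Set.indicator_of_notMem (by exact hb), Set.indicator_of_notMem (by simp; linarith),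
          zero_mul]
    rw [setLIntegral_congr_fun measurableSet_Ioi e, setLIntegral_indicator measurableSet_Iio,
      Set.Iio_inter_Ioi]
    by_cases hb : b < x
    · rw [lintegral_Ioo_beta h0 (by linarith) (by linarith), Set.indicator_of_mem (by exact hb)]
      simp
    · rw [Set.indicator_of_notMem (by exact hb), Set.Ioo_eq_empty (by linarith)]
      simp
  rw [lintegral_congr key, lintegral_indicator measurableSet_Iio, lintegral_const,
    Measure.restrict_apply_univ, mul_comm]

theorem HasPotentialIdentity.measure_eq {β : ℝ} (h0 : 0 < β) (h1 : β < 1) {ν κ : Measure ℝ}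
    [IsProbabilityMeasure ν] [IsProbabilityMeasure κ] (hν : HasPotentialIdentity β ν)
    (hκ : HasPotentialIdentity β κ) : ν = κ := by
  refine Measure.ext_of_Ici _ _ fun x => ?_
  have hb : ENNReal.ofReal (beta β (1 - β)) ≠ 0 := by
    simpa using beta_pos h0 (by linarith : 0 < 1 - β)
  have : ν (Set.Iio x) = κ (Set.Iio x) := by
    have := (hν.measure_Iio h0 h1 x).trans (hκ.measure_Iio h0 h1 x).symm
    exact (ENNReal.mul_left_inj hb ENNReal.ofReal_ne_top).mp this
  rw [← Set.compl_Iio, prob_compl_eq_one_sub measurableSet_Iio,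
    prob_compl_eq_one_sub measurableSet_Iio, this]

/-- A beta integral with parameters `1 - β + s` and `β - s`, evaluated by the reflection formula.
Integrability at infinity is the condition `s < β`. -/
theorem lintegral_rpow_overshootLaw {β s : ℝ} (h0 : 0 < β) (h1 : β < 1) (hs : 0 ≤ s)
    (hsβ : s < β) :
    ∫⁻ u, ENNReal.ofReal (u ^ s) ∂(overshootLaw β) =
      ENNReal.ofReal (Real.sin (Real.pi * β) / Real.sin (Real.pi * (β - s))) := by
  have hsin := sin_pi_mul_pos h0 h1
  rw [lintegral_overshootLaw β (by fun_prop)]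
  have e : ∀ u ∈ Set.Ioi (0 : ℝ),
      ENNReal.ofReal (overshootDensity β u) * ENNReal.ofReal (u ^ s) =
      ENNReal.ofReal (Real.sin (Real.pi * β) / Real.pi) *
        ENNReal.ofReal (u ^ ((1 - β + s) - 1) * (1 + u) ^ (-((1 - β + s) + (β - s)))) := by
    intro u hu
    have hu : 0 < u := hu
    rw [← ENNReal.ofReal_mul (by unfold overshootDensity; positivity),
      ← ENNReal.ofReal_mul (by positivity), overshootDensity]
    congr 1
    rw [show -((1 - β + s) + (β - s)) = -1 by ring, Real.rpow_neg_one,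
      show (1 - β + s) - 1 = -β + s by ring, Real.rpow_add hu]
    ring
  rw [setLIntegral_congr_fun measurableSet_Ioi e, lintegral_const_mul' _ _ ENNReal.ofReal_ne_top,
    lintegral_Ioi_beta (by linarith) (by linarith), ← ENNReal.ofReal_mul (by positivity)]
  congr 1
  have : beta (1 - β + s) (β - s) = beta (β - s) (1 - (β - s)) := by
    rw [beta, beta, mul_comm]; congr 2 <;> ring_nf
  rw [this, beta_one_sub]
  have := Real.pi_pos
  field_simp

theorem isProbabilityMeasure_overshootLaw {β : ℝ} (h0 : 0 < β) (h1 : β < 1) :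
    IsProbabilityMeasure (overshootLaw β) := by
  have := lintegral_rpow_overshootLaw h0 h1 le_rfl h0
  have hsin := sin_pi_mul_pos h0 h1
  constructor
  simpa [div_self hsin.ne'] using this

/-- The moments of order `s` of two overshoots contract for `s` below `β₁ + β₂ - 1`. -/
theorem overshoot_moments_lt_one {β₁ β₂ s : ℝ} (hβ₁ : β₁ ∈ Set.Ioo (0 : ℝ) 1)
    (hβ₂ : β₂ ∈ Set.Ioo (0 : ℝ) 1) (hs : 0 < s) (hsβ : s < β₁ + β₂ - 1) :
    Real.sin (Real.pi * β₁) / Real.sin (Real.pi * (β₁ - s)) *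
      (Real.sin (Real.pi * β₂) / Real.sin (Real.pi * (β₂ - s))) < 1 := by
  have hpi := Real.pi_pos
  have h1 := sin_pi_mul_pos (β := β₁ - s) (by linarith [hβ₂.2]) (by linarith [hβ₁.2])
  have h2 := sin_pi_mul_pos (β := β₂ - s) (by linarith [hβ₁.2]) (by linarith [hβ₂.2])
  rw [div_mul_div_comm, div_lt_one (by positivity)]
  -- In `2 sin x sin y = cos (x - y) - cos (x + y)` the difference of the angles does not change
  -- when `s` is subtracted from both indices. With `h = β₁ + β₂ - 1`, only `cos (π h) < cos (π |h -
  -- 2 s|)` remains, which holds because `|h - 2 s| < h` for `0 < s < h`.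
  have prod : ∀ x y : ℝ, 2 * (Real.sin x * Real.sin y) = Real.cos (x - y) - Real.cos (x + y) :=
    fun x y => by rw [Real.cos_sub, Real.cos_add]; ring
  have e1 := prod (Real.pi * β₁) (Real.pi * β₂)
  have e2 := prod (Real.pi * (β₁ - s)) (Real.pi * (β₂ - s))
  have c1 : Real.cos (Real.pi * β₁ + Real.pi * β₂) =
      -Real.cos (Real.pi * (β₁ + β₂ - 1)) := by
    rw [← Real.cos_add_pi]; congr 1; ring
  have c2 : Real.cos (Real.pi * (β₁ - s) + Real.pi * (β₂ - s)) =
      -Real.cos (Real.pi * |β₁ + β₂ - 1 - 2 * s|) := by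
    rw [← abs_of_pos hpi, ← abs_mul, Real.cos_abs, abs_of_pos hpi, ← Real.cos_add_pi]
    congr 1; ring
  have c3 : Real.pi * (β₁ - s) - Real.pi * (β₂ - s) = Real.pi * β₁ - Real.pi * β₂ := by ring
  have lt : Real.cos (Real.pi * (β₁ + β₂ - 1)) <
      Real.cos (Real.pi * |β₁ + β₂ - 1 - 2 * s|) := by
    refine Real.cos_lt_cos_of_nonneg_of_le_pi (by positivity) ?_ ?_
    · nlinarith [hβ₁.2, hβ₂.2]
    · refine mul_lt_mul_of_pos_left ?_ hpi
      rw [abs_lt]; constructor <;> linarith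
  rw [c1] at e1
  rw [c2, c3] at e2
  linarith

/-! ### The distribution function of the first intersection time -/

/-- The distribution function of the first intersection time at distance `1`, written as a
convolution integral with values in `ℝ≥0∞`. -/
noncomputable def hittingCDF (β₁ β₂ x : ℝ) : ℝ≥0∞ :=
  ENNReal.ofReal (1 / (Real.Gamma (β₁ + β₂ - 1) * Real.Gamma (1 - (β₁ + β₂ - 1)))) *
    ∫⁻ t in Set.Ioo 0 x,
      ENNReal.ofReal ((1 + t) ^ (β₁ - 1) * t ^ (β₂ - 1) * (x - t) ^ (-(β₁ + β₂ - 1)))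

theorem hittingCDF_of_nonpos (β₁ β₂ : ℝ) {x : ℝ} (hx : x ≤ 0) : hittingCDF β₁ β₂ x = 0 := by
  rw [hittingCDF, Set.Ioo_eq_empty (by linarith)]; simp

/-- Substitute `t = x * y`: the three exponents add up to `-1` and cancel the Jacobian. The
convolution form suits the recursion; this one, with a fixed domain, suits monotonicity, continuity
and the limit at infinity. -/
theorem hittingCDF_eq_unit (β₁ β₂ : ℝ) {x : ℝ} (hx : 0 < x) :
    hittingCDF β₁ β₂ x =
      ENNReal.ofReal (1 / (Real.Gamma (β₁ + β₂ - 1) * Real.Gamma (1 - (β₁ + β₂ - 1)))) *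
      ∫⁻ y in Set.Ioo (0 : ℝ) 1,
        ENNReal.ofReal ((1 / x + y) ^ (β₁ - 1) * y ^ (β₂ - 1) * (1 - y) ^ (-(β₁ + β₂ - 1))) := by
  rw [hittingCDF, setLIntegral_Ioo_comp_mul_left hx,
    ← lintegral_const_mul' _ _ ENNReal.ofReal_ne_top]
  congr 1
  refine setLIntegral_congr_fun measurableSet_Ioo fun y hy => ?_
  have hy0 := hy.1
  have hy1 : 0 < 1 - y := by linarith [hy.2]
  rw [← ENNReal.ofReal_mul hx.le]
  congr 1
  rw [show 1 + x * y = x * (1 / x + y) by field_simp, show x - x * y = x * (1 - y) by ring,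
    Real.mul_rpow hx.le (by positivity), Real.mul_rpow hx.le hy0.le, Real.mul_rpow hx.le hy1.le]
  have : x * (x ^ (β₁ - 1) * x ^ (β₂ - 1) * x ^ (-(β₁ + β₂ - 1))) = 1 := by
    rw [← Real.rpow_add hx, ← Real.rpow_add hx,
      show β₁ - 1 + (β₂ - 1) + -(β₁ + β₂ - 1) = -1 by ring, Real.rpow_neg_one,
      mul_inv_cancel₀ hx.ne']
  linear_combination ((1 / x + y) ^ (β₁ - 1) * y ^ (β₂ - 1) * (1 - y) ^ (-(β₁ + β₂ - 1))) * this

theorem gamma_mul_gamma_pos {h : ℝ} (h0 : 0 < h) (h1 : h < 1) :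
    0 < Real.Gamma h * Real.Gamma (1 - h) :=
  mul_pos (Real.Gamma_pos_of_pos h0) (Real.Gamma_pos_of_pos (by linarith))

theorem intersectionCDF_eq_toReal {β₁ β₂ x : ℝ} (h0 : 0 < β₁ + β₂ - 1) (h1 : β₁ + β₂ - 1 < 1)
    (hx : 0 < x) : intersectionCDF β₁ β₂ x 1 = (hittingCDF β₁ β₂ x).toReal := by
  have hK := gamma_mul_gamma_pos h0 h1
  rw [intersectionCDF, hittingCDF_eq_unit β₁ β₂ hx, ENNReal.toReal_mul,
    ENNReal.toReal_ofReal (by positivity), intervalIntegral.integral_of_le zero_le_one,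
    integral_Ioc_eq_integral_Ioo, integral_eq_lintegral_of_nonneg_ae]
  · filter_upwards [ae_restrict_mem measurableSet_Ioo] with y hy
    have hy0 := hy.1
    have hy1 : 0 < 1 - y := by linarith [hy.2]
    simp only [Pi.zero_apply]
    positivity
  · exact Measurable.aestronglyMeasurable (by fun_prop)

/-- The power `(1 + 1 / w) ^ γ` misses `1` by at most `w ^ (-r)`. For `w ≤ 1` the error term alone
suffices; for `w > 1` both exponents may be lowered to `-1`. -/
theorem one_le_one_add_inv_rpow_add {γ r w : ℝ} (hγ0 : -1 ≤ γ) (hr0 : 0 ≤ r) (hr1 : r ≤ 1)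
    (hw : 0 < w) : 1 ≤ (1 + 1 / w) ^ γ + w ^ (-r) := by
  rcases le_or_gt w 1 with h | h
  · have : 1 ≤ w ^ (-r) := Real.one_le_rpow_of_pos_of_le_one_of_nonpos hw h (by linarith)
    have : 0 < (1 + 1 / w) ^ γ := by positivity
    linarith
  · have h1 : (1 + 1 / w) ^ (-1 : ℝ) ≤ (1 + 1 / w) ^ γ :=
      Real.rpow_le_rpow_of_exponent_le (by have : 0 < 1 / w := by positivity
                                           linarith) hγ0
    have h2 : w ^ (-1 : ℝ) ≤ w ^ (-r) := Real.rpow_le_rpow_of_exponent_le h.le (by linarith)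
    rw [Real.rpow_neg_one] at h1 h2
    have h3 : 1 ≤ (1 + 1 / w)⁻¹ + w⁻¹ := by
      rw [show (1 + 1 / w)⁻¹ = w / (w + 1) by field_simp, inv_eq_one_div,
        div_add_div _ _ (by positivity) (by positivity), le_div_iff₀ (by positivity)]
      nlinarith
    linarith

/-- The case `r = 0` is the normalization, and `r > 0` controls the tail; integrability at `0` is
what requires `r < β₁ + β₂ - 1`. -/
theorem lintegral_Ioo_intersection {β₁ β₂ r : ℝ} (hr : r < β₁ + β₂ - 1) (h1 : β₁ + β₂ - 1 < 1) :
    ∫⁻ y in Set.Ioo (0 : ℝ) 1,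
      ENNReal.ofReal (y ^ (-r) * y ^ (β₁ - 1) * y ^ (β₂ - 1) * (1 - y) ^ (-(β₁ + β₂ - 1))) =
      ENNReal.ofReal (beta (β₁ + β₂ - 1 - r) (1 - (β₁ + β₂ - 1))) := by
  rw [← lintegral_Ioo_zero_one_beta (by linarith) (by linarith)]
  refine setLIntegral_congr_fun measurableSet_Ioo fun y hy => ?_
  have hy0 := hy.1
  rw [← Real.rpow_add hy0, ← Real.rpow_add hy0]
  congr 3 <;> ring

/-- The integrand is the limit as `x → ∞` of the one in `hittingCDF_eq_unit` and dominates it when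
`β₁ < 1`, because `1 / x + y ≥ y` and the exponent `β₁ - 1` is negative. It thus provides the upper
bound `1`, the value at infinity and the dominating function for continuity. -/
theorem hittingCDF_normalization {β₁ β₂ : ℝ} (h0 : 0 < β₁ + β₂ - 1) (h1 : β₁ + β₂ - 1 < 1) :
    ENNReal.ofReal (1 / (Real.Gamma (β₁ + β₂ - 1) * Real.Gamma (1 - (β₁ + β₂ - 1)))) *
      ∫⁻ y in Set.Ioo (0 : ℝ) 1,
        ENNReal.ofReal (y ^ (β₁ - 1) * y ^ (β₂ - 1) * (1 - y) ^ (-(β₁ + β₂ - 1))) = 1 := by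
  have hK := gamma_mul_gamma_pos h0 h1
  have := lintegral_Ioo_intersection (r := 0) h0 h1
  simp only [neg_zero, Real.rpow_zero, one_mul, sub_zero] at this
  rw [this, ← ENNReal.ofReal_mul (by positivity), beta, add_sub_cancel, Real.Gamma_one, div_one,
    one_div_mul_cancel hK.ne', ENNReal.ofReal_one]

theorem hittingCDF_le_one {β₁ β₂ : ℝ} (hβ₁ : β₁ < 1) (h0 : 0 < β₁ + β₂ - 1)
    (h1 : β₁ + β₂ - 1 < 1) (x : ℝ) : hittingCDF β₁ β₂ x ≤ 1 := by
  rcases le_or_gt x 0 with hx | hx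
  · simp [hittingCDF_of_nonpos β₁ β₂ hx]
  rw [hittingCDF_eq_unit β₁ β₂ hx, ← hittingCDF_normalization h0 h1]
  gcongr ENNReal.ofReal _ * ?_
  refine setLIntegral_mono' measurableSet_Ioo fun y hy => ENNReal.ofReal_le_ofReal ?_
  have hy0 := hy.1
  have hy1 : 0 < 1 - y := by linarith [hy.2]
  gcongr ?_ * _ * _
  have : 0 < 1 / x := by positivity
  exact Real.rpow_le_rpow_of_nonpos hy0 (by linarith) (by linarith)

theorem monotone_hittingCDF {β₁ : ℝ} (hβ₁ : β₁ < 1) (β₂ : ℝ) : Monotone (hittingCDF β₁ β₂) := by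
  intro x z hxz
  rcases le_or_gt x 0 with hx | hx
  · simp [hittingCDF_of_nonpos β₁ β₂ hx]
  have hz := hx.trans_le hxz
  rw [hittingCDF_eq_unit β₁ β₂ hx, hittingCDF_eq_unit β₁ β₂ hz]
  gcongr ENNReal.ofReal _ * ?_
  refine setLIntegral_mono' measurableSet_Ioo fun y hy => ENNReal.ofReal_le_ofReal ?_
  have hy0 := hy.1
  have hy1 : 0 < 1 - y := by linarith [hy.2]
  gcongr ?_ * _ * _
  refine Real.rpow_le_rpow_of_nonpos (by positivity) ?_ (by linarith)
  gcongr

theorem one_le_hittingCDF_add {β₁ β₂ r : ℝ} (hβ₁ : β₁ ∈ Set.Ioo (0 : ℝ) 1)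
    (h1 : β₁ + β₂ - 1 < 1) (hr0 : 0 ≤ r) (hr : r < β₁ + β₂ - 1) :
    ∃ C : ℝ, 0 ≤ C ∧ ∀ x, 0 < x →
      1 ≤ hittingCDF β₁ β₂ x + ENNReal.ofReal (C * x ^ (-r)) := by
  have h0 : 0 < β₁ + β₂ - 1 := by linarith
  have hK := gamma_mul_gamma_pos h0 h1
  have hB := beta_pos (α := β₁ + β₂ - 1 - r) (β := 1 - (β₁ + β₂ - 1)) (by linarith) (by linarith)
  refine ⟨1 / (Real.Gamma (β₁ + β₂ - 1) * Real.Gamma (1 - (β₁ + β₂ - 1))) *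
    beta (β₁ + β₂ - 1 - r) (1 - (β₁ + β₂ - 1)), by positivity, fun x hx => ?_⟩
  rw [hittingCDF_eq_unit β₁ β₂ hx, ← hittingCDF_normalization h0 h1, mul_assoc,
    ENNReal.ofReal_mul (p := 1 / _) (by positivity), ← mul_add, mul_comm (beta _ _),
    ENNReal.ofReal_mul (by positivity), ← lintegral_Ioo_intersection hr h1,
    ← lintegral_const_mul' (ENNReal.ofReal (x ^ (-r))) _ ENNReal.ofReal_ne_top,
    ← lintegral_add_left (by fun_prop)]
  gcongr ENNReal.ofReal _ * ?_
  refine setLIntegral_mono' measurableSet_Ioo fun y hy => ?_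
  have hy0 := hy.1
  have hy1 : 0 < 1 - y := by linarith [hy.2]
  rw [← ENNReal.ofReal_mul (by positivity), ← ENNReal.ofReal_add (by positivity) (by positivity)]
  refine ENNReal.ofReal_le_ofReal ?_
  -- Writing `1 / x + y = y * (1 + 1 / (x * y))` suggests `w = x * y`; the error `(x * y) ^ (-r)`
  -- then integrates to a multiple of `x ^ (-r)`.
  have key := one_le_one_add_inv_rpow_add (γ := β₁ - 1) (r := r) (w := x * y)
    (by linarith [hβ₁.1]) hr0 (by linarith) (by positivity)
  have e : (1 / x + y) = y * (1 + 1 / (x * y)) := by field_simp; ring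
  rw [e, Real.mul_rpow hy0.le (by positivity)]
  rw [Real.mul_rpow hx.le hy0.le] at key
  have hp : 0 ≤ y ^ (β₁ - 1) * y ^ (β₂ - 1) * (1 - y) ^ (-(β₁ + β₂ - 1)) := by positivity
  nlinarith [mul_le_mul_of_nonneg_left key hp]

theorem continuousAt_hittingCDF {β₁ β₂ x : ℝ} (hβ₁ : β₁ < 1) (h0 : 0 < β₁ + β₂ - 1)
    (h1 : β₁ + β₂ - 1 < 1) (hx : 0 < x) : ContinuousAt (hittingCDF β₁ β₂) x := by
  have hK := gamma_mul_gamma_pos h0 h1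
  have hev : (fun z => ENNReal.ofReal
      (1 / (Real.Gamma (β₁ + β₂ - 1) * Real.Gamma (1 - (β₁ + β₂ - 1)))) *
      ∫⁻ y in Set.Ioo (0 : ℝ) 1,
        ENNReal.ofReal ((1 / z + y) ^ (β₁ - 1) * y ^ (β₂ - 1) * (1 - y) ^ (-(β₁ + β₂ - 1))))
      =ᶠ[nhds x] hittingCDF β₁ β₂ := by
    filter_upwards [Ioi_mem_nhds hx] with z hz
    exact (hittingCDF_eq_unit β₁ β₂ hz).symm
  refine ContinuousAt.congr ?_ hev
  refine ENNReal.Tendsto.const_mul ?_ (Or.inr ENNReal.ofReal_ne_top)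
  refine tendsto_lintegral_filter_of_dominated_convergence
    (fun y => ENNReal.ofReal (y ^ (β₁ - 1) * y ^ (β₂ - 1) * (1 - y) ^ (-(β₁ + β₂ - 1))))
    (Filter.Eventually.of_forall fun z => by fun_prop) ?_ ?_ ?_
  · filter_upwards [Ioi_mem_nhds hx] with z hz
    filter_upwards [ae_restrict_mem measurableSet_Ioo] with y hy
    refine ENNReal.ofReal_le_ofReal ?_
    have hy0 := hy.1
    have hy1 : 0 < 1 - y := by linarith [hy.2]
    gcongr ?_ * _ * _
    have : 0 < 1 / z := one_div_pos.mpr hz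
    exact Real.rpow_le_rpow_of_nonpos hy0 (by linarith) (by linarith)
  · intro h
    have := hittingCDF_normalization h0 h1
    rw [h, ENNReal.mul_top (ENNReal.ofReal_pos.mpr (one_div_pos.mpr hK)).ne'] at this
    exact ENNReal.top_ne_one this
  · filter_upwards [ae_restrict_mem measurableSet_Ioo] with y hy
    have hy0 := hy.1
    refine ENNReal.tendsto_ofReal ?_
    have : ContinuousAt (fun z : ℝ => (1 / z + y) ^ (β₁ - 1)) x := by
      refine ContinuousAt.rpow_const ?_ (Or.inl (by positivity))
      exact (continuousAt_const.div continuousAt_id hx.ne').add continuousAt_const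
    exact (this.mul continuousAt_const).mul continuousAt_const

/-- The recursion for the distribution function of the first intersection time. -/
theorem lintegral_hittingCDF_overshootLaw {β₁ β₂ : ℝ} (hβ₁ : β₁ ∈ Set.Ioo (0 : ℝ) 1) (x : ℝ) :
    ∫⁻ b, hittingCDF β₂ β₁ (x / b - 1) ∂(overshootLaw β₁) = hittingCDF β₁ β₂ x := by
  set K := ENNReal.ofReal (1 / (Real.Gamma (β₁ + β₂ - 1) * Real.Gamma (1 - (β₁ + β₂ - 1))))
  -- This `φ` makes both sides of the potential identity hitting functions: against `(1 + t) ^ (β₁ -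
  -- 1)` it gives `hittingCDF β₁ β₂ x`, and against `y ^ (β₁ - 1)` after a shift by `b` it gives, by
  -- scaling, `hittingCDF β₂ β₁ (x / b - 1)`, both up to the common constant `K`.
  set φ : ℝ → ℝ≥0∞ := (Set.Iio x).indicator fun t =>
    ENNReal.ofReal (t ^ (β₂ - 1) * (x - t) ^ (-(β₁ + β₂ - 1))) with hφ
  have hφm : Measurable φ := Measurable.indicator (by fun_prop) measurableSet_Iio
  have e : ∀ b, 0 < b → hittingCDF β₂ β₁ (x / b - 1) =
      K * ∫⁻ y in Set.Ioi (0 : ℝ), φ (b + y) * ENNReal.ofReal (y ^ (β₁ - 1)) := by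
    intro b hb
    have e1 : ∀ y ∈ Set.Ioi (0 : ℝ), φ (b + y) * ENNReal.ofReal (y ^ (β₁ - 1)) =
        (Set.Iio (x - b)).indicator (fun y => ENNReal.ofReal
          ((b + y) ^ (β₂ - 1) * (x - (b + y)) ^ (-(β₁ + β₂ - 1)) * y ^ (β₁ - 1))) y := by
      intro y hy
      have hy : 0 < y := hy
      by_cases hby : b + y < x
      · have : 0 < x - (b + y) := by linarith
        rw [hφ, Set.indicator_of_mem (by exact hby), Set.indicator_of_mem (by simp; linarith),
          ← ENNReal.ofReal_mul (by positivity)]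
      · rw [hφ, Set.indicator_of_notMem (by exact hby), Set.indicator_of_notMem (by simp; linarith),
          zero_mul]
    rw [setLIntegral_congr_fun measurableSet_Ioi e1, setLIntegral_indicator measurableSet_Iio,
      Set.Iio_inter_Ioi, hittingCDF, show x / b - 1 = b⁻¹ * (x - b) by field_simp,
      setLIntegral_Ioo_mul_left (by positivity), ← lintegral_const_mul' _ _ ENNReal.ofReal_ne_top]
    congr 1
    · simp only [K]; congr 5 <;> ring
    · refine setLIntegral_congr_fun measurableSet_Ioo fun y hy => ?_
      have hy0 := hy.1
      have hy1 : 0 < x - (b + y) := by linarith [hy.2]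
      rw [← ENNReal.ofReal_mul (by positivity)]
      congr 1
      rw [show 1 + b⁻¹ * y = b⁻¹ * (b + y) by field_simp,
        show b⁻¹ * (x - b) - b⁻¹ * y = b⁻¹ * (x - (b + y)) by ring,
        Real.mul_rpow (by positivity) (by positivity), Real.mul_rpow (by positivity) hy0.le,
        Real.mul_rpow (by positivity) hy1.le, show β₂ + β₁ - 1 = β₁ + β₂ - 1 by ring]
      have hb' : 0 < b⁻¹ := by positivity
      have : b⁻¹ * (b⁻¹ ^ (β₂ - 1) * b⁻¹ ^ (β₁ - 1) * b⁻¹ ^ (-(β₁ + β₂ - 1))) = 1 := by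
        rw [← Real.rpow_add hb', ← Real.rpow_add hb',
          show β₂ - 1 + (β₁ - 1) + -(β₁ + β₂ - 1) = -1 by ring, Real.rpow_neg_one,
          mul_inv_cancel₀ hb'.ne']
      linear_combination
        ((b + y) ^ (β₂ - 1) * (x - (b + y)) ^ (-(β₁ + β₂ - 1)) * y ^ (β₁ - 1)) * this
  have hm : Measurable fun p : ℝ × ℝ => φ (p.1 + p.2) * ENNReal.ofReal (p.2 ^ (β₁ - 1)) := by
    fun_prop
  rw [lintegral_congr_ae ((ae_overshootLaw_pos β₁).mono e),
    lintegral_const_mul' _ _ ENNReal.ofReal_ne_top,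
    hasPotentialIdentity_overshootLaw hβ₁.1 hβ₁.2 φ hφm, hittingCDF]
  congr 1
  have e2 : ∀ t ∈ Set.Ioi (0 : ℝ), φ t * ENNReal.ofReal ((1 + t) ^ (β₁ - 1)) =
      (Set.Iio x).indicator (fun t => ENNReal.ofReal
        ((1 + t) ^ (β₁ - 1) * t ^ (β₂ - 1) * (x - t) ^ (-(β₁ + β₂ - 1)))) t := by
    intro t ht
    have ht : 0 < t := ht
    by_cases htx : t < x
    · have : 0 < x - t := by linarith
      rw [hφ, Set.indicator_of_mem (by exact htx), Set.indicator_of_mem (by exact htx),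
        ← ENNReal.ofReal_mul (by positivity)]
      congr 1; ring
    · rw [hφ, Set.indicator_of_notMem (by exact htx), Set.indicator_of_notMem (by exact htx),
        zero_mul]
  rw [setLIntegral_congr_fun measurableSet_Ioi e2, setLIntegral_indicator measurableSet_Iio,
    Set.Iio_inter_Ioi]

/-! ### Euler's integral for the hypergeometric function -/

/-- Euler's integral representation of the Gauss hypergeometric function. -/
noncomputable def eulerHypergeometric (a b c : ℝ) (z : ℂ) : ℂ :=
  ((Real.Gamma c / (Real.Gamma b * Real.Gamma (c - b)) : ℝ) : ℂ) *
    ∫ t in Set.Ioo (0 : ℝ) 1,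
      ((t ^ (b - 1) * (1 - t) ^ (c - b - 1) : ℝ) : ℂ) * (1 - z * t) ^ (-a : ℂ)

theorem integrableOn_beta {p q : ℝ} (hp : 0 < p) (hq : 0 < q) :
    IntegrableOn (fun t : ℝ => t ^ (p - 1) * (1 - t) ^ (q - 1)) (Set.Ioo 0 1) := by
  refine ⟨Measurable.aestronglyMeasurable (by fun_prop), ?_⟩
  rw [hasFiniteIntegral_iff_ofReal, lintegral_Ioo_zero_one_beta hp hq]
  · exact ENNReal.ofReal_lt_top
  · filter_upwards [ae_restrict_mem measurableSet_Ioo] with t ht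
    exact mul_nonneg (Real.rpow_nonneg ht.1.le _) (Real.rpow_nonneg (by linarith [ht.2]) _)

theorem integral_Ioo_beta {p q : ℝ} (hp : 0 < p) (hq : 0 < q) :
    ∫ t in Set.Ioo (0 : ℝ) 1, t ^ (p - 1) * (1 - t) ^ (q - 1) = beta p q := by
  rw [integral_eq_lintegral_of_nonneg_ae, lintegral_Ioo_zero_one_beta hp hq,
    ENNReal.toReal_ofReal (beta_pos hp hq).le]
  · filter_upwards [ae_restrict_mem measurableSet_Ioo] with t ht
    exact mul_nonneg (Real.rpow_nonneg ht.1.le _) (Real.rpow_nonneg (by linarith [ht.2]) _)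
  · exact Measurable.aestronglyMeasurable (by fun_prop)

/-- The slit plane is star-shaped about `1`, and `1 - z * t = (1 - t) * 1 + t * (1 - z)`. -/
theorem one_sub_mul_mem_slitPlane {z : ℂ} (hz : 1 - z ∈ Complex.slitPlane) {t : ℝ} (h0 : 0 ≤ t)
    (h1 : t ≤ 1) : 1 - z * t ∈ Complex.slitPlane := by
  have := Complex.starConvex_one_slitPlane hz (sub_nonneg.mpr h1) h0 (by ring)
  convert! this using 1
  simp only [Complex.real_smul, Complex.ofReal_sub, Complex.ofReal_one]
  ring

theorem differentiableOn_eulerHypergeometric {a b c : ℝ} (hb : 0 < b) (hbc : b < c) :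
    DifferentiableOn ℂ (eulerHypergeometric a b c) {z | 1 - z ∈ Complex.slitPlane} := by
  intro z₀ hz₀
  refine DifferentiableAt.differentiableWithinAt (DifferentiableAt.const_mul ?_ _)
  have hopen : IsOpen {z : ℂ | 1 - z ∈ Complex.slitPlane} :=
    Complex.isOpen_slitPlane.preimage (by fun_prop)
  obtain ⟨ε, hε, hball⟩ := Metric.nhds_basis_closedBall.mem_iff.mp (hopen.mem_nhds hz₀)
  -- Differentiation under the integral: this `z`-derivative of the kernel is continuous, hence
  -- bounded, on the compact set `closedBall z₀ ε × [0, 1]`, so a multiple of the integrable beta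
  -- weight dominates.
  set F' : ℂ → ℝ → ℂ := fun z t => (-a : ℂ) * (1 - z * t) ^ (-a - 1 : ℂ) * (-t) with hF'
  have hcont : ContinuousOn (fun p : ℂ × ℝ => F' p.1 p.2)
      (Metric.closedBall z₀ ε ×ˢ Set.Icc (0 : ℝ) 1) := by
    refine (continuousOn_const.mul (ContinuousOn.cpow_const (by fun_prop) ?_)).mul (by fun_prop)
    rintro ⟨z, t⟩ ⟨hz, ht⟩
    exact one_sub_mul_mem_slitPlane (hball hz) ht.1 ht.2
  obtain ⟨C, hC⟩ := ((isCompact_closedBall z₀ ε).prod isCompact_Icc).exists_bound_of_continuousOn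
    hcont
  have hw := integrableOn_beta hb (by linarith : 0 < c - b)
  have hz₀m : ContinuousOn (fun t : ℝ => (1 - z₀ * t) ^ (-a : ℂ)) (Set.Icc (0 : ℝ) 1) :=
    ContinuousOn.cpow_const (by fun_prop) fun t ht => one_sub_mul_mem_slitPlane hz₀ ht.1 ht.2
  obtain ⟨C₀, hC₀⟩ := isCompact_Icc.exists_bound_of_continuousOn hz₀m
  have hmeas : ∀ z, AEStronglyMeasurable (fun t : ℝ =>
      ((t ^ (b - 1) * (1 - t) ^ (c - b - 1) : ℝ) : ℂ) * (1 - z * t) ^ (-a : ℂ))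
      (volume.restrict (Set.Ioo (0 : ℝ) 1)) := fun z =>
    Measurable.aestronglyMeasurable (by fun_prop)
  refine (hasDerivAt_integral_of_dominated_loc_of_deriv_le
    (F' := fun z t => ((t ^ (b - 1) * (1 - t) ^ (c - b - 1) : ℝ) : ℂ) * F' z t)
    (bound := fun t => ‖t ^ (b - 1) * (1 - t) ^ (c - b - 1)‖ * C)
    (Metric.closedBall_mem_nhds z₀ hε) (Filter.Eventually.of_forall hmeas) ?_ ?_ ?_
    (hw.norm.mul_const C) ?_).2.differentiableAt
  · refine (hw.norm.mul_const C₀).mono' (hmeas z₀) ?_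
    filter_upwards [ae_restrict_mem measurableSet_Ioo] with t ht
    rw [norm_mul, Complex.norm_real]
    exact mul_le_mul_of_nonneg_left (hC₀ t ⟨ht.1.le, ht.2.le⟩) (norm_nonneg _)
  · exact Measurable.aestronglyMeasurable (by fun_prop)
  · filter_upwards [ae_restrict_mem measurableSet_Ioo] with t ht z hz
    rw [norm_mul, Complex.norm_real]
    exact mul_le_mul_of_nonneg_left (hC (z, t) ⟨hz, ht.1.le, ht.2.le⟩) (norm_nonneg _)
  · filter_upwards [ae_restrict_mem measurableSet_Ioo] with t ht z hz
    refine HasDerivAt.const_mul _ ?_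
    have h1 : HasDerivAt (fun z : ℂ => 1 - z * t) (-(t : ℂ)) z := by
      simpa using ((hasDerivAt_id z).mul_const (t : ℂ)).const_sub 1
    exact h1.cpow_const (one_sub_mul_mem_slitPlane (hball hz) ht.1.le ht.2.le)

theorem hasSum_one_sub_cpow_neg (a : ℂ) {x : ℂ} (hx : ‖x‖ < 1) :
    HasSum (fun n : ℕ => ((n.factorial : ℂ)⁻¹ * (ascPochhammer ℂ n).eval a) * x ^ n)
      ((1 - x) ^ (-a)) := by
  have h := (Complex.one_add_cpow_hasFPowerSeriesOnBall_zero (a := -a)).hasSum (y := -x)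
    (by simpa [Metric.mem_eball, edist_zero_right, ← ofReal_norm] using hx)
  rw [zero_add, ← sub_eq_add_neg,
    -- The parameter `b` occurs above and below and cancels; any value other than a nonpositive
    -- integer would do.
    binomialSeries_eq_ordinaryHypergeometricSeries (b := (1 : ℂ))
      (by intro k hk; have := congrArg Complex.re hk; simp at this; linarith)] at h
  refine h.congr_fun fun n => ?_
  simp only [FormalMultilinearSeries.compContinuousLinearMap_apply]
  rw [show (⇑(-ContinuousLinearMap.id ℂ ℂ) ∘ fun _ : Fin n => -x) = fun _ => x by ext; simp,
    ordinaryHypergeometricSeries_apply_eq, neg_neg, smul_eq_mul, mul_inv_cancel_right₀]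
  simp [ascPochhammer_eval_one, Nat.factorial_ne_zero]

/-- Expand `(1 - z t) ^ (-a)` in its binomial series and integrate term by term. The `n`-th moment
of the weight is `beta (b + n) (c - b)`, and divided by `beta b (c - b)` it is the quotient of the
Pochhammer symbols of `b` and `c`. -/
theorem eulerHypergeometric_eq {a b c : ℝ} (hb : 0 < b) (hbc : b < c) {z : ℂ} (hz : ‖z‖ < 1) :
    eulerHypergeometric a b c z = ordinaryHypergeometric (a : ℂ) (b : ℂ) (c : ℂ) z := by
  have hw := integrableOn_beta hb (by linarith : 0 < c - b)
  set k : ℕ → ℂ := fun n => ((n.factorial : ℂ)⁻¹ * (ascPochhammer ℂ n).eval (a : ℂ)) with hk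
  set f : ℕ → ℝ → ℂ := fun n t =>
    ((t ^ (b - 1) * (1 - t) ^ (c - b - 1) : ℝ) : ℂ) * (k n * (z * t) ^ n) with hf
  have hsum : Summable fun n => ‖k n‖ * ‖z‖ ^ n := by
    have := (hasSum_one_sub_cpow_neg (a : ℂ) (x := (‖z‖ : ℂ)) (by simpa using hz)).summable.norm
    simpa [hk] using this
  have hfle : ∀ n, ∀ t ∈ Set.Ioo (0 : ℝ) 1, ‖f n t‖ ≤
      ‖t ^ (b - 1) * (1 - t) ^ (c - b - 1)‖ * (‖k n‖ * ‖z‖ ^ n) := by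
    intro n t ht
    simp only [hf]
    rw [norm_mul, Complex.norm_real, norm_mul (k n), norm_pow, norm_mul z, Complex.norm_real,
      Real.norm_of_nonneg ht.1.le]
    gcongr
    · exact mul_nonneg (norm_nonneg z) ht.1.le
    · exact mul_le_of_le_one_right (norm_nonneg z) ht.2.le
  have hfm : ∀ n, AEStronglyMeasurable (f n) (volume.restrict (Set.Ioo (0 : ℝ) 1)) := fun n =>
    Measurable.aestronglyMeasurable (by simp only [hf]; fun_prop)
  have hfi : ∀ n, Integrable (f n) (volume.restrict (Set.Ioo (0 : ℝ) 1)) := fun n => by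
    refine (hw.norm.mul_const (‖k n‖ * ‖z‖ ^ n)).mono' (hfm n) ?_
    filter_upwards [ae_restrict_mem measurableSet_Ioo] with t ht using hfle n t ht
  have hI := hasSum_integral_of_summable_integral_norm hfi <| by
    refine Summable.of_nonneg_of_le (fun n => integral_nonneg fun t => norm_nonneg _)
      (fun n => ?_)
      (hsum.mul_left (∫ t in Set.Ioo (0 : ℝ) 1, ‖t ^ (b - 1) * (1 - t) ^ (c - b - 1)‖))
    rw [← integral_mul_const]
    refine integral_mono_ae (hfi n).norm (hw.norm.mul_const _) ?_
    filter_upwards [ae_restrict_mem measurableSet_Ioo] with t ht using hfle n t ht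
  have hlim : ∫ t in Set.Ioo (0 : ℝ) 1, ∑' n, f n t = ∫ t in Set.Ioo (0 : ℝ) 1,
      ((t ^ (b - 1) * (1 - t) ^ (c - b - 1) : ℝ) : ℂ) * (1 - z * t) ^ (-a : ℂ) := by
    refine setIntegral_congr_fun measurableSet_Ioo fun t ht => ?_
    have : ‖z * (t : ℂ)‖ < 1 := by
      rw [norm_mul, Complex.norm_real, Real.norm_of_nonneg ht.1.le]
      exact (mul_le_of_le_one_right (norm_nonneg _) ht.2.le).trans_lt hz
    exact ((hasSum_one_sub_cpow_neg (a : ℂ) this).mul_left _).tsum_eq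
  rw [hlim] at hI
  have hcoef : ∀ n, ((Real.Gamma c / (Real.Gamma b * Real.Gamma (c - b)) : ℝ) : ℂ) *
      ∫ t in Set.Ioo (0 : ℝ) 1, f n t =
      ((n.factorial : ℂ)⁻¹ * (ascPochhammer ℂ n).eval (a : ℂ) * (ascPochhammer ℂ n).eval (b : ℂ) *
        ((ascPochhammer ℂ n).eval (c : ℂ))⁻¹) • z ^ n := by
    intro n
    have e1 : ∫ t in Set.Ioo (0 : ℝ) 1, f n t = (k n * z ^ n) * (beta (b + n) (c - b) : ℝ) := by
      rw [← integral_Ioo_beta (by positivity) (by linarith : 0 < c - b), ← integral_complex_ofReal,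
        ← integral_const_mul]
      refine setIntegral_congr_fun measurableSet_Ioo fun t ht => ?_
      have : t ^ (b + n - 1) = t ^ (b - 1) * t ^ n := by
        rw [show b + n - 1 = (b - 1) + n by ring, Real.rpow_add ht.1, Real.rpow_natCast]
      simp only [hf]
      rw [this]
      push_cast
      ring
    have hpoch : ∀ {y : ℝ}, 0 < y → (ascPochhammer ℂ n).eval (y : ℂ) =
        ((Real.Gamma (y + n) / Real.Gamma y : ℝ) : ℂ) := fun {y} hy => by
      rw [← Complex.Gamma_add_nat_div_Gamma_eq]
      · push_cast
        rw [← Complex.Gamma_ofReal, ← Complex.Gamma_ofReal]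
        push_cast
        rfl
      · intro m hm
        have := congrArg Complex.re hm
        simp at this
        have : (0 : ℝ) ≤ m := by positivity
        linarith
    rw [e1, hpoch hb, hpoch (hb.trans hbc), beta, smul_eq_mul, hk,
      show b + n + (c - b) = c + n by ring]
    have g1 := Real.Gamma_pos_of_pos hb
    have g2 := Real.Gamma_pos_of_pos (hb.trans hbc)
    have g3 := Real.Gamma_pos_of_pos (by linarith : 0 < c - b)
    have g4 := Real.Gamma_pos_of_pos (by have := hb.trans hbc; positivity : 0 < c + n)
    have : Real.Gamma c / (Real.Gamma b * Real.Gamma (c - b)) *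
        (Real.Gamma (b + n) * Real.Gamma (c - b) / Real.Gamma (c + n)) =
        (Real.Gamma (b + n) / Real.Gamma b) * (Real.Gamma (c + n) / Real.Gamma c)⁻¹ := by
      field_simp
    have := congrArg (fun x : ℝ => (x : ℂ)) this
    simp only [Complex.ofReal_mul, Complex.ofReal_inv] at this
    linear_combination
      ((n.factorial : ℂ)⁻¹ * (ascPochhammer ℂ n).eval (a : ℂ) * z ^ n) * this
  have hfin := hI.mul_left ((Real.Gamma c / (Real.Gamma b * Real.Gamma (c - b)) : ℝ) : ℂ)
  rw [eulerHypergeometric, ordinaryHypergeometric_eq_tsum, ← hfin.tsum_eq]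
  exact tsum_congr hcoef

theorem isGaussHypergeometric_eulerHypergeometric {a b c : ℝ} (hb : 0 < b) (hbc : b < c) :
    IsGaussHypergeometric a b c (eulerHypergeometric a b c) :=
  ⟨differentiableOn_eulerHypergeometric hb hbc, fun _ hz => eulerHypergeometric_eq hb hbc hz⟩

/-- Pull `(a / x) ^ (β₁ - 1)` out of the integral. For the stated parameters `c - b = 1 - (β₁ + β₂ -
1)`, so Euler's weight is the one in `intersectionCDF`, and the Gamma factors in front of Euler's
integral cancel accordingly. -/
theorem intersectionCDF_eq_eulerHypergeometric {β₁ β₂ x a : ℝ} (hβ₁ : β₁ < 1) (hβ₂ : 0 < β₂)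
    (h1 : β₁ + β₂ < 2) (hx : 0 < x) (ha : 0 < a) :
    (intersectionCDF β₁ β₂ x a : ℂ) =
      (Real.Gamma β₂ / (Real.Gamma (β₁ + β₂ - 1) * Real.Gamma (2 - β₁)) *
        (a / x) ^ (β₁ - 1) : ℝ) *
          eulerHypergeometric (1 - β₁) β₂ (2 - β₁) (-(x / a) : ℝ) := by
  have g1 := Real.Gamma_pos_of_pos hβ₂
  have g2 := Real.Gamma_pos_of_pos (by linarith : 0 < 2 - β₁)
  have g3 := Real.Gamma_pos_of_pos (by linarith : 0 < 1 - (β₁ + β₂ - 1))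
  have hint : ∫ t in Set.Ioo (0 : ℝ) 1,
      ((t ^ (β₂ - 1) * (1 - t) ^ (2 - β₁ - β₂ - 1) : ℝ) : ℂ) *
        (1 - ((-(x / a) : ℝ) : ℂ) * t) ^ (-((1 - β₁ : ℝ) : ℂ)) =
      ((∫ t in Set.Ioo (0 : ℝ) 1, t ^ (β₂ - 1) * (1 - t) ^ (2 - β₁ - β₂ - 1) *
        (1 + x / a * t) ^ (β₁ - 1) : ℝ) : ℂ) := by
    rw [← integral_complex_ofReal]
    refine setIntegral_congr_fun measurableSet_Ioo fun t ht => ?_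
    have h0 := ht.1
    have e : (1 : ℂ) - ((-(x / a) : ℝ) : ℂ) * t = ((1 + x / a * t : ℝ) : ℂ) := by push_cast; ring
    rw [e, ← Complex.ofReal_neg, ← Complex.ofReal_cpow (by positivity), neg_sub]
    push_cast
    ring
  have hreal : intersectionCDF β₁ β₂ x a =
      1 / (Real.Gamma (β₁ + β₂ - 1) * Real.Gamma (1 - (β₁ + β₂ - 1))) * ((a / x) ^ (β₁ - 1) *
      ∫ t in Set.Ioo (0 : ℝ) 1, t ^ (β₂ - 1) * (1 - t) ^ (2 - β₁ - β₂ - 1) *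
        (1 + x / a * t) ^ (β₁ - 1)) := by
    rw [intersectionCDF, intervalIntegral.integral_of_le zero_le_one,
      integral_Ioc_eq_integral_Ioo, ← integral_const_mul ((a / x) ^ (β₁ - 1))]
    congr 1
    refine setIntegral_congr_fun measurableSet_Ioo fun t ht => ?_
    have h0 := ht.1
    rw [show a / x + t = a / x * (1 + x / a * t) by field_simp,
      Real.mul_rpow (by positivity) (by positivity),
      show 2 - β₁ - β₂ - 1 = -(β₁ + β₂ - 1) by ring]
    ring
  rw [eulerHypergeometric, hint, hreal, ← Complex.ofReal_mul, ← Complex.ofReal_mul,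
    show 2 - β₁ - β₂ = 1 - (β₁ + β₂ - 1) by ring]
  congr 1
  field_simp

/-! ### Measurability of operations on random closed sets -/

open TopologicalSpace in
theorem measurableSet_closeds_hit_isCompact {K : Set ℝ} (hK : IsCompact K) :
    MeasurableSet {F : Closeds ℝ | ((F : Set ℝ) ∩ K).Nonempty} :=
  MeasurableSpace.measurableSet_generateFrom ⟨K, hK, rfl⟩

-- An open subset of `ℝ` is a countable union of compact sets.
open TopologicalSpace in
theorem measurableSet_closeds_hit_isOpen {U : Set ℝ} (hU : IsOpen U) :
    MeasurableSet {F : Closeds ℝ | ((F : Set ℝ) ∩ U).Nonempty} := by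
  have hloc := hU.locallyCompactSpace
  obtain ⟨K, hK, hKU⟩ : IsSigmaCompact U :=
    isSigmaCompact_iff_sigmaCompactSpace.mpr inferInstance
  have : {F : Closeds ℝ | ((F : Set ℝ) ∩ U).Nonempty} =
      ⋃ n, {F : Closeds ℝ | ((F : Set ℝ) ∩ K n).Nonempty} := by
    ext F
    simp [← hKU, Set.inter_iUnion, Set.nonempty_iUnion]
  rw [this]
  exact MeasurableSet.iUnion fun n => measurableSet_closeds_hit_isCompact (hK n)

/-- The distances to fixed points serve as measurable coordinates on closed sets;
`measurable_closeds_of_infEDist` is the converse. The extended distance allows for the empty set,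
where it is `∞`. -/
theorem measurable_infEDist_closeds (q : ℝ) :
    Measurable fun F : TopologicalSpace.Closeds ℝ => Metric.infEDist q (F : Set ℝ) := by
  refine measurable_of_Iio fun r => ?_
  convert! measurableSet_closeds_hit_isOpen (U := Metric.eball q r) Metric.isOpen_eball using 1
  ext F
  simp only [Set.mem_preimage, Set.mem_Iio, Metric.infEDist_lt_iff]
  constructor
  · rintro ⟨y, hy, h⟩
    exact ⟨y, hy, by rwa [Metric.mem_eball']⟩
  · rintro ⟨y, hy, h⟩
    exact ⟨y, hy, by rwa [Metric.mem_eball'] at h⟩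

/-- The distance from a point to a closed set is jointly measurable. -/
theorem measurable_infEDist_uncurry :
    Measurable fun p : ℝ × TopologicalSpace.Closeds ℝ => Metric.infEDist p.1 (p.2 : Set ℝ) :=
  measurable_uncurry_of_continuous_of_measurable
    (u := fun (t : ℝ) (F : TopologicalSpace.Closeds ℝ) => Metric.infEDist t (F : Set ℝ))
    (fun _ => Metric.continuous_infEDist) measurable_infEDist_closeds

theorem Measurable.infEDist_closeds {S : Type*} [MeasurableSpace S] {t : S → ℝ}
    {Φ : S → TopologicalSpace.Closeds ℝ} (ht : Measurable t) (hΦ : Measurable Φ) :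
    Measurable fun s => Metric.infEDist (t s) (Φ s : Set ℝ) :=
  measurable_infEDist_uncurry.comp (ht.prodMk hΦ)

/-- Since a continuous function attains its infimum on a compact set, an uncountable existential
becomes a countable infimum. This is the source of all later measurability statements about hitting
a set. -/
theorem exists_eq_zero_iff_iInf_denseSeq {K : Set ℝ} (hK : IsCompact K) [Nonempty K]
    {g : ℝ → ℝ≥0∞} (hg : Continuous g) :
    (∃ x ∈ K, g x = 0) ↔ ⨅ n, g (TopologicalSpace.denseSeq K n) = 0 := by
  constructor
  · rintro ⟨x, hx, h0⟩
    refine le_antisymm (le_of_forall_gt fun ε hε => ?_) zero_le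
    have hopen : IsOpen {y : K | g y < ε} := isOpen_lt (hg.comp continuous_subtype_val)
      continuous_const
    obtain ⟨n, hn⟩ := (TopologicalSpace.denseRange_denseSeq K).exists_mem_open hopen
      ⟨⟨x, hx⟩, by simpa [h0] using hε⟩
    exact (iInf_le _ n).trans_lt hn
  · intro h
    obtain ⟨x, hx, hmin⟩ := hK.exists_isMinOn (Set.nonempty_coe_sort.mp ‹_›) hg.continuousOn
    refine ⟨x, hx, le_antisymm ?_ zero_le⟩
    rw [← h]
    exact le_iInf fun n => hmin (TopologicalSpace.denseSeq K n).2

theorem measurableSet_exists_mem_eq_zero {S : Type*} [MeasurableSpace S] {K : Set ℝ}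
    (hK : IsCompact K) {g : S → ℝ → ℝ≥0∞} (hg : ∀ s, Continuous (g s))
    (hm : ∀ r, Measurable fun s => g s r) : MeasurableSet {s | ∃ r ∈ K, g s r = 0} := by
  rcases K.eq_empty_or_nonempty with rfl | hne
  · simp
  have : Nonempty K := hne.to_subtype
  simp_rw [exists_eq_zero_iff_iInf_denseSeq hK (hg _)]
  exact (measurableSet_singleton 0).preimage (Measurable.iInf fun n => hm _)

theorem mem_closeds_iff_infEDist {F : TopologicalSpace.Closeds ℝ} {x : ℝ} :
    x ∈ F ↔ Metric.infEDist x (F : Set ℝ) = 0 := by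
  rw [← Metric.mem_closure_iff_infEDist_zero, F.isClosed.closure_eq]; rfl

theorem measurable_closeds_of_infEDist {S : Type*} [MeasurableSpace S]
    {Φ : S → TopologicalSpace.Closeds ℝ}
    (h : ∀ q, Measurable fun s => Metric.infEDist q (Φ s : Set ℝ)) : Measurable Φ := by
  refine measurable_generateFrom ?_
  rintro _ ⟨K, hK, rfl⟩
  have := measurableSet_exists_mem_eq_zero hK
    (g := fun s q => Metric.infEDist q (Φ s : Set ℝ)) (fun s => Metric.continuous_infEDist) h
  convert! this using 1
  ext s
  simp only [Set.mem_preimage, Set.mem_ofPred_eq, ← mem_closeds_iff_infEDist]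
  exact ⟨fun ⟨x, hx, hxK⟩ => ⟨x, hxK, hx⟩, fun ⟨x, hxK, hx⟩ => ⟨x, hx, hxK⟩⟩

/-- The closure of the range of a countable family depends measurably on the family. -/
theorem measurable_closeds_closure_range {ι : Type*} [Countable ι] :
    Measurable fun x : ι → ℝ => TopologicalSpace.Closeds.closure (Set.range x) := by
  refine measurable_closeds_of_infEDist fun q => ?_
  have : (fun x : ι → ℝ => Metric.infEDist q
      (TopologicalSpace.Closeds.closure (Set.range x) : Set ℝ)) =
      fun x => ⨅ i, edist q (x i) := by
    ext x
    rw [TopologicalSpace.Closeds.coe_closure, Metric.infEDist_closure, Metric.infEDist, iInf_range]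
  rw [this]
  fun_prop

/-- The part of `F` on `[t, ∞)`, translated to start in `[0, ∞)`. -/
def tailFrom (t : ℝ) (F : TopologicalSpace.Closeds ℝ) : TopologicalSpace.Closeds ℝ :=
  ⟨{x | 0 ≤ x ∧ t + x ∈ F}, isClosed_Ici.inter (F.isClosed.preimage (by fun_prop))⟩

theorem mem_tailFrom {t x : ℝ} {F : TopologicalSpace.Closeds ℝ} :
    x ∈ tailFrom t F ↔ 0 ≤ x ∧ t + x ∈ F := Iff.rfl

theorem measurable_tailFrom_uncurry :
    Measurable fun p : ℝ × TopologicalSpace.Closeds ℝ => tailFrom p.1 p.2 := by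
  refine measurable_generateFrom ?_
  rintro _ ⟨K, hK, rfl⟩
  have := measurableSet_exists_mem_eq_zero (hK.inter_right isClosed_Ici (t := Set.Ici (0 : ℝ)))
    (g := fun (p : ℝ × TopologicalSpace.Closeds ℝ) q => Metric.infEDist (p.1 + q) (p.2 : Set ℝ))
    (fun p => Metric.continuous_infEDist.comp (by fun_prop))
    (fun q => (measurable_fst.add_const q).infEDist_closeds measurable_snd)
  convert! this using 1
  ext p
  simp only [Set.mem_preimage, Set.mem_ofPred_eq, ← mem_closeds_iff_infEDist]
  exact ⟨fun ⟨x, ⟨h0, hx⟩, hxK⟩ => ⟨x, ⟨hxK, h0⟩, hx⟩,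
    fun ⟨x, ⟨hxK, h0⟩, hx⟩ => ⟨x, ⟨h0, hx⟩, hxK⟩⟩

/-- The first point of `F` on `[t, ∞)`. -/
noncomputable def nextPoint (t : ℝ) (F : TopologicalSpace.Closeds ℝ) : ℝ :=
  sInf ((F : Set ℝ) ∩ Set.Ici t)

theorem isLeast_nextPoint {t : ℝ} {F : TopologicalSpace.Closeds ℝ}
    (h : ((F : Set ℝ) ∩ Set.Ici t).Nonempty) :
    IsLeast ((F : Set ℝ) ∩ Set.Ici t) (nextPoint t F) :=
  have hb : BddBelow ((F : Set ℝ) ∩ Set.Ici t) := ⟨t, fun _ hx => hx.2⟩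
  ⟨(F.isClosed.inter isClosed_Ici).csInf_mem h hb, fun _ hx => csInf_le hb hx⟩

theorem exists_mem_Icc_iff_exists_unit {a z : ℝ} (hz : 0 ≤ z) {p : ℝ → Prop} :
    (∃ x ∈ Set.Icc a (a + z), p x) ↔ ∃ r ∈ Set.Icc (0 : ℝ) 1, p (a + r * z) := by
  constructor
  · rintro ⟨x, ⟨h1, h2⟩, hp⟩
    rcases hz.eq_or_lt with rfl | hz
    · exact ⟨0, by simp, by convert hp using 1; linarith⟩
    · refine ⟨(x - a) / z, ⟨div_nonneg (by linarith) hz.le, ?_⟩, ?_⟩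
      · rw [div_le_one hz]; linarith
      · convert hp using 1; field_simp; ring
  · rintro ⟨r, ⟨h0, h1⟩, hp⟩
    exact ⟨a + r * z, ⟨by nlinarith, by nlinarith⟩, hp⟩

/-- An interval with variable ends is parametrized by the fixed compact set `[0, 1]`; for negative
length it is empty, whence the extra condition on `p.1.2`. -/
theorem measurableSet_exists_mem_Icc :
    MeasurableSet {p : (ℝ × ℝ) × TopologicalSpace.Closeds ℝ |
      ∃ x ∈ Set.Icc p.1.1 (p.1.1 + p.1.2), x ∈ p.2} := by
  have h1 : MeasurableSet {p : (ℝ × ℝ) × TopologicalSpace.Closeds ℝ | 0 ≤ p.1.2} :=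
    measurableSet_le measurable_const (by fun_prop)
  have h2 := measurableSet_exists_mem_eq_zero (isCompact_Icc (a := (0 : ℝ)) (b := 1))
    (g := fun (p : (ℝ × ℝ) × TopologicalSpace.Closeds ℝ) r =>
      Metric.infEDist (p.1.1 + r * p.1.2) (p.2 : Set ℝ))
    (fun p => Metric.continuous_infEDist.comp (by fun_prop))
    (fun q => Measurable.infEDist_closeds (by fun_prop) measurable_snd)
  convert! h1.inter h2 using 1
  ext p
  simp only [Set.mem_inter_iff, Set.mem_ofPred_eq]
  constructor
  · rintro ⟨x, hx, hxF⟩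
    have hz : 0 ≤ p.1.2 := by linarith [hx.1, hx.2]
    refine ⟨hz, ?_⟩
    simp_rw [← mem_closeds_iff_infEDist]
    exact (exists_mem_Icc_iff_exists_unit (p := (· ∈ p.2)) hz).mp ⟨x, hx, hxF⟩
  · rintro ⟨hz, h⟩
    simp_rw [← mem_closeds_iff_infEDist] at h
    exact (exists_mem_Icc_iff_exists_unit (p := (· ∈ p.2)) hz).mpr h

theorem measurable_nextPoint_uncurry :
    Measurable fun p : ℝ × TopologicalSpace.Closeds ℝ => nextPoint p.1 p.2 := by
  set E : ℝ → Set (ℝ × TopologicalSpace.Closeds ℝ) := fun x =>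
    {p | ∃ y ∈ p.2, p.1 ≤ y ∧ y ≤ x} with hE
  have hEm : ∀ x, MeasurableSet (E x) := fun x => by
    have : E x = (fun p : ℝ × TopologicalSpace.Closeds ℝ => ((p.1, x - p.1), p.2)) ⁻¹'
        {p : (ℝ × ℝ) × TopologicalSpace.Closeds ℝ |
          ∃ x ∈ Set.Icc p.1.1 (p.1.1 + p.1.2), x ∈ p.2} := by
      ext p
      simp only [hE, Set.mem_ofPred_eq, Set.mem_preimage, add_sub_cancel, Set.mem_Icc]
      exact exists_congr fun y => and_comm
    rw [this]
    exact measurableSet_exists_mem_Icc.preimage (by fun_prop)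
  have hN : MeasurableSet (⋃ n : ℕ, E n) := MeasurableSet.iUnion fun n => hEm n
  refine measurable_of_Iic fun x => ?_
  -- If the closed set has no point in `[t, ∞)`, then `nextPoint` is `sInf ∅ = 0`, and the condition
  -- reduces to `0 ≤ x`.
  have : (fun p : ℝ × TopologicalSpace.Closeds ℝ => nextPoint p.1 p.2) ⁻¹' Set.Iic x =
      E x ∪ ((⋃ n : ℕ, E n)ᶜ ∩ {_p | 0 ≤ x}) := by
    ext p
    simp only [Set.mem_preimage, Set.mem_Iic, Set.mem_union, Set.mem_inter_iff, Set.mem_compl_iff,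
      Set.mem_ofPred_eq]
    by_cases hne : ((p.2 : Set ℝ) ∩ Set.Ici p.1).Nonempty
    · have hl := isLeast_nextPoint hne
      have hmem : p ∈ ⋃ n : ℕ, E n := by
        obtain ⟨y, hy, hty⟩ := hne
        obtain ⟨n, hn⟩ := exists_nat_ge y
        exact Set.mem_iUnion.mpr ⟨n, y, hy, hty, hn⟩
      simp only [hmem, not_true_eq_false, false_and, or_false]
      exact ⟨fun h => ⟨_, hl.1.1, hl.1.2, h⟩, fun ⟨y, hy, h1, h2⟩ => (hl.2 ⟨hy, h1⟩).trans h2⟩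
    · have hx : p ∉ E x := fun ⟨y, hy, h1, _⟩ => hne ⟨y, hy, h1⟩
      have hmem : p ∉ ⋃ n : ℕ, E n := fun h => by
        obtain ⟨n, y, hy, h1, _⟩ := Set.mem_iUnion.mp h
        exact hne ⟨y, hy, h1⟩
      rw [Set.not_nonempty_iff_eq_empty] at hne
      simp [nextPoint, hne, hx, hmem]
  rw [this]
  exact (hEm x).union (hN.compl.inter (MeasurableSet.const _))

/-! ### The strong Markov property of random walks at first passage times -/

theorem measurable_sInf_nat_setOf {Ω : Type*} [MeasurableSpace Ω] {p : ℕ → Ω → Prop}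
    (hp : ∀ k, MeasurableSet {ω | p k ω}) : Measurable fun ω => sInf {k | p k ω} := by
  refine measurable_of_Iic fun k => ?_
  -- The intersection accounts for the outcomes without any admissible index, where `sInf ∅ = 0`.
  have : (fun ω => sInf {k | p k ω}) ⁻¹' Set.Iic k =
      (⋃ j ∈ Finset.range (k + 1), {ω | p j ω}) ∪ ⋂ j, {ω | p j ω}ᶜ := by
    ext ω
    simp only [Set.mem_preimage, Set.mem_Iic, Set.mem_union, Set.mem_iUnion, Set.mem_iInter,
      Set.mem_compl_iff, Set.mem_ofPred_eq, Finset.mem_range, exists_prop]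
    by_cases h : {k | p k ω}.Nonempty
    · constructor
      · intro hk
        exact Or.inl ⟨_, by omega, Nat.sInf_mem h⟩
      · rintro (⟨j, hj, hpj⟩ | hn)
        · exact (Nat.sInf_le hpj).trans (by omega)
        · exact absurd h.some_mem (hn _)
    · rw [Set.not_nonempty_iff_eq_empty] at h
      simp only [h, Nat.sInf_empty, zero_le, true_iff]
      right
      intro j hj
      have : j ∈ {k | p k ω} := hj
      rw [h] at this
      exact this
  rw [this]
  exact ((Finset.range (k + 1)).measurableSet_biUnion fun j _ => hp j).union
    (MeasurableSet.iInter fun j => (hp j).compl)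

section RandomWalk

variable {Ω : Type*} [MeasurableSpace Ω] {P : Measure Ω} {ξ : ℕ → Ω → ℝ}

/-- A shifted i.i.d. sequence has the same law as the original one. -/
theorem map_shift_eq_of_iid [IsProbabilityMeasure P] (hm : ∀ i, Measurable (ξ i))
    (hi : iIndepFun ξ P) (hd : ∀ i, IdentDistrib (ξ i) (ξ 0) P P) (k : ℕ) :
    P.map (fun ω j => ξ (k + j) ω) = P.map (fun ω j => ξ j ω) := by
  have h1 := (iIndepFun_iff_map_fun_eq_infinitePi_map (fun i => hm i)).mp hi
  have h2 := (iIndepFun_iff_map_fun_eq_infinitePi_map (fun i => hm (k + i))).mp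
    (hi.precomp (g := fun j => k + j) (add_right_injective k))
  rw [h1, h2]
  congr 1
  ext1 j
  rw [(hd (k + j)).map_eq, (hd j).map_eq]

theorem indepFun_past_future [IsProbabilityMeasure P] (hm : ∀ i, Measurable (ξ i))
    (hi : iIndepFun ξ P) (k : ℕ) {A B : Type*} [MeasurableSpace A] [MeasurableSpace B]
    {U : Ω → A} {V : Ω → B}
    (hU : Measurable[⨆ i ∈ Set.Iio k, MeasurableSpace.comap (ξ i) inferInstance] U)
    (hV : Measurable[⨆ i ∈ Set.Ici k, MeasurableSpace.comap (ξ i) inferInstance] V) :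
    IndepFun U V P := by
  have h := indep_iSup_of_disjoint (fun i => (hm i).comap_le) hi (S := Set.Iio k) (T := Set.Ici k)
    (Set.disjoint_left.mpr fun i h1 h2 =>
      absurd (Set.mem_Iio.mp h1) (not_lt.mpr (Set.mem_Ici.mp h2)))
  exact indep_of_indep_of_le_left (indep_of_indep_of_le_right h hV.comap_le) hU.comap_le

/-- Strong Markov property of a random walk at the first passage time over a level `a`. -/
theorem integral_firstPassage_mul [IsProbabilityMeasure P] (hm : ∀ i, Measurable (ξ i))
    (hi : iIndepFun ξ P) (hd : ∀ i, IdentDistrib (ξ i) (ξ 0) P P) (a : ℝ)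
    (hpass : ∀ᵐ ω ∂P, ∃ k, a < ∑ i ∈ Finset.range k, ξ i ω) {J : Type*} [Finite J] (m : J → ℕ)
    (f : ℝ →ᵇ ℝ) (g : (J → ℝ) →ᵇ ℝ) :
    let S : ℕ → Ω → ℝ := fun k ω => ∑ i ∈ Finset.range k, ξ i ω
    let N : Ω → ℕ := fun ω => sInf {k | a < S k ω}
    ∫ ω, f (S (N ω) ω) * g (fun j => S (N ω + m j) ω - S (N ω) ω) ∂P =
      (∫ ω, f (S (N ω) ω) ∂P) * ∫ ω, g (fun j => S (m j) ω) ∂P := by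
  intro S N
  have := Fintype.ofFinite J
  have hS : ∀ k, Measurable (S k) := fun k => Finset.measurable_fun_sum _ fun i _ => hm i
  have hN : Measurable N :=
    measurable_sInf_nat_setOf fun k => measurableSet_lt measurable_const (hS k)
  have hSN : ∀ l, Measurable fun ω => S (N ω + l) ω := fun l => by
    have h1 : Measurable fun p : ℕ × Ω => S (p.1 + l) p.2 :=
      measurable_from_prod_countable_right fun k => hS (k + l)
    exact h1.comp (hN.prodMk measurable_id)
  have hSN0 : Measurable fun ω => S (N ω) ω := hSN 0
  have hgm : Measurable fun ω => g (fun j => S (N ω + m j) ω - S (N ω) ω) :=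
    g.continuous.measurable.comp (measurable_pi_lambda _ fun j => (hSN _).sub hSN0)
  have hfm : Measurable fun ω => f (S (N ω) ω) := f.continuous.measurable.comp hSN0
  have hfi : Integrable (fun ω => f (S (N ω) ω)) P :=
    Integrable.of_bound hfm.aestronglyMeasurable ‖f‖
      (Filter.Eventually.of_forall fun ω => f.norm_coe_le_norm _)
  have hfgi : Integrable (fun ω => f (S (N ω) ω) * g (fun j => S (N ω + m j) ω - S (N ω) ω)) P :=
    hfi.mul_bdd hgm.aestronglyMeasurable
      (Filter.Eventually.of_forall fun ω => g.norm_coe_le_norm _)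
  have hNm : ∀ k, MeasurableSet {ω | N ω = k} := fun k => hN (measurableSet_singleton k)
  have hdisj : Pairwise (Function.onFun Disjoint fun k => {ω | N ω = k}) := fun k l hkl =>
    Set.disjoint_left.mpr fun ω h1 h2 => hkl (h1.symm.trans h2)
  have hU : ⋃ k, {ω | N ω = k} = Set.univ := Set.eq_univ_of_forall fun ω => by simp
  have key : ∀ k, ∫ ω in {ω | N ω = k}, f (S (N ω) ω) *
      g (fun j => S (N ω + m j) ω - S (N ω) ω) ∂P =
      (∫ ω in {ω | N ω = k}, f (S (N ω) ω) ∂P) * ∫ ω, g (fun j => S (m j) ω) ∂P := by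
    intro k
    -- The event `N = k` expressed through `S 0, …, S k` alone, so that it belongs to the past of
    -- `k` and is independent of the later increments. The agreement is only almost sure, because `N
    -- = 0` by default when the level is never passed.
    set A : Set Ω := {ω | a < S k ω} ∩ ⋂ j ∈ Finset.range k, {ω | S j ω ≤ a} with hA
    have hAN : {ω | N ω = k} =ᵐ[P] A := by
      refine Filter.eventuallyEq_set.mpr ?_
      filter_upwards [hpass] with ω hω
      have hmem : a < S (N ω) ω := Nat.sInf_mem (s := {k | a < S k ω}) hω
      simp only [hA, Set.mem_inter_iff, Set.mem_iInter, Finset.mem_range, Set.mem_ofPred_eq]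
      constructor
      · rintro rfl
        exact ⟨hmem, fun j hj => not_lt.mp
          (Nat.notMem_of_lt_sInf (s := {k | a < S k ω}) hj)⟩
      · rintro ⟨h1, h2⟩
        refine le_antisymm (Nat.sInf_le h1) (not_lt.mp fun h => ?_)
        exact absurd hmem (not_lt.mpr (h2 _ h))
    have hpast : ∀ j ≤ k,
        Measurable[⨆ i ∈ Set.Iio k, MeasurableSpace.comap (ξ i) inferInstance] (S j) := by
      intro j hj
      refine Finset.measurable_fun_sum _ fun i hi => ?_
      have hik : i ∈ Set.Iio k := (Finset.mem_range.mp hi).trans_le hj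
      exact Measurable.mono (comap_measurable (ξ i))
        (le_iSup₂_of_le (f := fun i (_ : i ∈ Set.Iio k) =>
          MeasurableSpace.comap (ξ i) inferInstance) i hik le_rfl) le_rfl
    have hAm : MeasurableSet[⨆ i ∈ Set.Iio k, MeasurableSpace.comap (ξ i) inferInstance] A := by
      refine MeasurableSet.inter ?_ ((Finset.range k).measurableSet_biInter fun j hj => ?_)
      · exact hpast k le_rfl measurableSet_Ioi
      · exact hpast j (Finset.mem_range.mp hj).le measurableSet_Iic
    have hle : ⨆ i ∈ Set.Iio k, MeasurableSpace.comap (ξ i) inferInstance ≤ ‹MeasurableSpace Ω› :=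
      iSup₂_le fun i _ => (hm i).comap_le
    have hSk : ∀ j ω, S (k + j) ω - S k ω = ∑ i ∈ Finset.range j, ξ (k + i) ω := fun j ω => by
      simp only [S, Finset.sum_range_add, add_sub_cancel_left]
    have hind : IndepFun (A.indicator fun ω => f (S k ω))
        (fun ω => g (fun j => S (k + m j) ω - S k ω)) P := by
      refine indepFun_past_future hm hi k ?_ ?_
      · exact Measurable.indicator (f.continuous.measurable.comp (hpast k le_rfl)) hAm
      · refine g.continuous.measurable.comp
          (@measurable_pi_lambda Ω J (fun _ => ℝ) (_) _ _ fun j => ?_)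
        simp_rw [hSk]
        refine Finset.measurable_fun_sum _ fun i hi => ?_
        exact Measurable.mono (comap_measurable (ξ (k + i)))
          (le_iSup₂_of_le (f := fun i (_ : i ∈ Set.Ici k) =>
            MeasurableSpace.comap (ξ i) inferInstance) (k + i) (Nat.le_add_right k i) le_rfl) le_rfl
    have hlaw : ∫ ω, g (fun j => S (k + m j) ω - S k ω) ∂P = ∫ ω, g (fun j => S (m j) ω) ∂P := by
      have hw : Measurable fun x : ℕ → ℝ => g fun j => ∑ i ∈ Finset.range (m j), x i :=
        g.continuous.measurable.comp (by fun_prop)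
      have h1 := integral_map (μ := P) (φ := fun ω j => ξ (k + j) ω)
        (measurable_pi_lambda _ fun j => hm _).aemeasurable
        (f := fun x : ℕ → ℝ => g fun j => ∑ i ∈ Finset.range (m j), x i) hw.aestronglyMeasurable
      have h2 := integral_map (μ := P) (φ := fun ω j => ξ j ω)
        (measurable_pi_lambda _ fun j => hm _).aemeasurable
        (f := fun x : ℕ → ℝ => g fun j => ∑ i ∈ Finset.range (m j), x i) hw.aestronglyMeasurable
      rw [map_shift_eq_of_iid hm hi hd k] at h1
      simp_rw [hSk]
      exact h1.symm.trans h2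
    have hmA : MeasurableSet A := hle _ hAm
    have hfk : Measurable fun ω => f (S k ω) := f.continuous.measurable.comp (hS k)
    have hgk : Measurable fun ω => g (fun j => S (k + m j) ω - S k ω) :=
      g.continuous.measurable.comp (measurable_pi_lambda _ fun j => (hS _).sub (hS k))
    have e1 : ∫ ω in {ω | N ω = k}, f (S (N ω) ω) *
        g (fun j => S (N ω + m j) ω - S (N ω) ω) ∂P =
        ∫ ω in A, f (S k ω) * g (fun j => S (k + m j) ω - S k ω) ∂P := by
      rw [← setIntegral_congr_set hAN]
      exact setIntegral_congr_fun (hNm k) fun ω hω => by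
        have hω : N ω = k := hω
        simp only [hω]
    have e2 : ∫ ω in {ω | N ω = k}, f (S (N ω) ω) ∂P = ∫ ω in A, f (S k ω) ∂P := by
      rw [← setIntegral_congr_set hAN]
      exact setIntegral_congr_fun (hNm k) fun ω hω => by
        have hω : N ω = k := hω
        simp only [hω]
    rw [e1, e2, ← integral_indicator hmA, ← integral_indicator hmA, ← hlaw,
      ← hind.integral_fun_mul_eq_mul_integral (hfk.indicator hmA).aestronglyMeasurable
        hgk.aestronglyMeasurable]
    refine integral_congr_ae (Filter.Eventually.of_forall fun ω => ?_)
    by_cases hω : ω ∈ A <;> simp [hω]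
  have s1 := hasSum_integral_iUnion hNm hdisj (hfgi.integrableOn (s := ⋃ k, {ω | N ω = k}))
  have s2 := (hasSum_integral_iUnion hNm hdisj
    (hfi.integrableOn (s := ⋃ k, {ω | N ω = k}))).mul_right (∫ ω, g (fun j => S (m j) ω) ∂P)
  simp_rw [key] at s1
  have := s1.unique s2
  rwa [hU, setIntegral_univ, setIntegral_univ] at this

end RandomWalk

/-! ### Paths of subordinators -/

/-- Nondecreasing, right-continuous, unbounded functions that start at `0`. -/
structure IsSubordinatorPath (x : ℝ≥0 → ℝ) : Prop where
  zero : x 0 = 0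
  mono : Monotone x
  right_cont : ∀ t, ContinuousWithinAt x (Set.Ici t) t
  unbounded : ∀ M, ∃ t, M < x t

/-- The first passage time over the level `a`. -/
noncomputable def passageTime (x : ℝ≥0 → ℝ) (a : ℝ) : ℝ≥0 := sInf {t | a < x t}

/-- The first time in `2⁻ⁿ ℕ`, in units of `2⁻ⁿ`, at which the level `a` has been passed. -/
noncomputable def gridPassage (x : ℝ≥0 → ℝ) (a : ℝ) (n : ℕ) : ℕ := sInf {k : ℕ | a < x (k / 2 ^ n)}

/-- The dyadic time `k / 2ⁿ` for `i = (n, k)`. -/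
noncomputable def dyadicTime (i : ℕ × ℕ) : ℝ≥0 := i.2 / 2 ^ i.1

/-- The smallest multiple of `2⁻ⁿ` that exceeds `u`. -/
noncomputable def dyadicAbove (u : ℝ≥0) (n : ℕ) : ℕ × ℕ := (n, ⌊u * 2 ^ n⌋₊ + 1)

theorem tendsto_inv_two_pow_nnreal :
    Filter.Tendsto (fun n : ℕ => ((2 : ℝ≥0) ^ n)⁻¹) Filter.atTop (nhds 0) := by
  simp_rw [← inv_pow]
  exact NNReal.tendsto_pow_atTop_nhds_zero_of_lt_one (inv_lt_one_of_one_lt₀ one_lt_two)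

theorem lt_dyadicTime_dyadicAbove (u : ℝ≥0) (n : ℕ) : u < dyadicTime (dyadicAbove u n) := by
  rw [dyadicTime, dyadicAbove, lt_div_iff₀ (by positivity)]
  push_cast
  exact Nat.lt_floor_add_one _

theorem dyadicTime_dyadicAbove_le (u : ℝ≥0) (n : ℕ) :
    dyadicTime (dyadicAbove u n) ≤ u + (2 ^ n)⁻¹ := by
  rw [dyadicTime, dyadicAbove, div_le_iff₀ (by positivity), add_mul,
    inv_mul_cancel₀ (by positivity)]
  push_cast
  gcongr
  exact Nat.floor_le zero_le

theorem tendsto_of_le_of_le_add_inv {t : ℝ≥0} {u : ℕ → ℝ≥0} (h1 : ∀ n, t ≤ u n)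
    (h2 : ∀ n, u n ≤ t + (2 ^ n)⁻¹) : Filter.Tendsto u Filter.atTop (nhds t) := by
  refine tendsto_of_tendsto_of_tendsto_of_le_of_le tendsto_const_nhds ?_ h1 h2
  simpa using tendsto_inv_two_pow_nnreal.const_add t

theorem tendsto_dyadicAbove (u : ℝ≥0) :
    Filter.Tendsto (fun n => dyadicTime (dyadicAbove u n)) Filter.atTop (nhds u) :=
  tendsto_of_le_of_le_add_inv (fun n => (lt_dyadicTime_dyadicAbove u n).le)
    (dyadicTime_dyadicAbove_le u)

theorem tendsto_comp_of_right_cont {x : ℝ≥0 → ℝ} {t : ℝ≥0}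
    (hx : ContinuousWithinAt x (Set.Ici t) t) {u : ℕ → ℝ≥0} (h1 : ∀ n, t ≤ u n)
    (h2 : Filter.Tendsto u Filter.atTop (nhds t)) :
    Filter.Tendsto (fun n => x (u n)) Filter.atTop (nhds (x t)) :=
  Filter.Tendsto.comp hx (tendsto_nhdsWithin_iff.mpr ⟨h2, Filter.Eventually.of_forall h1⟩)

/-- The closed range of a right-continuous path is determined by its values at dyadic times. -/
theorem closure_range_eq_closure_range_dyadic {x : ℝ≥0 → ℝ}
    (hx : ∀ t, ContinuousWithinAt x (Set.Ici t) t) :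
    closure (Set.range x) = closure (Set.range fun i => x (dyadicTime i)) := by
  refine subset_antisymm (closure_minimal ?_ isClosed_closure) (closure_mono ?_)
  · rintro _ ⟨t, rfl⟩
    exact mem_closure_of_tendsto (tendsto_comp_of_right_cont (hx t)
      (fun n => (lt_dyadicTime_dyadicAbove t n).le) (tendsto_dyadicAbove t))
      (Filter.Eventually.of_forall fun n => ⟨_, rfl⟩)
  · rintro _ ⟨i, rfl⟩
    exact ⟨_, rfl⟩

theorem le_of_lt_passageTime {x : ℝ≥0 → ℝ} {a : ℝ} {t : ℝ≥0} (ht : t < passageTime x a) : x t ≤ a :=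
  not_lt.mp fun h => notMem_of_lt_csInf ht (OrderBot.bddBelow _) h

theorem passageTime_le {x : ℝ≥0 → ℝ} {a : ℝ} {t : ℝ≥0} (ht : a < x t) : passageTime x a ≤ t :=
  csInf_le (OrderBot.bddBelow _) ht

namespace IsSubordinatorPath

variable {x : ℝ≥0 → ℝ}

theorem lt_of_passageTime_lt (hx : IsSubordinatorPath x) {a : ℝ} {t : ℝ≥0}
    (ht : passageTime x a < t) : a < x t := by
  obtain ⟨s, hs, hst⟩ := exists_lt_of_csInf_lt (hx.unbounded a) ht
  exact lt_of_lt_of_le hs (hx.mono hst.le)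

theorem le_passage (hx : IsSubordinatorPath x) (a : ℝ) : a ≤ x (passageTime x a) :=
  ge_of_tendsto' (tendsto_comp_of_right_cont (hx.right_cont _)
    (fun n => (lt_dyadicTime_dyadicAbove _ n).le) (tendsto_dyadicAbove (passageTime x a)))
    fun n => (hx.lt_of_passageTime_lt (lt_dyadicTime_dyadicAbove _ n)).le

theorem exists_lt_grid (hx : IsSubordinatorPath x) (a : ℝ) (n : ℕ) :
    ∃ k : ℕ, a < x (k / 2 ^ n) := by
  obtain ⟨t, ht⟩ := hx.unbounded a
  exact ⟨_, ht.trans_le (hx.mono (lt_dyadicTime_dyadicAbove t n).le)⟩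

theorem passageTime_le_gridPassage (hx : IsSubordinatorPath x) (a : ℝ) (n : ℕ) :
    passageTime x a ≤ gridPassage x a n / 2 ^ n :=
  passageTime_le (Nat.sInf_mem (s := {k : ℕ | a < x (k / 2 ^ n)}) (hx.exists_lt_grid a n))

theorem gridPassage_le (hx : IsSubordinatorPath x) (a : ℝ) (n : ℕ) :
    (gridPassage x a n : ℝ≥0) / 2 ^ n ≤ passageTime x a + (2 ^ n)⁻¹ := by
  rcases Nat.eq_zero_or_pos (gridPassage x a n) with h | h
  · simp [h]
  · obtain ⟨k, hk⟩ := Nat.exists_eq_add_of_lt h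
    rw [zero_add] at hk
    have h1 : ¬ a < x (k / 2 ^ n) := fun h' =>
      Nat.notMem_of_lt_sInf (s := {k : ℕ | a < x (k / 2 ^ n)})
        (show k < gridPassage x a n by omega) h'
    have h2 : (k : ℝ≥0) / 2 ^ n ≤ passageTime x a :=
      not_lt.mp fun h' => h1 (hx.lt_of_passageTime_lt h')
    rw [hk]
    push_cast
    rw [add_div, one_div]
    gcongr

/-- Grid passage times lie to the right of the true passage time, at distance at most `2⁻ⁿ`, so
right continuity of the path applies. -/
theorem tendsto_gridPassage (hx : IsSubordinatorPath x) (a : ℝ) (t : ℝ≥0) :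
    Filter.Tendsto (fun n : ℕ => x (gridPassage x a n / 2 ^ n + t)) Filter.atTop
      (nhds (x (passageTime x a + t))) := by
  refine tendsto_comp_of_right_cont (hx.right_cont _)
    (fun n => by gcongr; exact hx.passageTime_le_gridPassage a n) ?_
  exact (tendsto_of_le_of_le_add_inv (hx.passageTime_le_gridPassage a)
    (hx.gridPassage_le a)).add_const t

theorem right_cont_shift (hx : IsSubordinatorPath x) (s t : ℝ≥0) :
    ContinuousWithinAt (fun u => x (s + u) - x s) (Set.Ici t) t := by
  refine ContinuousWithinAt.sub ?_ continuousWithinAt_const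
  refine (hx.right_cont (s + t)).comp (by fun_prop) fun u hu => ?_
  exact add_le_add_right (Set.mem_Ici.mp hu) s

end IsSubordinatorPath

/-! ### Elementary properties of stable subordinators -/

section Subordinator

variable {Ω : Type*} [MeasurableSpace Ω] {P : Measure Ω} {β : ℝ} {X : ℝ≥0 → Ω → ℝ}

theorem IsStableSubordinator.ae_nonneg (hX : IsStableSubordinator β X P) :
    ∀ᵐ ω ∂P, ∀ t, 0 ≤ X t ω := by
  filter_upwards [hX.start_zero, hX.monotone] with ω h0 hm t
  exact h0 ▸ hm (zero_le (a := t))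

theorem IsStableSubordinator.integrable_exp [IsProbabilityMeasure P]
    (hX : IsStableSubordinator β X P) {l : ℝ} (hl : 0 ≤ l) (t : ℝ≥0) :
    Integrable (fun ω => Real.exp (-l * X t ω)) P := by
  refine Integrable.of_bound (C := 1)
    (Real.measurable_exp.comp ((hX.measurable t).const_mul _)).aestronglyMeasurable ?_
  filter_upwards [hX.ae_nonneg] with ω h
  rw [Real.norm_of_nonneg (Real.exp_pos _).le, Real.exp_le_one_iff]
  nlinarith [h t]

/-- Chernoff's bound at exponent `-1`: the probability of staying below `n` up to time `k` is at
most `exp n * exp (-c * k)`, which tends to `0` as `k → ∞`. -/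
theorem IsStableSubordinator.ae_unbounded [IsProbabilityMeasure P]
    (hX : IsStableSubordinator β X P) : ∀ᵐ ω ∂P, ∀ M, ∃ t, M < X t ω := by
  obtain ⟨c, hc, hlap⟩ := hX.laplace
  have key : ∀ n : ℕ, ∀ᵐ ω ∂P, ∃ t, (n : ℝ) < X t ω := by
    intro n
    rw [ae_iff]
    have hle : ∀ k : ℕ, P.real {ω | ¬ ∃ t, (n : ℝ) < X t ω} ≤ Real.exp n * Real.exp (-c * k) := by
      intro k
      have h1 := measure_le_le_exp_mul_mgf (X := X k) (μ := P) (t := -1) n (by norm_num)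
        (hX.integrable_exp zero_le_one k)
      have h2 : mgf (X k) P (-1) = Real.exp (-c * k) := by
        have := hlap k 1 zero_le_one
        simpa [mgf] using this
      rw [h2, neg_neg, one_mul] at h1
      refine le_trans (measureReal_mono fun ω hω => ?_) h1
      exact not_lt.mp fun h => hω ⟨_, h⟩
    have hlim : Filter.Tendsto (fun k : ℕ => Real.exp n * Real.exp (-c * k)) Filter.atTop
        (nhds 0) := by
      rw [← mul_zero (Real.exp n)]
      refine (Real.tendsto_exp_atBot.comp ?_).const_mul _
      exact tendsto_natCast_atTop_atTop.const_mul_atTop_of_neg (by linarith)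
    have := ge_of_tendsto' hlim hle
    exact (measureReal_eq_zero_iff).mp (le_antisymm this measureReal_nonneg)
  filter_upwards [ae_all_iff.mpr key] with ω h M
  obtain ⟨n, hn⟩ := exists_nat_ge M
  obtain ⟨t, ht⟩ := h n
  exact ⟨t, hn.trans_lt ht⟩

theorem IsStableSubordinator.ae_isSubordinatorPath [IsProbabilityMeasure P]
    (hX : IsStableSubordinator β X P) : ∀ᵐ ω ∂P, IsSubordinatorPath fun t => X t ω := by
  filter_upwards [hX.start_zero, hX.monotone, hX.right_continuous, hX.ae_unbounded]
    with ω h1 h2 h3 h4 using ⟨h1, h2, h3, h4⟩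

/-- The process after its first passage over the level `a`, started anew from `0`. -/
noncomputable def postPassage (X : ℝ≥0 → Ω → ℝ) (a : ℝ) (t : ℝ≥0) (ω : Ω) : ℝ :=
  X (passageTime (fun s => X s ω) a + t) ω - X (passageTime (fun s => X s ω) a) ω

theorem measurable_gridPassage (hX : ∀ t, Measurable (X t)) (a : ℝ) (n : ℕ) :
    Measurable fun ω => gridPassage (fun s => X s ω) a n :=
  measurable_sInf_nat_setOf fun k => measurableSet_lt measurable_const (hX (k / 2 ^ n))

theorem measurable_comp_gridPassage (hX : ∀ t, Measurable (X t)) (a : ℝ) (n : ℕ) (t : ℝ≥0) :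
    Measurable fun ω => X (gridPassage (fun s => X s ω) a n / 2 ^ n + t) ω := by
  have h1 : Measurable (fun p : ℕ × Ω => X (p.1 / 2 ^ n + t) p.2) := by
    refine measurable_from_prod_countable_right fun k => ?_
    exact hX (k / 2 ^ n + t)
  have h2 : Measurable fun ω => (gridPassage (fun s => X s ω) a n, ω) :=
    (measurable_gridPassage hX a n).prodMk measurable_id
  exact Measurable.comp (g := fun p : ℕ × Ω => X (p.1 / 2 ^ n + t) p.2)
    (f := fun ω => (gridPassage (fun s => X s ω) a n, ω)) h1 h2

theorem IsStableSubordinator.aemeasurable_passage_add [IsProbabilityMeasure P]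
    (hX : IsStableSubordinator β X P) (a : ℝ) (t : ℝ≥0) :
    AEMeasurable (fun ω => X (passageTime (fun s => X s ω) a + t) ω) P := by
  refine aemeasurable_of_tendsto_metrizable_ae Filter.atTop
    (fun n => (measurable_comp_gridPassage hX.measurable a n t).aemeasurable) ?_
  filter_upwards [hX.ae_isSubordinatorPath] with ω hω using hω.tendsto_gridPassage a t

theorem IsStableSubordinator.aemeasurable_overshoot [IsProbabilityMeasure P]
    (hX : IsStableSubordinator β X P) (a : ℝ) : AEMeasurable (overshoot X a) P := by
  have := (hX.aemeasurable_passage_add a 0).sub_const a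
  change AEMeasurable (fun ω => X (passageTime (fun s => X s ω) a) ω - a) P
  simpa using this

theorem IsStableSubordinator.aemeasurable_postPassage [IsProbabilityMeasure P]
    (hX : IsStableSubordinator β X P) (a : ℝ) (t : ℝ≥0) : AEMeasurable (postPassage X a t) P := by
  have := (hX.aemeasurable_passage_add a t).sub (hX.aemeasurable_passage_add a 0)
  rw [show postPassage X a t = (fun ω => X (passageTime (fun s => X s ω) a + t) ω) -
    fun ω => X (passageTime (fun s => X s ω) a) ω from rfl]
  simpa using this

/-! ### The strong Markov property at first passage times -/

theorem IsStableSubordinator.integral_gridPassage_mul [IsProbabilityMeasure P]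
    (hX : IsStableSubordinator β X P) (a : ℝ) {J : Type*} [Finite J] (n : ℕ) (m : J → ℕ)
    (f : ℝ →ᵇ ℝ) (g : (J → ℝ) →ᵇ ℝ) :
    ∫ ω, f (X (gridPassage (fun s => X s ω) a n / 2 ^ n) ω) *
        g (fun j => X (gridPassage (fun s => X s ω) a n / 2 ^ n + m j / 2 ^ n) ω -
          X (gridPassage (fun s => X s ω) a n / 2 ^ n) ω) ∂P =
      (∫ ω, f (X (gridPassage (fun s => X s ω) a n / 2 ^ n) ω) ∂P) *
        ∫ ω, g (fun j => X (m j / 2 ^ n) ω) ∂P := by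
  set t : ℕ → ℝ≥0 := fun k => k / 2 ^ n with ht
  have htm : Monotone t := fun i j hij => by simp only [ht]; gcongr
  set ξ : ℕ → Ω → ℝ := fun i ω => X (t (i + 1)) ω - X (t i) ω with hξ
  have hsum : ∀ᵐ ω ∂P, ∀ k, ∑ i ∈ Finset.range k, ξ i ω = X (t k) ω := by
    filter_upwards [hX.start_zero] with ω h0 k
    rw [hξ, Finset.sum_range_sub (fun i => X (t i) ω)]
    simp [ht, h0]
  have hid : ∀ i, IdentDistrib (ξ i) (ξ 0) P P := by
    have h1 : ∀ i, IdentDistrib (ξ i) (X (2 ^ n)⁻¹) P P := fun i => by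
      have := hX.stationary_increments (t i) (2 ^ n)⁻¹
      have e : t i + (2 ^ n)⁻¹ = t (i + 1) := by
        simp only [ht]; push_cast; rw [add_div, one_div]
      rwa [e] at this
    exact fun i => (h1 i).trans (h1 0).symm
  have hpass : ∀ᵐ ω ∂P, ∃ k, a < ∑ i ∈ Finset.range k, ξ i ω := by
    filter_upwards [hsum, hX.ae_isSubordinatorPath] with ω h1 h2
    simp_rw [h1]
    exact h2.exists_lt_grid a n
  have key := integral_firstPassage_mul (ξ := ξ)
    (fun i => (hX.measurable (t (i + 1))).sub (hX.measurable (t i)))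
    (hX.indep_increments.nat htm) hid a hpass m f g
  simp only at key
  have htadd : ∀ k l : ℕ, t (k + l) = k / 2 ^ n + l / 2 ^ n := fun k l => by
    simp only [ht]; push_cast; rw [add_div]
  refine Eq.trans (Eq.trans (integral_congr_ae ?_) key) (congrArg₂ (· * ·) (integral_congr_ae ?_)
    (integral_congr_ae ?_))
  · filter_upwards [hsum] with ω h
    simp only [h, htadd]
    rfl
  · filter_upwards [hsum] with ω h
    simp only [h]
    rfl
  · filter_upwards [hsum] with ω h
    simp only [h]
    rfl

theorem exists_dyadicTime_eq (J : Finset (ℕ × ℕ)) :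
    ∃ M, ∀ n, M ≤ n → ∀ i ∈ J, ∃ k : ℕ, dyadicTime i = k / 2 ^ n := by
  refine ⟨J.sup Prod.fst, fun n hn i hi => ⟨i.2 * 2 ^ (n - i.1), ?_⟩⟩
  have h1 : i.1 ≤ n := (Finset.le_sup (f := Prod.fst) hi).trans hn
  rw [dyadicTime, div_eq_div_iff (by positivity) (by positivity)]
  push_cast
  rw [mul_assoc, ← pow_add, Nat.sub_add_cancel h1]

/-- Strong Markov property of a stable subordinator at a first passage time, in terms of the
finite-dimensional distributions at dyadic times. -/
theorem IsStableSubordinator.integral_overshoot_mul [IsProbabilityMeasure P]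
    (hX : IsStableSubordinator β X P) (a : ℝ) (J : Finset (ℕ × ℕ)) (f : ℝ →ᵇ ℝ)
    (g : (J → ℝ) →ᵇ ℝ) :
    ∫ ω, f (overshoot X a ω) * g (fun j => postPassage X a (dyadicTime j) ω) ∂P =
      (∫ ω, f (overshoot X a ω) ∂P) * ∫ ω, g (fun j => X (dyadicTime j) ω) ∂P := by
  -- From `n = M` on, all times in `J` lie on the grid of mesh `2⁻ⁿ`, so the random walk identity
  -- holds exactly; both sides then converge by bounded convergence.
  obtain ⟨M, hM⟩ := exists_dyadicTime_eq J
  set f' : ℝ →ᵇ ℝ := f.compContinuous ⟨fun y => y - a, by fun_prop⟩ with hf'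
  set Y : ℕ → ℝ≥0 → Ω → ℝ := fun n t ω => X (gridPassage (fun s => X s ω) a n / 2 ^ n + t) ω
    with hY
  have hYm : ∀ n t, Measurable (Y n t) := fun n t => measurable_comp_gridPassage hX.measurable a n t
  have hYlim : ∀ᵐ ω ∂P, ∀ t, Filter.Tendsto (fun n => Y n t ω) Filter.atTop
      (nhds (X (passageTime (fun s => X s ω) a + t) ω)) := by
    filter_upwards [hX.ae_isSubordinatorPath] with ω hω t using hω.tendsto_gridPassage a t
  have hflim : ∀ᵐ ω ∂P, Filter.Tendsto (fun n => f' (Y n 0 ω)) Filter.atTop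
      (nhds (f (overshoot X a ω))) := by
    filter_upwards [hYlim] with ω hω
    have := (f'.continuous.tendsto _).comp (hω 0)
    simpa [hf', overshoot, passageTime, Function.comp_def] using this
  have hglim : ∀ᵐ ω ∂P, Filter.Tendsto
      (fun n => g (fun j => Y n (dyadicTime j) ω - Y n 0 ω)) Filter.atTop
      (nhds (g (fun j => postPassage X a (dyadicTime j) ω))) := by
    filter_upwards [hYlim] with ω hω
    refine (g.continuous.tendsto _).comp (tendsto_pi_nhds.mpr fun j => ?_)
    have := (hω (dyadicTime j)).sub (hω 0)
    simpa [postPassage] using this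
  have hgm : ∀ n, Measurable fun ω => g (fun j => Y n (dyadicTime j) ω - Y n 0 ω) := fun n =>
    g.continuous.measurable.comp (measurable_pi_lambda _ fun j => (hYm n _).sub (hYm n 0))
  have hfm : ∀ n, Measurable fun ω => f' (Y n 0 ω) := fun n =>
    f'.continuous.measurable.comp (hYm n 0)
  have lim1 : Filter.Tendsto (fun n => ∫ ω, f' (Y n 0 ω) *
      g (fun j => Y n (dyadicTime j) ω - Y n 0 ω) ∂P) Filter.atTop
      (nhds (∫ ω, f (overshoot X a ω) * g (fun j => postPassage X a (dyadicTime j) ω) ∂P)) := by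
    refine tendsto_integral_of_dominated_convergence (fun _ => ‖f'‖ * ‖g‖)
      (fun n => ((hfm n).mul (hgm n)).aestronglyMeasurable) (integrable_const _)
      (fun n => Filter.Eventually.of_forall fun ω => ?_) ?_
    · rw [norm_mul]
      exact mul_le_mul (f'.norm_coe_le_norm _) (g.norm_coe_le_norm _) (norm_nonneg _)
        (norm_nonneg _)
    · filter_upwards [hflim, hglim] with ω h1 h2 using h1.mul h2
  have lim2 : Filter.Tendsto (fun n => ∫ ω, f' (Y n 0 ω) ∂P) Filter.atTop
      (nhds (∫ ω, f (overshoot X a ω) ∂P)) :=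
    tendsto_integral_of_dominated_convergence (fun _ => ‖f'‖)
      (fun n => (hfm n).aestronglyMeasurable) (integrable_const _)
      (fun n => Filter.Eventually.of_forall fun ω => f'.norm_coe_le_norm _) hflim
  refine tendsto_nhds_unique (lim1.congr' ?_) (lim2.mul_const _)
  filter_upwards [Filter.eventually_ge_atTop M] with n hn
  choose m hm using fun j : J => hM n hn j j.2
  have := hX.integral_gridPassage_mul a n m f' g
  simp_rw [← hm] at this
  simpa [hY] using this

end Subordinator

section Subordinator

variable {Ω : Type*} [MeasurableSpace Ω] {P : Measure Ω} {β : ℝ} {X : ℝ≥0 → Ω → ℝ}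

theorem IsStableSubordinator.indepFun_overshoot_postPassage [IsProbabilityMeasure P]
    (hX : IsStableSubordinator β X P) (a : ℝ) :
    IndepFun (overshoot X a) (fun ω i => postPassage X a (dyadicTime i) ω) P := by
  refine indepFun_process_of_bcf (hX.aemeasurable_overshoot a)
    (fun i => hX.aemeasurable_postPassage a (dyadicTime i)) fun f J g => ?_
  have h1 := hX.integral_overshoot_mul a J f g
  -- With `f = 1` the process after passage has the same expectations as the original one; inserting
  -- this turns the Markov identity into a product formula, that is, independence.
  have h2 := hX.integral_overshoot_mul a J (BoundedContinuousFunction.const ℝ 1) g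
  simp only [BoundedContinuousFunction.const_apply, one_mul, integral_const, probReal_univ,
    smul_eq_mul, mul_one] at h2
  rw [← h2] at h1
  exact h1

theorem IsStableSubordinator.map_postPassage [IsProbabilityMeasure P]
    (hX : IsStableSubordinator β X P) (a : ℝ) :
    P.map (fun ω i => postPassage X a (dyadicTime i) ω) =
      P.map (fun ω i => X (dyadicTime i) ω) := by
  have hY : ∀ i, AEMeasurable (postPassage X a (dyadicTime i)) P := fun i =>
    hX.aemeasurable_postPassage a (dyadicTime i)
  have hZ : ∀ i, Measurable (X (dyadicTime i)) := fun i => hX.measurable _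
  rw [map_eq_iff_forall_finset_map_restrict_eq
    (aemeasurable_pi_lambda (fun ω i => postPassage X a (dyadicTime i) ω) hY)
    (measurable_pi_lambda (fun ω i => X (dyadicTime i) ω) hZ).aemeasurable]
  intro J
  have hYJ : AEMeasurable (fun ω => J.restrict fun i => postPassage X a (dyadicTime i) ω) P :=
    aemeasurable_pi_lambda _ fun j => hY j
  have hZJ : AEMeasurable (fun ω => J.restrict fun i => X (dyadicTime i) ω) P :=
    aemeasurable_pi_lambda _ fun j => (hZ j).aemeasurable
  have := Measure.isProbabilityMeasure_map hYJ
  have := Measure.isProbabilityMeasure_map hZJ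
  refine ext_of_forall_integral_eq_of_IsFiniteMeasure fun g => ?_
  rw [integral_map hYJ g.continuous.measurable.aestronglyMeasurable,
    integral_map hZJ g.continuous.measurable.aestronglyMeasurable]
  have h2 := hX.integral_overshoot_mul a J (BoundedContinuousFunction.const ℝ 1) g
  simp only [BoundedContinuousFunction.const_apply, one_mul, integral_const, probReal_univ,
    smul_eq_mul, mul_one] at h2
  exact h2

/-! ### Potential measures -/

theorem lintegral_Ioi_rpow_mul_exp {p l : ℝ} (hp : 0 < p) (hl : 0 < l) :
    ∫⁻ t in Set.Ioi (0 : ℝ), ENNReal.ofReal (t ^ (p - 1) * Real.exp (-l * t)) =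
      ENNReal.ofReal ((1 / l) ^ p * Real.Gamma p) := by
  have h := Real.integral_rpow_mul_exp_neg_mul_Ioi hp hl
  have hpos : 0 < (1 / l) ^ p * Real.Gamma p :=
    mul_pos (by positivity) (Real.Gamma_pos_of_pos hp)
  have hint : IntegrableOn (fun t : ℝ => t ^ (p - 1) * Real.exp (-(l * t))) (Set.Ioi 0) := by
    -- A non-integrable function would have Bochner integral `0`, contrary to the positive value
    -- known from `h`.
    by_contra hn
    rw [integral_undef hn] at h
    exact hpos.ne h
  rw [← h, ofReal_integral_eq_lintegral_ofReal hint]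
  · simp_rw [neg_mul]
  · filter_upwards [ae_restrict_mem measurableSet_Ioi] with t ht
    have : 0 < t := ht
    simp only [Pi.zero_apply]
    positivity

/-- Approximate the time from the right by dyadic times: each approximation takes countably many
times and is jointly measurable, and right continuity gives the limit. -/
theorem aemeasurable_uncurry_of_right_cont [SFinite P] {Z : ℝ≥0 → Ω → ℝ}
    (hm : ∀ i, AEMeasurable (Z (dyadicTime i)) P)
    (hrc : ∀ᵐ ω ∂P, ∀ t, ContinuousWithinAt (fun s => Z s ω) (Set.Ici t) t) :
    AEMeasurable (fun p : ℝ × Ω => Z p.1.toNNReal p.2) ((volume.restrict (Set.Ioi 0)).prod P) := by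
  refine aemeasurable_of_tendsto_metrizable_ae Filter.atTop
    (f := fun n p => Z (dyadicTime (dyadicAbove p.1.toNNReal n)) p.2) (fun n => ?_) ?_
  · choose W hW hZW using hm
    refine ⟨fun p => W (dyadicAbove p.1.toNNReal n) p.2, ?_, ?_⟩
    · have h1 : Measurable (fun p : (ℕ × ℕ) × Ω => W p.1 p.2) :=
        measurable_from_prod_countable_right hW
      have h2 : Measurable fun p : ℝ × Ω => (dyadicAbove p.1.toNNReal n, p.2) := by
        unfold dyadicAbove
        refine Measurable.prodMk (measurable_const.prodMk ?_) measurable_snd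
        exact (Nat.measurable_floor.comp (by fun_prop)).add_const 1
      exact Measurable.comp (g := fun p : (ℕ × ℕ) × Ω => W p.1 p.2)
        (f := fun p : ℝ × Ω => (dyadicAbove p.1.toNNReal n, p.2)) h1 h2
    · filter_upwards [Measure.quasiMeasurePreserving_snd.ae (ae_all_iff.mpr hZW)] with p hp
        using hp _
  · filter_upwards [Measure.quasiMeasurePreserving_snd.ae hrc] with p hp
    exact tendsto_comp_of_right_cont (hp _) (fun n => (lt_dyadicTime_dyadicAbove _ n).le)
      (tendsto_dyadicAbove _)

/-- The potential measure of a `β`-stable subordinator with Laplace exponent `c * l ^ β`. -/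
noncomputable def potentialMeasure (β c : ℝ) : Measure ℝ :=
  (volume.restrict (Set.Ioi 0)).withDensity fun x =>
    ENNReal.ofReal (1 / (c * Real.Gamma β) * x ^ (β - 1))

theorem lintegral_potentialMeasure (β c : ℝ) {f : ℝ → ℝ≥0∞} (hf : Measurable f) :
    ∫⁻ x, f x ∂(potentialMeasure β c) =
      ∫⁻ x in Set.Ioi 0, ENNReal.ofReal (1 / (c * Real.Gamma β) * x ^ (β - 1)) * f x := by
  rw [potentialMeasure, lintegral_withDensity_eq_lintegral_mul _ (by fun_prop) hf]
  rfl

theorem laplace_potentialMeasure {β c l : ℝ} (hβ : 0 < β) (hc : 0 < c) (hl : 0 < l) :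
    ∫⁻ x, ENNReal.ofReal (Real.exp (-l * x)) ∂(potentialMeasure β c) =
      ENNReal.ofReal (1 / (c * l ^ β)) := by
  have hΓ := Real.Gamma_pos_of_pos hβ
  rw [lintegral_potentialMeasure β c (by fun_prop)]
  have e : ∀ x : ℝ, ENNReal.ofReal (1 / (c * Real.Gamma β) * x ^ (β - 1)) *
      ENNReal.ofReal (Real.exp (-l * x)) = ENNReal.ofReal (1 / (c * Real.Gamma β)) *
      ENNReal.ofReal (x ^ (β - 1) * Real.exp (-l * x)) := fun x => by
    rw [← ENNReal.ofReal_mul' (Real.exp_pos _).le, ← ENNReal.ofReal_mul (by positivity), mul_assoc]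
  simp_rw [e]
  rw [lintegral_const_mul' _ _ ENNReal.ofReal_ne_top, lintegral_Ioi_rpow_mul_exp hβ hl,
    ← ENNReal.ofReal_mul (by positivity)]
  congr 1
  rw [Real.div_rpow zero_le_one hl.le, Real.one_rpow]
  have := Real.rpow_pos_of_pos hl β
  field_simp

theorem lintegral_Ioi_exp_neg_mul {k : ℝ} (hk : 0 < k) :
    ∫⁻ t in Set.Ioi (0 : ℝ), ENNReal.ofReal (Real.exp (-k * t)) = ENNReal.ofReal (1 / k) := by
  have := lintegral_Ioi_rpow_mul_exp one_pos hk
  simpa using this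

theorem IsStableSubordinator.aemeasurable_uncurry [IsProbabilityMeasure P]
    (hX : IsStableSubordinator β X P) :
    AEMeasurable (fun p : ℝ × Ω => X p.1.toNNReal p.2) ((volume.restrict (Set.Ioi 0)).prod P) :=
  aemeasurable_uncurry_of_right_cont (fun _ => (hX.measurable _).aemeasurable) hX.right_continuous

/-- The occupation measure of a stable subordinator is its potential measure. -/
theorem IsStableSubordinator.map_occupation [IsProbabilityMeasure P] (hβ : 0 < β)
    (hX : IsStableSubordinator β X P) {c : ℝ} (hc : 0 < c)
    (hlap : ∀ (t : ℝ≥0) (l : ℝ), 0 ≤ l →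
      ∫ ω, Real.exp (-l * X t ω) ∂P = Real.exp (-c * t * l ^ β)) :
    ((volume.restrict (Set.Ioi 0)).prod P).map (fun p : ℝ × Ω => X p.1.toNNReal p.2) =
      potentialMeasure β c := by
  -- By Tonelli the Laplace transform of the occupation measure is `∫ exp (-c t l ^ β) dt` over `t >
  -- 0`.
  have key : ∀ l : ℝ, 0 < l → ∫⁻ x, ENNReal.ofReal (Real.exp (-l * x))
      ∂(((volume.restrict (Set.Ioi 0)).prod P).map (fun p : ℝ × Ω => X p.1.toNNReal p.2)) =
      ENNReal.ofReal (1 / (c * l ^ β)) := by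
    intro l hl
    have hlβ := Real.rpow_pos_of_pos hl β
    have hem : AEMeasurable (fun p : ℝ × Ω => ENNReal.ofReal (Real.exp (-l * X p.1.toNNReal p.2)))
        ((volume.restrict (Set.Ioi 0)).prod P) :=
      Measurable.comp_aemeasurable (g := fun x : ℝ => ENNReal.ofReal (Real.exp (-l * x)))
        (by fun_prop) hX.aemeasurable_uncurry
    rw [lintegral_map' (by fun_prop) hX.aemeasurable_uncurry,
      lintegral_prod (fun p : ℝ × Ω => ENNReal.ofReal (Real.exp (-l * X p.1.toNNReal p.2))) hem,
      ← lintegral_Ioi_exp_neg_mul (by positivity)]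
    refine setLIntegral_congr_fun measurableSet_Ioi fun t ht => ?_
    have ht : 0 < t := ht
    simp only
    rw [← ofReal_integral_eq_lintegral_ofReal (hX.integrable_exp hl.le _)
      (Filter.Eventually.of_forall fun ω => (Real.exp_pos _).le), hlap _ l hl.le,
      Real.coe_toNNReal _ ht.le]
    ring_nf
  refine measure_eq_of_laplace_eq (fun l hl => ?_) fun l hl => ?_
  · rw [key l hl]; exact ENNReal.ofReal_ne_top
  · rw [key l hl, laplace_potentialMeasure hβ hc hl]

/-- At dyadic `u` this is independence and equality in law of the process after passage; right
continuity extends it to all `u`. -/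
theorem IsStableSubordinator.integral_exp_passage_add [IsProbabilityMeasure P]
    (hX : IsStableSubordinator β X P) {c : ℝ}
    (hlap : ∀ (t : ℝ≥0) (l : ℝ), 0 ≤ l →
      ∫ ω, Real.exp (-l * X t ω) ∂P = Real.exp (-c * t * l ^ β)) (a : ℝ) {l : ℝ} (hl : 0 ≤ l)
    (u : ℝ≥0) :
    ∫ ω, Real.exp (-l * X (passageTime (fun s => X s ω) a + u) ω) ∂P =
      (∫ ω, Real.exp (-l * (a + overshoot X a ω)) ∂P) * Real.exp (-c * u * l ^ β) := by
  have hover : ∀ ω, a + overshoot X a ω = X (passageTime (fun s => X s ω) a) ω := fun ω => by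
    simp [overshoot, passageTime]
  have hdy : ∀ i, ∫ ω, Real.exp (-l * X (passageTime (fun s => X s ω) a + dyadicTime i) ω) ∂P =
      (∫ ω, Real.exp (-l * (a + overshoot X a ω)) ∂P) *
        Real.exp (-c * dyadicTime i * l ^ β) := by
    intro i
    have hind : IndepFun (fun ω => Real.exp (-l * (a + overshoot X a ω)))
        (fun ω => Real.exp (-l * postPassage X a (dyadicTime i) ω)) P :=
      (hX.indepFun_overshoot_postPassage a).comp
        (φ := fun b => Real.exp (-l * (a + b))) (ψ := fun y : ℕ × ℕ → ℝ => Real.exp (-l * y i))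
        (by fun_prop) (by fun_prop)
    have hlaw : ∫ ω, Real.exp (-l * postPassage X a (dyadicTime i) ω) ∂P =
        ∫ ω, Real.exp (-l * X (dyadicTime i) ω) ∂P := by
      have hf : Measurable fun y : ℕ × ℕ → ℝ => Real.exp (-l * y i) := by fun_prop
      have h1 := integral_map (μ := P) (φ := fun ω i => postPassage X a (dyadicTime i) ω)
        (aemeasurable_pi_lambda _ fun i => hX.aemeasurable_postPassage a (dyadicTime i))
        hf.aestronglyMeasurable
      have h2 := integral_map (μ := P) (φ := fun ω i => X (dyadicTime i) ω)
        (measurable_pi_lambda _ fun i => hX.measurable _).aemeasurable hf.aestronglyMeasurable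
      rw [hX.map_postPassage a] at h1
      exact h1.symm.trans h2
    rw [← hlap _ l hl, ← hlaw, ← hind.integral_fun_mul_eq_mul_integral]
    · refine integral_congr_ae (Filter.Eventually.of_forall fun ω => ?_)
      simp only [hover, postPassage]
      rw [← Real.exp_add]
      congr 1; ring
    · exact (Measurable.comp_aemeasurable (g := fun b : ℝ => Real.exp (-l * (a + b)))
        (by fun_prop) (hX.aemeasurable_overshoot a)).aestronglyMeasurable
    · exact (Measurable.comp_aemeasurable (g := fun b : ℝ => Real.exp (-l * b))
        (by fun_prop) (hX.aemeasurable_postPassage a (dyadicTime i))).aestronglyMeasurable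
  have lim1 : Filter.Tendsto (fun n => ∫ ω, Real.exp
      (-l * X (passageTime (fun s => X s ω) a + dyadicTime (dyadicAbove u n)) ω) ∂P) Filter.atTop
      (nhds (∫ ω, Real.exp (-l * X (passageTime (fun s => X s ω) a + u) ω) ∂P)) := by
    refine tendsto_integral_of_dominated_convergence (fun _ => 1) (fun n => ?_)
      (integrable_const _) (fun n => ?_) ?_
    · exact (Measurable.comp_aemeasurable (g := fun b : ℝ => Real.exp (-l * b))
        (by fun_prop) (hX.aemeasurable_passage_add a _)).aestronglyMeasurable
    · filter_upwards [hX.ae_nonneg] with ω h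
      rw [Real.norm_of_nonneg (Real.exp_pos _).le, Real.exp_le_one_iff]
      nlinarith [h (passageTime (fun s => X s ω) a + dyadicTime (dyadicAbove u n))]
    · filter_upwards [hX.ae_isSubordinatorPath] with ω h
      refine (Real.continuous_exp.tendsto _).comp (Filter.Tendsto.const_mul _ ?_)
      exact tendsto_comp_of_right_cont (h.right_cont _)
        (fun n => by gcongr; exact (lt_dyadicTime_dyadicAbove u n).le)
        ((tendsto_dyadicAbove u).const_add _)
  have lim2 : Filter.Tendsto (fun n => (∫ ω, Real.exp (-l * (a + overshoot X a ω)) ∂P) *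
      Real.exp (-c * dyadicTime (dyadicAbove u n) * l ^ β)) Filter.atTop
      (nhds ((∫ ω, Real.exp (-l * (a + overshoot X a ω)) ∂P) * Real.exp (-c * u * l ^ β))) := by
    have h1 : Filter.Tendsto (fun n => (dyadicTime (dyadicAbove u n) : ℝ)) Filter.atTop
        (nhds (u : ℝ)) := (NNReal.continuous_coe.tendsto u).comp (tendsto_dyadicAbove u)
    exact ((Real.continuous_exp.tendsto _).comp ((h1.const_mul (-c)).mul_const _)).const_mul _
  exact tendsto_nhds_unique (lim1.congr fun n => hdy _) lim2

/-- Apart from the single time `passageTime x a`, the path is above `a` exactly after that time; the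
rest is a time shift. -/
theorem IsSubordinatorPath.lintegral_indicator_passage {x : ℝ≥0 → ℝ} (hx : IsSubordinatorPath x)
    (a : ℝ) (f : ℝ → ℝ≥0∞) :
    ∫⁻ t in Set.Ioi (0 : ℝ), (Set.Ioi a).indicator f (x t.toNNReal) =
      ∫⁻ u in Set.Ioi (0 : ℝ), f (x (passageTime x a + u.toNNReal)) := by
  set τ := passageTime x a with hτ
  have h1 := setLIntegral_Ioi_comp_add_left (τ : ℝ) 0 (fun t => f (x (Real.toNNReal t)))
  have h2 : ∫⁻ u in Set.Ioi (0 : ℝ), f (x (τ + u.toNNReal)) =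
      ∫⁻ u in Set.Ioi (0 : ℝ), f (x (Real.toNNReal ((τ : ℝ) + u))) := by
    refine setLIntegral_congr_fun measurableSet_Ioi fun u hu => ?_
    have hu : 0 < u := hu
    rw [Real.toNNReal_add τ.coe_nonneg hu.le, Real.toNNReal_coe]
  rw [h2, h1, add_zero, ← lintegral_indicator measurableSet_Ioi,
    ← lintegral_indicator measurableSet_Ioi]
  refine lintegral_congr_ae ?_
  filter_upwards [compl_mem_ae_iff.mpr (measure_singleton (μ := volume) (τ : ℝ))] with t ht
  have htτ : t ≠ τ := ht
  rcases htτ.lt_or_gt with h | h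
  · rw [Set.indicator_of_notMem (s := Set.Ioi (τ : ℝ)) (by simpa using h.le)]
    by_cases h0 : 0 < t
    · rw [Set.indicator_of_mem (s := Set.Ioi (0 : ℝ)) (by exact h0),
        Set.indicator_of_notMem (s := Set.Ioi a)]
      have : t.toNNReal < τ := by
        rw [← NNReal.coe_lt_coe, Real.coe_toNNReal _ h0.le]; exact h
      simpa using le_of_lt_passageTime this
    · rw [Set.indicator_of_notMem (by exact h0)]
  · have h0 : 0 < t := τ.2.trans_lt h
    rw [Set.indicator_of_mem (s := Set.Ioi (τ : ℝ)) (by exact h),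
      Set.indicator_of_mem (s := Set.Ioi (0 : ℝ)) (by exact h0),
      Set.indicator_of_mem (s := Set.Ioi a)]
    refine hx.lt_of_passageTime_lt (t := t.toNNReal) ?_
    rw [← hτ, ← NNReal.coe_lt_coe, Real.coe_toNNReal _ h0.le]; exact h

/-- Time spent beyond `a` is time spent after passage. There the Laplace transform factors at each
later time `u`, and the integral over `u` gives `1 / (c * l ^ β)`. -/
theorem IsStableSubordinator.laplace_occupation_Ioi [IsProbabilityMeasure P]
    (hX : IsStableSubordinator β X P) {c : ℝ} (hc : 0 < c)
    (hlap : ∀ (t : ℝ≥0) (l : ℝ), 0 ≤ l →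
      ∫ ω, Real.exp (-l * X t ω) ∂P = Real.exp (-c * t * l ^ β)) (a : ℝ) {l : ℝ} (hl : 0 < l) :
    ∫⁻ x in Set.Ioi a, ENNReal.ofReal (Real.exp (-l * x))
      ∂(((volume.restrict (Set.Ioi 0)).prod P).map (fun p : ℝ × Ω => X p.1.toNNReal p.2)) =
      (∫⁻ ω, ENNReal.ofReal (Real.exp (-l * (a + overshoot X a ω))) ∂P) *
        ENNReal.ofReal (1 / (c * l ^ β)) := by
  have hlβ := Real.rpow_pos_of_pos hl β
  set e : ℝ → ℝ≥0∞ := fun x => ENNReal.ofReal (Real.exp (-l * x)) with he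
  have hem : Measurable e := by fun_prop
  have hZ : AEMeasurable (fun p : ℝ × Ω => X (passageTime (fun s => X s p.2) a + p.1.toNNReal) p.2)
      ((volume.restrict (Set.Ioi 0)).prod P) :=
    aemeasurable_uncurry_of_right_cont
      (Z := fun u ω => X (passageTime (fun s => X s ω) a + u) ω)
      (fun i => hX.aemeasurable_passage_add a _) (by
        filter_upwards [hX.ae_isSubordinatorPath] with ω h t
        refine (h.right_cont _).comp (by fun_prop) fun u hu => ?_
        exact add_le_add_right (Set.mem_Ici.mp hu) _)
  have hover : ∀ ω, a + overshoot X a ω = X (passageTime (fun s => X s ω) a) ω := fun ω => by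
    simp [overshoot, passageTime]
  have hbi : ∀ u : ℝ≥0, Integrable
      (fun ω => Real.exp (-l * X (passageTime (fun s => X s ω) a + u) ω)) P := fun u => by
    refine Integrable.of_bound (C := 1) (Measurable.comp_aemeasurable
      (g := fun b : ℝ => Real.exp (-l * b)) (by fun_prop)
      (hX.aemeasurable_passage_add a u)).aestronglyMeasurable ?_
    filter_upwards [hX.ae_nonneg] with ω h
    rw [Real.norm_of_nonneg (Real.exp_pos _).le, Real.exp_le_one_iff]
    nlinarith [h (passageTime (fun s => X s ω) a + u)]
  have hi0 : Integrable (fun ω => Real.exp (-l * (a + overshoot X a ω))) P := by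
    simp_rw [hover]
    simpa using hbi 0
  have hi : AEMeasurable (fun p : ℝ × Ω => (Set.Ioi a).indicator e (X p.1.toNNReal p.2))
      ((volume.restrict (Set.Ioi 0)).prod P) :=
    (hem.indicator measurableSet_Ioi).comp_aemeasurable hX.aemeasurable_uncurry
  have hp : AEMeasurable (fun p : ℝ × Ω =>
      e (X (passageTime (fun s => X s p.2) a + p.1.toNNReal) p.2))
      ((volume.restrict (Set.Ioi 0)).prod P) := hem.comp_aemeasurable hZ
  rw [← lintegral_indicator measurableSet_Ioi, lintegral_map'
      (hem.indicator measurableSet_Ioi).aemeasurable hX.aemeasurable_uncurry,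
    lintegral_prod_symm (fun p : ℝ × Ω => (Set.Ioi a).indicator e (X p.1.toNNReal p.2)) hi]
  have step : ∫⁻ ω, (∫⁻ t in Set.Ioi (0 : ℝ), (Set.Ioi a).indicator e (X t.toNNReal ω)) ∂P =
      ∫⁻ ω, (∫⁻ u in Set.Ioi (0 : ℝ),
        e (X (passageTime (fun s => X s ω) a + u.toNNReal) ω)) ∂P := by
    refine lintegral_congr_ae ?_
    filter_upwards [hX.ae_isSubordinatorPath] with ω h using h.lintegral_indicator_passage a e
  rw [step, ← lintegral_prod_symm (fun p : ℝ × Ω =>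
      e (X (passageTime (fun s => X s p.2) a + p.1.toNNReal) p.2)) hp,
    lintegral_prod _ hp, ← lintegral_Ioi_exp_neg_mul (by positivity),
    ← lintegral_const_mul _ (by fun_prop)]
  refine setLIntegral_congr_fun measurableSet_Ioi fun u hu => ?_
  have hu : 0 < u := hu
  simp only [he]
  rw [← ofReal_integral_eq_lintegral_ofReal (hbi _)
      (Filter.Eventually.of_forall fun ω => (Real.exp_pos _).le),
    ← ofReal_integral_eq_lintegral_ofReal hi0
      (Filter.Eventually.of_forall fun ω => (Real.exp_pos _).le),
    hX.integral_exp_passage_add hlap a hl.le, ENNReal.ofReal_mul' (Real.exp_pos _).le,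
    Real.coe_toNNReal _ hu.le]
  ring_nf

end Subordinator

instance (β c : ℝ) : SFinite (potentialMeasure β c) := by
  unfold potentialMeasure; infer_instance

/-! ### The renewal identity and the generalized arcsine law. -/

section Subordinator

variable {Ω : Type*} [MeasurableSpace Ω] {P : Measure Ω} {β : ℝ} {X : ℝ≥0 → Ω → ℝ}

/-- The renewal identity: beyond the level `a` the potential measure is the convolution of the law
of the first position beyond `a` with the potential measure. -/
theorem IsStableSubordinator.restrict_potentialMeasure [IsProbabilityMeasure P] (hβ : 0 < β)
    (hX : IsStableSubordinator β X P) {c : ℝ} (hc : 0 < c)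
    (hlap : ∀ (t : ℝ≥0) (l : ℝ), 0 ≤ l →
      ∫ ω, Real.exp (-l * X t ω) ∂P = Real.exp (-c * t * l ^ β)) (a : ℝ) :
    (potentialMeasure β c).restrict (Set.Ioi a) =
      ((P.map (overshoot X a)).prod (potentialMeasure β c)).map fun p => a + p.1 + p.2 := by
  refine measure_eq_of_laplace_eq (fun l hl => ?_) fun l hl => ?_
  · refine ((setLIntegral_le_lintegral _ _).trans_lt ?_).ne
    rw [laplace_potentialMeasure hβ hc hl]
    exact ENNReal.ofReal_lt_top
  · have h := hX.laplace_occupation_Ioi hc hlap a hl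
    rw [hX.map_occupation hβ hc hlap] at h
    have he : AEMeasurable (fun ω => ENNReal.ofReal (Real.exp (-l * (a + overshoot X a ω)))) P :=
      Measurable.comp_aemeasurable
        (g := fun b : ℝ => ENNReal.ofReal (Real.exp (-l * (a + b)))) (by fun_prop)
        (hX.aemeasurable_overshoot a)
    rw [h, lintegral_map (by fun_prop) (by fun_prop), lintegral_prod _ (by fun_prop),
      lintegral_map' ?_ (hX.aemeasurable_overshoot a), ← laplace_potentialMeasure hβ hc hl,
      ← lintegral_mul_const'' _ he]
    · refine lintegral_congr fun ω => ?_
      rw [← lintegral_const_mul _ (by fun_prop)]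
      refine lintegral_congr fun y => ?_
      rw [← ENNReal.ofReal_mul (Real.exp_pos _).le, ← Real.exp_add]
      ring_nf
    · exact (Measurable.lintegral_prod_right' (f := fun p : ℝ × ℝ =>
        ENNReal.ofReal (Real.exp (-l * (a + p.1 + p.2)))) (by fun_prop)).aemeasurable

theorem IsStableSubordinator.hasPotentialIdentity [IsProbabilityMeasure P] (hβ : 0 < β)
    (hX : IsStableSubordinator β X P) {a : ℝ} (ha : 0 < a) :
    HasPotentialIdentity β (P.map fun ω => overshoot X a ω / a) := by
  obtain ⟨c, hc, hlap⟩ := hX.laplace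
  intro φ hφ
  have hΓ := Real.Gamma_pos_of_pos hβ
  have hm := hX.aemeasurable_overshoot a
  -- The substitutions `x = a + a * t` and `y = a * t` produce the same constant on both sides;
  -- after cancellation neither the scale `c` nor the level `a` remains.
  set k : ℝ≥0∞ := ENNReal.ofReal a * ENNReal.ofReal (1 / (c * Real.Gamma β) * a ^ (β - 1)) with hk
  have hk0 : k ≠ 0 := by
    rw [hk]
    refine mul_ne_zero ?_ ?_ <;> simp only [ne_eq, ENNReal.ofReal_eq_zero, not_le] <;> positivity
  have hkt : k ≠ ∞ := ENNReal.mul_ne_top ENNReal.ofReal_ne_top ENNReal.ofReal_ne_top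
  have hψ : Measurable fun x => φ (x / a - 1) := by fun_prop
  have h := congrArg (fun μ => ∫⁻ x, φ (x / a - 1) ∂μ)
    (hX.restrict_potentialMeasure hβ hc hlap a)
  rw [lintegral_map hψ (by fun_prop), lintegral_prod _ (by fun_prop),
    lintegral_map' (Measurable.lintegral_prod_right' (f := fun p : ℝ × ℝ =>
        φ ((a + p.1 + p.2) / a - 1)) (by fun_prop)).aemeasurable hm,
    ← lintegral_indicator measurableSet_Ioi,
    lintegral_potentialMeasure β c (hψ.indicator measurableSet_Ioi)] at h
  have hL : ∫⁻ x in Set.Ioi (0 : ℝ), ENNReal.ofReal (1 / (c * Real.Gamma β) * x ^ (β - 1)) *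
      (Set.Ioi a).indicator (fun x => φ (x / a - 1)) x =
      k * ∫⁻ t in Set.Ioi (0 : ℝ), φ t * ENNReal.ofReal ((1 + t) ^ (β - 1)) := by
    have e1 : ∫⁻ x in Set.Ioi (0 : ℝ), ENNReal.ofReal (1 / (c * Real.Gamma β) * x ^ (β - 1)) *
        (Set.Ioi a).indicator (fun x => φ (x / a - 1)) x =
        ∫⁻ x in Set.Ioi a, ENNReal.ofReal (1 / (c * Real.Gamma β) * x ^ (β - 1)) *
          φ (x / a - 1) := by
      rw [← lintegral_indicator measurableSet_Ioi, ← lintegral_indicator measurableSet_Ioi]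
      refine lintegral_congr fun x => ?_
      by_cases hx : a < x
      · rw [Set.indicator_of_mem (s := Set.Ioi (0 : ℝ)) (by exact ha.trans hx),
          Set.indicator_of_mem (s := Set.Ioi a) (by exact hx),
          Set.indicator_of_mem (s := Set.Ioi a) (by exact hx)]
      · rw [Set.indicator_of_notMem (s := Set.Ioi a) (a := x) (by exact hx) (fun x =>
          ENNReal.ofReal (1 / (c * Real.Gamma β) * x ^ (β - 1)) * φ (x / a - 1))]
        by_cases h0 : x ∈ Set.Ioi (0 : ℝ)
        · rw [Set.indicator_of_mem h0, Set.indicator_of_notMem (s := Set.Ioi a) (by exact hx),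
            mul_zero]
        · rw [Set.indicator_of_notMem h0]
    have e2 := setLIntegral_Ioi_comp_add_left a 0 (fun x =>
      ENNReal.ofReal (1 / (c * Real.Gamma β) * x ^ (β - 1)) * φ (x / a - 1))
    rw [add_zero] at e2
    rw [e1, ← e2, setLIntegral_Ioi_comp_mul_left ha, hk, mul_assoc]
    congr 1
    rw [← lintegral_const_mul _ (by fun_prop)]
    refine setLIntegral_congr_fun measurableSet_Ioi fun t ht => ?_
    have ht : 0 < t := ht
    have e3 : (a + a * t) / a - 1 = t := by field_simp; ring
    have e4 : (a + a * t) ^ (β - 1) = a ^ (β - 1) * (1 + t) ^ (β - 1) := by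
      rw [← Real.mul_rpow ha.le (by positivity)]; ring_nf
    rw [e3, e4, ← mul_assoc, ENNReal.ofReal_mul (by positivity), mul_assoc,
      mul_comm (ENNReal.ofReal ((1 + t) ^ (β - 1)))]
  have hR : ∀ ω, ∫⁻ y, φ ((a + overshoot X a ω + y) / a - 1) ∂(potentialMeasure β c) =
      k * ∫⁻ y in Set.Ioi (0 : ℝ), φ (overshoot X a ω / a + y) * ENNReal.ofReal (y ^ (β - 1)) := by
    intro ω
    rw [lintegral_potentialMeasure β c (by fun_prop), setLIntegral_Ioi_comp_mul_left ha, hk,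
      mul_assoc]
    congr 1
    rw [← lintegral_const_mul _ (by fun_prop)]
    refine setLIntegral_congr_fun measurableSet_Ioi fun t ht => ?_
    have ht : 0 < t := ht
    have e3 : (a + overshoot X a ω + a * t) / a - 1 = overshoot X a ω / a + t := by
      field_simp; ring
    rw [e3, Real.mul_rpow ha.le ht.le, ← mul_assoc, ENNReal.ofReal_mul (by positivity), mul_assoc,
      mul_comm (ENNReal.ofReal (t ^ (β - 1)))]
  rw [hL] at h
  simp_rw [hR] at h
  rw [lintegral_const_mul' _ _ hkt] at h
  rw [(ENNReal.mul_right_inj hk0 hkt).mp h, lintegral_map' (Measurable.lintegral_prod_right'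
    (f := fun p : ℝ × ℝ => φ (p.1 + p.2) * ENNReal.ofReal (p.2 ^ (β - 1)))
    (by fun_prop)).aemeasurable (hm.div_const a)]

theorem IsStableSubordinator.map_overshoot_div [IsProbabilityMeasure P] (h0 : 0 < β) (h1 : β < 1)
    (hX : IsStableSubordinator β X P) {a : ℝ} (ha : 0 < a) :
    (P.map fun ω => overshoot X a ω / a) = overshootLaw β :=
  have := isProbabilityMeasure_overshootLaw h0 h1
  have := Measure.isProbabilityMeasure_map ((hX.aemeasurable_overshoot a).div_const a)
  (hX.hasPotentialIdentity h0 ha).measure_eq h0 h1 (hasPotentialIdentity_overshootLaw h0 h1)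

theorem IsStableSubordinator.map_overshoot [IsProbabilityMeasure P] (h0 : 0 < β) (h1 : β < 1)
    (hX : IsStableSubordinator β X P) {a : ℝ} (ha : 0 < a) :
    P.map (overshoot X a) = (overshootLaw β).map fun u => a * u := by
  rw [← hX.map_overshoot_div h0 h1 ha, AEMeasurable.map_map_of_aemeasurable (by fun_prop)
    ((hX.aemeasurable_overshoot a).div_const a)]
  congr 1
  ext ω
  simp only [Function.comp_apply]
  field_simp

theorem IsStableSubordinator.ae_overshoot_pos [IsProbabilityMeasure P] (h0 : 0 < β) (h1 : β < 1)
    (hX : IsStableSubordinator β X P) {a : ℝ} (ha : 0 < a) : ∀ᵐ ω ∂P, 0 < overshoot X a ω := by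
  have h := ae_overshootLaw_pos β
  rw [← hX.map_overshoot_div h0 h1 ha] at h
  filter_upwards [ae_of_ae_map ((hX.aemeasurable_overshoot a).div_const a) h] with ω hω
  exact (div_pos_iff_of_pos_right ha).mp hω

/-! ### Closed ranges at a fixed level -/

/-- Points of the range close to `a` lie above `b` and below the landing point `x (passageTime x
a)`. They are visited before the passage of `a`, hence are at most `a`, and the first passage over
`b` comes no later. -/
theorem IsSubordinatorPath.overshoot_le_of_mem_closure {x : ℝ≥0 → ℝ} (hx : IsSubordinatorPath x)
    {a : ℝ} (ha : a < x (passageTime x a)) (hmem : a ∈ closure (Set.range x)) {b : ℝ}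
    (hb : b < a) : x (passageTime x b) ≤ a := by
  obtain ⟨_, ⟨hy1, hy2⟩, t, rfl⟩ :=
    mem_closure_iff.mp hmem (Set.Ioo b (x (passageTime x a))) isOpen_Ioo ⟨hb, ha⟩
  have ht : t < passageTime x a := not_le.mp fun h => (hx.mono h).not_gt hy2
  exact (hx.mono (passageTime_le hy1)).trans (le_of_lt_passageTime ht)

theorem IsStableSubordinator.ae_notMem_closure_range [IsProbabilityMeasure P] (h0 : 0 < β)
    (h1 : β < 1) (hX : IsStableSubordinator β X P) {a : ℝ} (ha : 0 < a) :
    ∀ᵐ ω ∂P, a ∉ closure (Set.range fun t => X t ω) := by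
  have := isProbabilityMeasure_overshootLaw h0 h1
  set N : Set Ω := {ω | a ∈ closure (Set.range fun t => X t ω)} with hN
  have hle : ∀ n : ℕ, P N ≤ overshootLaw β (Set.Iic (1 / ((n : ℝ) + 1))) := by
    intro n
    -- Chosen so that `(a - b) / b = 1 / (n + 1)`: if `a` is in the closed range, the relative
    -- overshoot over `b` is at most this. Its law does not depend on `b` and has no mass at `0`.
    set b : ℝ := a * (n + 1) / (n + 2) with hb
    have hb0 : 0 < b := by positivity
    have hba : b < a := by
      rw [hb, div_lt_iff₀ (by positivity)]; nlinarith
    rw [← hX.map_overshoot_div h0 h1 hb0, Measure.map_apply_of_aemeasurable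
      ((hX.aemeasurable_overshoot b).div_const b) measurableSet_Iic]
    refine measure_mono_ae ?_
    filter_upwards [hX.ae_isSubordinatorPath, hX.ae_overshoot_pos h0 h1 ha] with ω h2 h3 h4
    have h5 := h2.overshoot_le_of_mem_closure (sub_pos.mp h3) h4 hba
    change overshoot X b ω / b ≤ 1 / ((n : ℝ) + 1)
    have h6 : overshoot X b ω ≤ a - b := sub_le_sub_right h5 b
    rw [div_le_div_iff₀ hb0 (by positivity)]
    have h7 : (a - b) * ((n : ℝ) + 1) = 1 * b := by rw [hb]; field_simp; ring
    rw [← h7]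
    gcongr
  have hlim : Filter.Tendsto (fun n : ℕ => overshootLaw β (Set.Iic (1 / ((n : ℝ) + 1))))
      Filter.atTop (nhds (overshootLaw β (⋂ n : ℕ, Set.Iic (1 / ((n : ℝ) + 1))))) := by
    refine tendsto_measure_iInter_atTop (fun n => measurableSet_Iic.nullMeasurableSet)
      (fun m n hmn => ?_) ⟨0, measure_ne_top _ _⟩
    refine Set.Iic_subset_Iic.mpr ?_
    have : (m : ℝ) ≤ n := by exact_mod_cast hmn
    gcongr
  have hzero : overshootLaw β (⋂ n : ℕ, Set.Iic (1 / ((n : ℝ) + 1))) = 0 := by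
    refine measure_mono_null (fun u hu => ?_) (ae_iff.mp (ae_overshootLaw_pos β))
    have : u ≤ 0 := ge_of_tendsto' tendsto_one_div_add_atTop_nhds_zero_nat
      fun n => Set.mem_iInter.mp hu n
    simpa using this
  rw [hzero] at hlim
  have := ge_of_tendsto' hlim hle
  rw [ae_iff]
  simpa [hN] using this

theorem IsSubordinatorPath.mem_closure_range_post {x : ℝ≥0 → ℝ} {a y : ℝ}
    (hya : a < y) (hy : y ∈ closure (Set.range x)) :
    y ∈ closure (Set.range fun u => x (passageTime x a + u)) := by
  rw [mem_closure_iff] at hy ⊢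
  intro U hU hyU
  obtain ⟨_, ⟨h1, h2⟩, t, rfl⟩ := hy (U ∩ Set.Ioi a) (hU.inter isOpen_Ioi) ⟨hyU, hya⟩
  exact ⟨_, h1, t - passageTime x a, by
    simp only [add_tsub_cancel_of_le (passageTime_le (show a < x t from h2))]⟩

/-- If `a` belonged to the closed range it would be its own next point; excluding this leaves only
limits of positions taken after the passage. -/
theorem IsSubordinatorPath.nextPoint_closure_range {x : ℝ≥0 → ℝ} (hx : IsSubordinatorPath x)
    {a : ℝ} (hmem : a ∉ closure (Set.range x)) :
    nextPoint a (TopologicalSpace.Closeds.closure (Set.range x)) = x (passageTime x a) := by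
  refine IsLeast.csInf_eq ⟨⟨subset_closure ⟨_, rfl⟩, hx.le_passage a⟩, ?_⟩
  rintro y ⟨hy, hay⟩
  have hya : a < y := lt_of_le_of_ne hay fun h => hmem (h ▸ hy)
  refine closure_minimal ?_ isClosed_Ici (IsSubordinatorPath.mem_closure_range_post hya hy)
  rintro _ ⟨u, rfl⟩
  exact hx.mono le_self_add

theorem IsSubordinatorPath.tailFrom_closure_range {x : ℝ≥0 → ℝ} (hx : IsSubordinatorPath x)
    {a : ℝ} (ha : a < x (passageTime x a)) :
    tailFrom (x (passageTime x a)) (TopologicalSpace.Closeds.closure (Set.range x)) =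
      TopologicalSpace.Closeds.closure
        (Set.range fun u => x (passageTime x a + u) - x (passageTime x a)) := by
  set τ := passageTime x a
  ext z
  change (0 ≤ z ∧ x τ + z ∈ closure (Set.range x)) ↔
    z ∈ closure (Set.range fun u => x (τ + u) - x τ)
  constructor
  · rintro ⟨hz, h⟩
    have h1 := IsSubordinatorPath.mem_closure_range_post (lt_of_lt_of_le ha (by linarith)) h
    have h2 := map_mem_closure (f := fun y => y - x τ) (by fun_prop) h1
      (t := Set.range fun u => x (τ + u) - x τ) (by rintro _ ⟨u, rfl⟩; exact ⟨u, rfl⟩)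
    simpa using h2
  · intro h
    constructor
    · refine closure_minimal ?_ isClosed_Ici h
      rintro _ ⟨u, rfl⟩
      exact sub_nonneg.mpr (hx.mono le_self_add)
    · refine map_mem_closure (f := fun y => x τ + y) (by fun_prop) h ?_
      rintro _ ⟨u, rfl⟩
      exact ⟨τ + u, by simp⟩

/-! ### The regenerative property -/

/-- The distance from `a` to the first point of `F` on `[a, ∞)`, together with the part of `F`
beyond that point. -/
noncomputable def splitAt (a : ℝ) (F : TopologicalSpace.Closeds ℝ) :
    ℝ × TopologicalSpace.Closeds ℝ :=
  (nextPoint a F - a, tailFrom (nextPoint a F) F)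

theorem measurable_splitAt_uncurry :
    Measurable fun p : ℝ × TopologicalSpace.Closeds ℝ => splitAt p.1 p.2 :=
  (measurable_nextPoint_uncurry.sub measurable_fst).prodMk
    (measurable_tailFrom_uncurry.comp (measurable_nextPoint_uncurry.prodMk measurable_snd))

theorem measurable_splitAt (a : ℝ) : Measurable (splitAt a) :=
  measurable_splitAt_uncurry.comp (measurable_const.prodMk measurable_id)

/-- Laws of random closed subsets of `[0, ∞)` that are unbounded, contain `0`, and regenerate after
each level `a > 0`, with first point `a + a * U` beyond `a`, where `U` has law `overshootLaw β`. -/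
structure IsStableRegenerativeLaw (β : ℝ) (ρ : Measure (TopologicalSpace.Closeds ℝ)) : Prop where
  isProbabilityMeasure : IsProbabilityMeasure ρ
  ae_nonneg : ∀ᵐ F ∂ρ, ∀ x ∈ F, 0 ≤ x
  ae_zero_mem : ∀ᵐ F ∂ρ, 0 ∈ F
  ae_unbounded : ∀ᵐ F : TopologicalSpace.Closeds ℝ ∂ρ,
    ∀ n : ℕ, ((F : Set ℝ) ∩ Set.Ioi (n : ℝ)).Nonempty
  map_splitAt : ∀ a : ℝ, 0 < a → ρ.map (splitAt a) = ((overshootLaw β).map fun u => a * u).prod ρ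

theorem IsStableSubordinator.ae_closedRange_eq (hX : IsStableSubordinator β X P) :
    ∀ᵐ ω ∂P, closedRange X ω =
      TopologicalSpace.Closeds.closure (Set.range fun i => X (dyadicTime i) ω) := by
  filter_upwards [hX.right_continuous] with ω h
  exact SetLike.coe_injective (closure_range_eq_closure_range_dyadic h)

theorem IsStableSubordinator.aemeasurable_closedRange (hX : IsStableSubordinator β X P) :
    AEMeasurable (closedRange X) P :=
  ⟨_, measurable_closeds_closure_range.comp
    (measurable_pi_lambda (fun ω i => X (dyadicTime i) ω) fun _ => hX.measurable _),
    hX.ae_closedRange_eq⟩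

/-- Almost surely the split consists of the overshoot and the closed range of `postPassage`; these
are independent, and the second is distributed as the whole closed range. -/
theorem IsStableSubordinator.map_splitAt [IsProbabilityMeasure P] (h0 : 0 < β) (h1 : β < 1)
    (hX : IsStableSubordinator β X P) {a : ℝ} (ha : 0 < a) :
    (P.map (closedRange X)).map (splitAt a) =
      ((overshootLaw β).map fun u => a * u).prod (P.map (closedRange X)) := by
  have hcl := measurable_closeds_closure_range (ι := ℕ × ℕ)
  have hpost : AEMeasurable (fun ω i => postPassage X a (dyadicTime i) ω) P :=
    aemeasurable_pi_lambda _ fun i => hX.aemeasurable_postPassage a (dyadicTime i)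
  have hpre : AEMeasurable (fun ω i => X (dyadicTime i) ω) P :=
    (measurable_pi_lambda _ fun i => hX.measurable _).aemeasurable
  have hsplit : (fun ω => splitAt a (closedRange X ω)) =ᵐ[P] fun ω =>
      (overshoot X a ω, TopologicalSpace.Closeds.closure
        (Set.range fun i => postPassage X a (dyadicTime i) ω)) := by
    filter_upwards [hX.ae_isSubordinatorPath, hX.ae_overshoot_pos h0 h1 ha,
      hX.ae_notMem_closure_range h0 h1 ha] with ω h2 h3 h4
    have e1 := h2.nextPoint_closure_range h4
    have e2 := h2.tailFrom_closure_range (sub_pos.mp h3)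
    have e3 : TopologicalSpace.Closeds.closure (Set.range fun u => postPassage X a u ω) =
        TopologicalSpace.Closeds.closure
          (Set.range fun i => postPassage X a (dyadicTime i) ω) :=
      SetLike.coe_injective (closure_range_eq_closure_range_dyadic (h2.right_cont_shift _))
    rw [splitAt, closedRange, e1, e2, ← e3]
    rfl
  have hind : IndepFun (overshoot X a) (fun ω => TopologicalSpace.Closeds.closure
      (Set.range fun i => postPassage X a (dyadicTime i) ω)) P :=
    (hX.indepFun_overshoot_postPassage a).comp (φ := id) measurable_id hcl
  have hlaw : P.map (fun ω => TopologicalSpace.Closeds.closure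
      (Set.range fun i => postPassage X a (dyadicTime i) ω)) = P.map (closedRange X) := by
    rw [Measure.map_congr hX.ae_closedRange_eq]
    have := congrArg (Measure.map fun x : ℕ × ℕ → ℝ =>
      TopologicalSpace.Closeds.closure (Set.range x)) (hX.map_postPassage a)
    rwa [AEMeasurable.map_map_of_aemeasurable hcl.aemeasurable hpost,
      AEMeasurable.map_map_of_aemeasurable hcl.aemeasurable hpre] at this
  rw [AEMeasurable.map_map_of_aemeasurable (measurable_splitAt a).aemeasurable
    hX.aemeasurable_closedRange, ← hX.map_overshoot h0 h1 ha, ← hlaw]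
  refine (Measure.map_congr hsplit).trans ?_
  exact (indepFun_iff_map_prod_eq_prod_map_map (hX.aemeasurable_overshoot a)
    (hcl.comp_aemeasurable hpost)).mp hind

theorem IsStableSubordinator.isStableRegenerativeLaw [IsProbabilityMeasure P] (h0 : 0 < β)
    (h1 : β < 1) (hX : IsStableSubordinator β X P) :
    IsStableRegenerativeLaw β (P.map (closedRange X)) where
  isProbabilityMeasure := Measure.isProbabilityMeasure_map hX.aemeasurable_closedRange
  ae_nonneg := by
    have hm : MeasurableSet {F : TopologicalSpace.Closeds ℝ | ∀ x ∈ F, 0 ≤ x} := by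
      convert! (measurableSet_closeds_hit_isOpen (isOpen_Iio (a := (0 : ℝ)))).compl using 1
      ext F
      simp only [Set.mem_ofPred_eq, Set.mem_compl_iff, Set.not_nonempty_iff_eq_empty,
        Set.eq_empty_iff_forall_notMem, Set.mem_inter_iff, Set.mem_Iio, not_and, not_lt]
      rfl
    rw [ae_map_iff hX.aemeasurable_closedRange hm]
    filter_upwards [hX.ae_nonneg] with ω h x hx
    refine closure_minimal ?_ isClosed_Ici hx
    rintro _ ⟨t, rfl⟩
    exact h t
  ae_zero_mem := by
    have hm : MeasurableSet {F : TopologicalSpace.Closeds ℝ | (0 : ℝ) ∈ F} := by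
      convert! measurableSet_closeds_hit_isCompact (isCompact_singleton (x := (0 : ℝ))) using 1
      ext F
      simp
    rw [ae_map_iff hX.aemeasurable_closedRange hm]
    filter_upwards [hX.start_zero] with ω h
    exact subset_closure ⟨0, h⟩
  ae_unbounded := by
    rw [ae_all_iff]
    intro n
    rw [ae_map_iff hX.aemeasurable_closedRange
      (measurableSet_closeds_hit_isOpen (isOpen_Ioi (a := (n : ℝ))))]
    filter_upwards [hX.ae_unbounded] with ω h
    obtain ⟨t, ht⟩ := h n
    exact ⟨_, subset_closure ⟨t, rfl⟩, ht⟩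
  map_splitAt _ ha := hX.map_splitAt h0 h1 ha

end Subordinator

/-! ### The leapfrog chain of two closed sets -/

/-- One step of the leapfrog chain. In the state `((s, a), (F₁, F₂))` the current position is `s`,
`F₂` is seen from the current position, and `F₁` from the point at distance `a` to its left. The
chain moves to the next point of `F₁`, and the sets exchange their roles. -/
noncomputable def leap
    (p : (ℝ × ℝ) × (TopologicalSpace.Closeds ℝ × TopologicalSpace.Closeds ℝ)) :
    (ℝ × ℝ) × (TopologicalSpace.Closeds ℝ × TopologicalSpace.Closeds ℝ) :=
  ((p.1.1 + (splitAt p.1.2 p.2.1).1, (splitAt p.1.2 p.2.1).1), (p.2.2, (splitAt p.1.2 p.2.1).2))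

theorem measurable_leap : Measurable leap := by
  have h : Measurable fun p : (ℝ × ℝ) × (TopologicalSpace.Closeds ℝ × TopologicalSpace.Closeds ℝ) =>
      splitAt p.1.2 p.2.1 :=
    Measurable.comp (g := fun p : ℝ × TopologicalSpace.Closeds ℝ => splitAt p.1 p.2)
      (f := fun p : (ℝ × ℝ) × (TopologicalSpace.Closeds ℝ × TopologicalSpace.Closeds ℝ) =>
        (p.1.2, p.2.1)) measurable_splitAt_uncurry (measurable_fst.snd.prodMk measurable_snd.fst)
  exact ((measurable_fst.fst.add h.fst).prodMk h.fst).prodMk (measurable_snd.snd.prodMk h.snd)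

section Chain

variable {β₁ β₂ : ℝ} {ρ₁ ρ₂ : Measure (TopologicalSpace.Closeds ℝ)}

/-- The one-step transition: the gap is multiplied by an overshoot factor `u`, and the two sets, in
exchanged order, are again independent with their original laws and independent of `u`. Hence
inductions along the chain exchange the indices at each step. -/
theorem lintegral_leap [SFinite (overshootLaw β₁)] [IsProbabilityMeasure ρ₂]
    (h₁ : IsStableRegenerativeLaw β₁ ρ₁)
    (s : ℝ) {a : ℝ} (ha : 0 < a)
    {f : (ℝ × ℝ) × (TopologicalSpace.Closeds ℝ × TopologicalSpace.Closeds ℝ) → ℝ≥0∞}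
    (hf : Measurable f) :
    ∫⁻ F, f (leap ((s, a), F)) ∂(ρ₁.prod ρ₂) =
      ∫⁻ u, (∫⁻ G, f ((s + a * u, a * u), G) ∂(ρ₂.prod ρ₁)) ∂(overshootLaw β₁) := by
  have := h₁.isProbabilityMeasure
  have hs : Measurable fun F : TopologicalSpace.Closeds ℝ × TopologicalSpace.Closeds ℝ =>
      f (leap ((s, a), F)) :=
    hf.comp (measurable_leap.comp (measurable_const.prodMk measurable_id))
  have hinner : ∀ F₂, ∫⁻ F₁, f (leap ((s, a), (F₁, F₂))) ∂ρ₁ =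
      ∫⁻ u, (∫⁻ T, f ((s + a * u, a * u), (F₂, T)) ∂ρ₁) ∂(overshootLaw β₁) := by
    intro F₂
    have hg : Measurable fun q : ℝ × TopologicalSpace.Closeds ℝ =>
        f ((s + q.1, q.1), (F₂, q.2)) := by fun_prop
    have e := lintegral_map (μ := ρ₁) hg (measurable_splitAt a)
    rw [h₁.map_splitAt a ha, lintegral_prod _ hg.aemeasurable,
      lintegral_map hg.lintegral_prod_right' (by fun_prop)] at e
    exact e.symm
  rw [lintegral_prod_symm _ hs.aemeasurable]
  simp_rw [hinner]
  have hm : Measurable fun q : TopologicalSpace.Closeds ℝ × ℝ =>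
      ∫⁻ T, f ((s + a * q.2, a * q.2), (q.1, T)) ∂ρ₁ :=
    Measurable.lintegral_prod_right' (f := fun q : (TopologicalSpace.Closeds ℝ × ℝ) ×
      TopologicalSpace.Closeds ℝ => f ((s + a * q.1.2, a * q.1.2), (q.1.1, q.2))) (by fun_prop)
  rw [lintegral_lintegral_swap hm.aemeasurable]
  refine lintegral_congr fun u => ?_
  rw [lintegral_prod _ (by fun_prop)]

theorem ae_leap [SFinite (overshootLaw β₁)] [IsProbabilityMeasure ρ₂]
    (h₁ : IsStableRegenerativeLaw β₁ ρ₁) (s : ℝ) {a : ℝ} (ha : 0 < a)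
    {A : Set ((ℝ × ℝ) × (TopologicalSpace.Closeds ℝ × TopologicalSpace.Closeds ℝ))}
    (hA : MeasurableSet A)
    (h : ∀ᵐ u ∂(overshootLaw β₁), ∀ᵐ G ∂(ρ₂.prod ρ₁), ((s + a * u, a * u), G) ∈ A) :
    ∀ᵐ F ∂(ρ₁.prod ρ₂), leap ((s, a), F) ∈ A := by
  have hf : Measurable (Aᶜ.indicator (1 :
    (ℝ × ℝ) × (TopologicalSpace.Closeds ℝ × TopologicalSpace.Closeds ℝ) → ℝ≥0∞)) :=
    measurable_one.indicator hA.compl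
  have e := lintegral_leap (ρ₂ := ρ₂) h₁ s ha hf
  have h0 : ∫⁻ u, (∫⁻ G, Aᶜ.indicator 1 ((s + a * u, a * u), G) ∂(ρ₂.prod ρ₁))
      ∂(overshootLaw β₁) = 0 := by
    refine (lintegral_congr_ae ?_).trans lintegral_zero
    filter_upwards [h] with u hu
    refine (lintegral_congr_ae ?_).trans lintegral_zero
    filter_upwards [hu] with G hG
    exact Set.indicator_of_notMem (Set.notMem_compl_iff.mpr hG) _
  have hs : Measurable fun F : TopologicalSpace.Closeds ℝ × TopologicalSpace.Closeds ℝ =>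
      Aᶜ.indicator (1 :
        (ℝ × ℝ) × (TopologicalSpace.Closeds ℝ × TopologicalSpace.Closeds ℝ) → ℝ≥0∞)
        (leap ((s, a), F)) :=
    hf.comp (measurable_leap.comp (measurable_const.prodMk measurable_id))
  rw [h0, lintegral_eq_zero_iff hs] at e
  filter_upwards [e] with F hF
  by_contra hn
  rw [Set.indicator_of_mem (by exact hn)] at hF
  exact one_ne_zero hF

/-- States of the leapfrog chain at a positive distance `a`, with the first set unbounded. -/
def regularStates : Set ((ℝ × ℝ) × (TopologicalSpace.Closeds ℝ × TopologicalSpace.Closeds ℝ)) :=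
  {p | 0 < p.1.2 ∧ ∀ n : ℕ, ((p.2.1 : Set ℝ) ∩ Set.Ioi (n : ℝ)).Nonempty}

theorem measurableSet_regularStates : MeasurableSet regularStates := by
  have : regularStates = {p | 0 < p.1.2} ∩ ⋂ n : ℕ, (fun p => p.2.1) ⁻¹'
      {F : TopologicalSpace.Closeds ℝ | ((F : Set ℝ) ∩ Set.Ioi (n : ℝ)).Nonempty} := by
    ext p; simp [regularStates]
  rw [this]
  exact (measurableSet_lt measurable_const measurable_fst.snd).inter (MeasurableSet.iInter fun n =>
    (measurableSet_closeds_hit_isOpen isOpen_Ioi).preimage measurable_snd.fst)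

theorem ae_iterate_leap_mem_regularStates (n : ℕ) {β₁ β₂ : ℝ}
    {ρ₁ ρ₂ : Measure (TopologicalSpace.Closeds ℝ)} [IsProbabilityMeasure (overshootLaw β₁)]
    [IsProbabilityMeasure (overshootLaw β₂)] (h₁ : IsStableRegenerativeLaw β₁ ρ₁)
    (h₂ : IsStableRegenerativeLaw β₂ ρ₂) (s : ℝ) {a : ℝ} (ha : 0 < a) :
    ∀ᵐ F ∂(ρ₁.prod ρ₂), leap^[n] ((s, a), F) ∈ regularStates := by
  induction n generalizing β₁ β₂ ρ₁ ρ₂ s a with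
  | zero =>
    have := h₁.isProbabilityMeasure
    have := h₂.isProbabilityMeasure
    filter_upwards [Measure.quasiMeasurePreserving_fst.ae h₁.ae_unbounded] with F hF
    exact ⟨ha, hF⟩
  | succ n ih =>
    have := h₁.isProbabilityMeasure
    have := h₂.isProbabilityMeasure
    simp_rw [Function.iterate_succ_apply]
    refine ae_leap (A := leap^[n] ⁻¹' regularStates) h₁ s ha
      (measurableSet_regularStates.preimage (measurable_leap.iterate n)) ?_
    filter_upwards [ae_overshootLaw_pos β₁] with u hu
    exact ih h₂ h₁ (s + a * u) (mul_pos ha hu)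

/-- `hittingCDF` with the two indices exchanged `n` times. -/
noncomputable def alternatingCDF : ℕ → ℝ → ℝ → ℝ → ℝ≥0∞
  | 0, β₁, β₂ => hittingCDF β₁ β₂
  | n + 1, β₁, β₂ => alternatingCDF n β₂ β₁

theorem alternatingCDF_eq_or (n : ℕ) (β₁ β₂ : ℝ) :
    alternatingCDF n β₁ β₂ = hittingCDF β₁ β₂ ∨ alternatingCDF n β₁ β₂ = hittingCDF β₂ β₁ := by
  induction n generalizing β₁ β₂ with
  | zero => exact Or.inl rfl
  | succ n ih => exact (ih β₂ β₁).symm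

theorem measurable_alternatingCDF (hβ₁ : β₁ < 1) (hβ₂ : β₂ < 1) (n : ℕ) :
    Measurable (alternatingCDF n β₁ β₂) := by
  rcases alternatingCDF_eq_or n β₁ β₂ with h | h <;> rw [h]
  · exact (monotone_hittingCDF hβ₁ β₂).measurable
  · exact (monotone_hittingCDF hβ₂ β₁).measurable

/-- The martingale property: a leap with factor `u` turns `x = (z - s) / a` into `(z - s - a * u) /
(a * u) = x / u - 1`, so each step is an instance of the recursion for `hittingCDF`. -/
theorem lintegral_alternatingCDF_iterate_leap (n : ℕ) {β₁ β₂ : ℝ} (hβ₁ : β₁ ∈ Set.Ioo (0 : ℝ) 1)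
    (hβ₂ : β₂ ∈ Set.Ioo (0 : ℝ) 1) {ρ₁ ρ₂ : Measure (TopologicalSpace.Closeds ℝ)}
    (h₁ : IsStableRegenerativeLaw β₁ ρ₁) (h₂ : IsStableRegenerativeLaw β₂ ρ₂) (z s : ℝ) {a : ℝ}
    (ha : 0 < a) :
    ∫⁻ F, alternatingCDF n β₁ β₂ ((z - (leap^[n] ((s, a), F)).1.1) / (leap^[n] ((s, a), F)).1.2)
      ∂(ρ₁.prod ρ₂) = hittingCDF β₁ β₂ ((z - s) / a) := by
  induction n generalizing β₁ β₂ ρ₁ ρ₂ s a with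
  | zero =>
    have := h₁.isProbabilityMeasure
    have := h₂.isProbabilityMeasure
    simp [alternatingCDF]
  | succ n ih =>
    have := h₁.isProbabilityMeasure
    have := h₂.isProbabilityMeasure
    have := isProbabilityMeasure_overshootLaw hβ₁.1 hβ₁.2
    simp_rw [Function.iterate_succ_apply]
    have hm := measurable_leap.iterate n
    rw [lintegral_leap (f := fun p => alternatingCDF (n + 1) β₁ β₂
        ((z - (leap^[n] p).1.1) / (leap^[n] p).1.2)) h₁ s ha
      ((measurable_alternatingCDF hβ₁.2 hβ₂.2 (n + 1)).comp
        ((hm.fst.fst.const_sub z).div hm.fst.snd)), ← lintegral_hittingCDF_overshootLaw hβ₁]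
    refine lintegral_congr_ae ?_
    filter_upwards [ae_overshootLaw_pos β₁] with u hu
    refine (ih hβ₂ hβ₁ h₂ h₁ (s + a * u) (mul_pos ha hu)).trans ?_
    congr 1
    field_simp
    ring

/-- The product of the first `n` terms of the sequence `m₁, m₂, m₁, m₂, …`. -/
noncomputable def alternatingProd : ℕ → ℝ≥0∞ → ℝ≥0∞ → ℝ≥0∞
  | 0, _, _ => 1
  | n + 1, m₁, m₂ => m₁ * alternatingProd n m₂ m₁

/-- Even and odd terms form geometric series with ratio `m₁ * m₂`; neither factor need be below `1`
by itself. -/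
theorem tsum_alternatingProd_ne_top {m₁ m₂ : ℝ≥0∞} (h₁ : m₁ ≠ ∞) (h : m₁ * m₂ < 1) :
    ∑' n, alternatingProd n m₁ m₂ ≠ ∞ := by
  have heven : ∀ k, alternatingProd (2 * k) m₁ m₂ = (m₁ * m₂) ^ k := by
    intro k
    induction k with
    | zero => simp [alternatingProd]
    | succ k ih =>
      rw [show 2 * (k + 1) = 2 * k + 1 + 1 by ring, alternatingProd, alternatingProd, ih, pow_succ,
        ← mul_assoc, mul_comm]
  have hodd : ∀ k, alternatingProd (2 * k + 1) m₁ m₂ = m₁ * (m₁ * m₂) ^ k := by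
    intro k
    induction k with
    | zero => simp [alternatingProd]
    | succ k ih =>
      rw [show 2 * (k + 1) + 1 = (2 * k + 1) + 1 + 1 by ring, alternatingProd, alternatingProd, ih,
        pow_succ]
      ring
  have hgeom : ∑' k, (m₁ * m₂) ^ k ≠ ∞ := by
    rw [ENNReal.tsum_geometric]
    exact ENNReal.inv_ne_top.mpr (tsub_pos_of_lt h).ne'
  rw [← tsum_even_add_odd ENNReal.summable ENNReal.summable]
  simp_rw [heven, hodd, ENNReal.tsum_mul_left]
  exact ENNReal.add_ne_top.mpr ⟨hgeom, ENNReal.mul_ne_top h₁ hgeom⟩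

theorem lintegral_rpow_iterate_leap (n : ℕ) {β₁ β₂ : ℝ} (r : ℝ)
    [IsProbabilityMeasure (overshootLaw β₁)] [IsProbabilityMeasure (overshootLaw β₂)]
    {ρ₁ ρ₂ : Measure (TopologicalSpace.Closeds ℝ)}
    (h₁ : IsStableRegenerativeLaw β₁ ρ₁) (h₂ : IsStableRegenerativeLaw β₂ ρ₂) (s : ℝ) {a : ℝ}
    (ha : 0 < a) :
    ∫⁻ F, ENNReal.ofReal ((leap^[n] ((s, a), F)).1.2 ^ r) ∂(ρ₁.prod ρ₂) =
      alternatingProd n (∫⁻ u, ENNReal.ofReal (u ^ r) ∂(overshootLaw β₁))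
        (∫⁻ u, ENNReal.ofReal (u ^ r) ∂(overshootLaw β₂)) * ENNReal.ofReal (a ^ r) := by
  induction n generalizing β₁ β₂ ρ₁ ρ₂ s a with
  | zero =>
    have := h₁.isProbabilityMeasure
    have := h₂.isProbabilityMeasure
    simp [alternatingProd]
  | succ n ih =>
    have := h₁.isProbabilityMeasure
    have := h₂.isProbabilityMeasure
    simp_rw [Function.iterate_succ_apply]
    have hm := measurable_leap.iterate n
    rw [lintegral_leap (f := fun p => ENNReal.ofReal ((leap^[n] p).1.2 ^ r)) h₁ s ha
      (hm.fst.snd.pow_const r).ennreal_ofReal]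
    have e : ∫⁻ u, (∫⁻ G, ENNReal.ofReal ((leap^[n] ((s + a * u, a * u), G)).1.2 ^ r)
        ∂(ρ₂.prod ρ₁)) ∂(overshootLaw β₁) =
        ∫⁻ u, (alternatingProd n (∫⁻ u, ENNReal.ofReal (u ^ r) ∂(overshootLaw β₂))
          (∫⁻ u, ENNReal.ofReal (u ^ r) ∂(overshootLaw β₁)) * ENNReal.ofReal (a ^ r)) *
          ENNReal.ofReal (u ^ r) ∂(overshootLaw β₁) := by
      refine lintegral_congr_ae ?_
      filter_upwards [ae_overshootLaw_pos β₁] with u hu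
      rw [ih h₂ h₁ (s + a * u) (mul_pos ha hu), Real.mul_rpow ha.le hu.le,
        ENNReal.ofReal_mul (by positivity), mul_assoc]
    rw [e, lintegral_const_mul _ (by fun_prop), alternatingProd]
    ring

end Chain

/-! ### Orbits of the leapfrog chain -/

theorem inter_Ici_nonempty_of_mem_regularStates
    {p : (ℝ × ℝ) × (TopologicalSpace.Closeds ℝ × TopologicalSpace.Closeds ℝ)}
    (hp : p ∈ regularStates) : ((p.2.1 : Set ℝ) ∩ Set.Ici p.1.2).Nonempty := by
  obtain ⟨n, hn⟩ := exists_nat_ge p.1.2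
  obtain ⟨x, hx, hnx⟩ := hp.2 n
  exact ⟨x, hx, hn.trans (le_of_lt hnx)⟩

theorem splitAt_fst_nonneg {a : ℝ} {F : TopologicalSpace.Closeds ℝ}
    (h : ((F : Set ℝ) ∩ Set.Ici a).Nonempty) : 0 ≤ (splitAt a F).1 :=
  sub_nonneg.mpr (isLeast_nextPoint h).1.2

theorem add_splitAt_fst_mem {a : ℝ} {F : TopologicalSpace.Closeds ℝ}
    (h : ((F : Set ℝ) ∩ Set.Ici a).Nonempty) : a + (splitAt a F).1 ∈ F := by
  have := (isLeast_nextPoint h).1.1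
  simpa [splitAt] using this

theorem mem_splitAt_snd {a x : ℝ} {F : TopologicalSpace.Closeds ℝ} :
    x ∈ (splitAt a F).2 ↔ 0 ≤ x ∧ a + (splitAt a F).1 + x ∈ F := by
  simp [splitAt, mem_tailFrom]

theorem iterate_leap_fst_succ
    (p : (ℝ × ℝ) × (TopologicalSpace.Closeds ℝ × TopologicalSpace.Closeds ℝ)) (n : ℕ) :
    (leap^[n + 1] p).1.1 = (leap^[n] p).1.1 + (leap^[n + 1] p).1.2 := by
  rw [Function.iterate_succ_apply']
  rfl

/-- A leap ends at the first available point of its set and so cannot pass a common point. Seen from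
the new position with the roles exchanged, that point is at distance `y - b`. -/
theorem iterate_leap_le_of_mem (n : ℕ) {s a y : ℝ} {A B : TopologicalSpace.Closeds ℝ}
    (hreg : ∀ n, leap^[n] ((s, a), (A, B)) ∈ regularStates) (hy : 0 ≤ y) (hA : a + y ∈ A)
    (hB : y ∈ B) : (leap^[n] ((s, a), (A, B))).1.1 ≤ s + y := by
  induction n generalizing s a y A B with
  | zero => simpa using hy
  | succ n ih =>
    have hne := inter_Ici_nonempty_of_mem_regularStates (hreg 0)
    set b := (splitAt a A).1 with hb
    have hby : b ≤ y := by
      have := (isLeast_nextPoint hne).2 ⟨hA, by simpa using hy⟩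
      rw [hb, splitAt, sub_le_iff_le_add, add_comm]
      exact this
    have := ih (s := s + b) (a := b) (A := B) (B := (splitAt a A).2) (y := y - b)
      (fun n => hreg (n + 1)) (by linarith) (by simpa using hB)
      (mem_splitAt_snd.mpr ⟨by linarith, by rw [← hb]; convert hA using 1; ring⟩)
    rw [Function.iterate_succ_apply]
    refine le_trans this ?_
    linarith

/-- A leap starts at a point of one set and ends at a point of the other, so each step interval
contains points of both. -/
theorem exists_mem_between_iterate_leap (n : ℕ) {s a : ℝ} {A B : TopologicalSpace.Closeds ℝ}
    (hreg : ∀ n, leap^[n] ((s, a), (A, B)) ∈ regularStates) (h0 : 0 ∈ B) :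
    (∃ u ∈ Set.Icc (leap^[n] ((s, a), (A, B))).1.1 (leap^[n + 1] ((s, a), (A, B))).1.1,
        a + (u - s) ∈ A) ∧
      ∃ v ∈ Set.Icc (leap^[n] ((s, a), (A, B))).1.1 (leap^[n + 1] ((s, a), (A, B))).1.1,
        v - s ∈ B := by
  induction n generalizing s a A B with
  | zero =>
    have hne := inter_Ici_nonempty_of_mem_regularStates (hreg 0)
    have hb := splitAt_fst_nonneg hne
    have hmem := add_splitAt_fst_mem hne
    simp only [Function.iterate_zero, id_eq, zero_add, Function.iterate_one, leap] at hb hmem ⊢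
    exact ⟨⟨s + (splitAt a A).1, ⟨by linarith, le_rfl⟩, by simpa using hmem⟩,
      ⟨s, ⟨le_rfl, by linarith⟩, by simpa using h0⟩⟩
  | succ n ih =>
    have hne := inter_Ici_nonempty_of_mem_regularStates (hreg 0)
    obtain ⟨⟨u, hu, huB⟩, ⟨v, hv, hvA⟩⟩ := ih (s := s + (splitAt a A).1) (a := (splitAt a A).1)
      (A := B) (B := (splitAt a A).2) (fun n => hreg (n + 1))
      (mem_splitAt_snd.mpr ⟨le_rfl, by simpa using add_splitAt_fst_mem hne⟩)
    rw [Function.iterate_succ_apply, Function.iterate_succ_apply]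
    refine ⟨⟨v, hv, ?_⟩, ⟨u, hu, ?_⟩⟩
    · convert (mem_splitAt_snd.mp hvA).2 using 1; ring
    · convert huB using 1; ring

/-- The points of both sets between consecutive positions are squeezed to the limit, which belongs
to both sets by closedness; every common point bounds all positions and hence the limit. -/
theorem isLeast_inter_of_tendsto_iterate_leap {a L : ℝ} {A B : TopologicalSpace.Closeds ℝ}
    (hreg : ∀ n, leap^[n] ((0, a), (A, B)) ∈ regularStates) (h0 : 0 ∈ B) (hB : ∀ x ∈ B, 0 ≤ x)
    (hL : Filter.Tendsto (fun n => (leap^[n] ((0, a), (A, B))).1.1) Filter.atTop (nhds L)) :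
    IsLeast ((A : Set ℝ) ∩ (fun r => a + r) '' (B : Set ℝ)) (a + L) := by
  have hL' := hL.comp (Filter.tendsto_add_atTop_nat 1)
  choose h1 h2 using fun n => exists_mem_between_iterate_leap n hreg h0
  choose u hu huA using h1
  choose v hv hvB using h2
  have hul := tendsto_of_tendsto_of_tendsto_of_le_of_le hL hL' (fun n => (hu n).1) fun n => (hu n).2
  have hvl := tendsto_of_tendsto_of_tendsto_of_le_of_le hL hL' (fun n => (hv n).1) fun n => (hv n).2
  simp only [sub_zero] at huA hvB
  refine ⟨⟨?_, L, ?_, rfl⟩, ?_⟩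
  · exact A.isClosed.mem_of_tendsto (hul.const_add a) (Filter.Eventually.of_forall huA)
  · exact B.isClosed.mem_of_tendsto hvl (Filter.Eventually.of_forall hvB)
  · rintro _ ⟨hA, y, hy, rfl⟩
    have := le_of_tendsto' hL fun n => iterate_leap_le_of_mem n hreg (hB y hy) hA hy
    simpa using this

/-- Summability of the powers forces the terms below `1` eventually, and there `x ≤ x ^ r` for `r ≤
1`. -/
theorem summable_of_tsum_ofReal_rpow_ne_top {x : ℕ → ℝ} {r : ℝ} (hr0 : 0 < r) (hr : r ≤ 1)
    (hx : ∀ n, 0 < x n) (h : ∑' n, ENNReal.ofReal (x n ^ r) ≠ ∞) : Summable x := by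
  have hs : Summable fun n => x n ^ r := by
    have := ENNReal.summable_toReal h
    refine this.congr fun n => ENNReal.toReal_ofReal (Real.rpow_nonneg (hx n).le r)
  refine hs.of_norm_bounded_eventually_nat ?_
  filter_upwards [hs.tendsto_atTop_zero.eventually_lt_const one_pos] with n hn
  rw [Real.norm_of_nonneg (hx n).le]
  rcases le_or_gt (x n) 1 with h1 | h1
  · calc x n = x n ^ (1 : ℝ) := (Real.rpow_one _).symm
      _ ≤ x n ^ r := Real.rpow_le_rpow_of_exponent_ge (hx n) h1 hr
  · exact absurd (Real.one_le_rpow h1.le hr0.le) (not_le.mpr hn)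

/-- The first point of `F₁ ∩ (a + F₂)`, measured from `a`. -/
noncomputable def meetingTime (a : ℝ)
    (F : TopologicalSpace.Closeds ℝ × TopologicalSpace.Closeds ℝ) : ℝ :=
  sInf ((F.1 : Set ℝ) ∩ (fun r => a + r) '' (F.2 : Set ℝ)) - a

/-! ### The law of the meeting time. -/

section Meeting

variable {β₁ β₂ : ℝ} {ρ₁ ρ₂ : Measure (TopologicalSpace.Closeds ℝ)}

theorem ae_summable_iterate_leap (hβ₁ : β₁ ∈ Set.Ioo (0 : ℝ) 1) (hβ₂ : β₂ ∈ Set.Ioo (0 : ℝ) 1)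
    (hβ : 0 < β₁ + β₂ - 1) (h₁ : IsStableRegenerativeLaw β₁ ρ₁)
    (h₂ : IsStableRegenerativeLaw β₂ ρ₂) {a : ℝ} (ha : 0 < a) :
    ∀ᵐ F ∂(ρ₁.prod ρ₂), (∀ n, leap^[n] ((0, a), F) ∈ regularStates) ∧
      Summable fun n => (leap^[n] ((0, a), F)).1.2 := by
  have := isProbabilityMeasure_overshootLaw hβ₁.1 hβ₁.2
  have := isProbabilityMeasure_overshootLaw hβ₂.1 hβ₂.2
  obtain ⟨r, hr0, hr⟩ := exists_between hβ
  have hm : ∀ n, Measurable fun F => ENNReal.ofReal ((leap^[n] ((0, a), F)).1.2 ^ r) := fun n =>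
    (((measurable_leap.iterate n).comp (measurable_const.prodMk measurable_id)).fst.snd.pow_const
      r).ennreal_ofReal
  -- The expected sum of the `r`-th powers of the gaps is a sum of alternating products of moments,
  -- finite because two consecutive factors contract when `0 < r < β₁ + β₂ - 1`.
  have hfin : ∫⁻ F, ∑' n, ENNReal.ofReal ((leap^[n] ((0, a), F)).1.2 ^ r) ∂(ρ₁.prod ρ₂) ≠ ∞ := by
    rw [lintegral_tsum fun n => (hm n).aemeasurable]
    simp_rw [lintegral_rpow_iterate_leap _ r h₁ h₂ 0 ha, ENNReal.tsum_mul_right]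
    refine ENNReal.mul_ne_top (tsum_alternatingProd_ne_top ?_ ?_) ENNReal.ofReal_ne_top
    · rw [lintegral_rpow_overshootLaw hβ₁.1 hβ₁.2 hr0.le (by linarith [hβ₂.2])]
      exact ENNReal.ofReal_ne_top
    · have hs₁ := sin_pi_mul_pos hβ₁.1 hβ₁.2
      have hs₂ : 0 < Real.sin (Real.pi * (β₁ - r)) :=
        sin_pi_mul_pos (by linarith [hβ₂.2]) (by linarith [hβ₁.2])
      rw [lintegral_rpow_overshootLaw hβ₁.1 hβ₁.2 hr0.le (by linarith [hβ₂.2]),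
        lintegral_rpow_overshootLaw hβ₂.1 hβ₂.2 hr0.le (by linarith [hβ₁.2]),
        ← ENNReal.ofReal_mul (by positivity), ENNReal.ofReal_lt_one]
      exact overshoot_moments_lt_one hβ₁ hβ₂ hr0 hr
  filter_upwards [ae_all_iff.mpr fun n => ae_iterate_leap_mem_regularStates n h₁ h₂ 0 ha,
    ae_lt_top (Measurable.tsum hm) hfin] with F hreg hF
  exact ⟨hreg, summable_of_tsum_ofReal_rpow_ne_top hr0 (by linarith [hβ₁.2, hβ₂.2])
    (fun n => (hreg n).1) hF.ne⟩

theorem ae_tendsto_iterate_leap (hβ₁ : β₁ ∈ Set.Ioo (0 : ℝ) 1) (hβ₂ : β₂ ∈ Set.Ioo (0 : ℝ) 1)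
    (hβ : 0 < β₁ + β₂ - 1) (h₁ : IsStableRegenerativeLaw β₁ ρ₁)
    (h₂ : IsStableRegenerativeLaw β₂ ρ₂) {a : ℝ} (ha : 0 < a) :
    ∀ᵐ F ∂(ρ₁.prod ρ₂), (∀ n, 0 < (leap^[n] ((0, a), F)).1.2) ∧
      StrictMono (fun n => (leap^[n] ((0, a), F)).1.1) ∧
      Filter.Tendsto (fun n => (leap^[n] ((0, a), F)).1.2) Filter.atTop (nhds 0) ∧
      Filter.Tendsto (fun n => (leap^[n] ((0, a), F)).1.1) Filter.atTop
        (nhds (meetingTime a F)) ∧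
      IsLeast ((F.1 : Set ℝ) ∩ (fun r => a + r) '' (F.2 : Set ℝ)) (a + meetingTime a F) := by
  have := h₁.isProbabilityMeasure
  have := h₂.isProbabilityMeasure
  filter_upwards [ae_summable_iterate_leap hβ₁ hβ₂ hβ h₁ h₂ ha,
    Measure.quasiMeasurePreserving_snd.ae h₂.ae_nonneg,
    Measure.quasiMeasurePreserving_snd.ae h₂.ae_zero_mem] with F hF hnn h0
  obtain ⟨hreg, hsum⟩ := hF
  have hs : ∀ n, (leap^[n] ((0, a), F)).1.1 =
      ∑ i ∈ Finset.range n, (leap^[i + 1] ((0, a), F)).1.2 := by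
    intro n
    induction n with
    | zero => rfl
    | succ n ih => rw [iterate_leap_fst_succ, ih, Finset.sum_range_succ]
  have hlim : Filter.Tendsto (fun n => (leap^[n] ((0, a), F)).1.1) Filter.atTop
      (nhds (∑' i, (leap^[i + 1] ((0, a), F)).1.2)) := by
    simp_rw [hs]
    exact ((summable_nat_add_iff 1).mpr hsum).hasSum.tendsto_sum_nat
  have hleast := isLeast_inter_of_tendsto_iterate_leap hreg h0 hnn hlim
  have hT : meetingTime a F = ∑' i, (leap^[i + 1] ((0, a), F)).1.2 := by
    rw [meetingTime, hleast.csInf_eq, add_sub_cancel_left]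
  rw [hT]
  refine ⟨fun n => (hreg n).1, strictMono_nat_of_lt_succ fun n => ?_, hsum.tendsto_atTop_zero,
    hlim, hleast⟩
  rw [iterate_leap_fst_succ]
  exact lt_add_of_pos_right _ (hreg (n + 1)).1

theorem ae_isLeast_meetingTime (hβ₁ : β₁ ∈ Set.Ioo (0 : ℝ) 1) (hβ₂ : β₂ ∈ Set.Ioo (0 : ℝ) 1)
    (hβ : 0 < β₁ + β₂ - 1) (h₁ : IsStableRegenerativeLaw β₁ ρ₁)
    (h₂ : IsStableRegenerativeLaw β₂ ρ₂) {a : ℝ} (ha : 0 < a) :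
    ∀ᵐ F ∂(ρ₁.prod ρ₂),
      IsLeast ((F.1 : Set ℝ) ∩ (fun r => a + r) '' (F.2 : Set ℝ)) (a + meetingTime a F) := by
  filter_upwards [ae_tendsto_iterate_leap hβ₁ hβ₂ hβ h₁ h₂ ha] with F hF using hF.2.2.2.2

theorem ae_meetingTime_pos (hβ₁ : β₁ ∈ Set.Ioo (0 : ℝ) 1) (hβ₂ : β₂ ∈ Set.Ioo (0 : ℝ) 1)
    (hβ : 0 < β₁ + β₂ - 1) (h₁ : IsStableRegenerativeLaw β₁ ρ₁)
    (h₂ : IsStableRegenerativeLaw β₂ ρ₂) {a : ℝ} (ha : 0 < a) :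
    ∀ᵐ F ∂(ρ₁.prod ρ₂), 0 < meetingTime a F := by
  filter_upwards [ae_tendsto_iterate_leap hβ₁ hβ₂ hβ h₁ h₂ ha] with F hF
  exact (hF.2.1 one_pos).trans_le (hF.2.1.monotone.ge_of_tendsto hF.2.2.2.1 1)

theorem aemeasurable_meetingTime (hβ₁ : β₁ ∈ Set.Ioo (0 : ℝ) 1) (hβ₂ : β₂ ∈ Set.Ioo (0 : ℝ) 1)
    (hβ : 0 < β₁ + β₂ - 1) (h₁ : IsStableRegenerativeLaw β₁ ρ₁)
    (h₂ : IsStableRegenerativeLaw β₂ ρ₂) {a : ℝ} (ha : 0 < a) :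
    AEMeasurable (meetingTime a) (ρ₁.prod ρ₂) := by
  refine aemeasurable_of_tendsto_metrizable_ae Filter.atTop
    (f := fun n F => (leap^[n] ((0, a), F)).1.1) (fun n => ?_) ?_
  · exact ((measurable_leap.iterate n).comp
      (measurable_const.prodMk measurable_id)).fst.fst.aemeasurable
  · filter_upwards [ae_tendsto_iterate_leap hβ₁ hβ₂ hβ h₁ h₂ ha] with F hF using hF.2.2.2.1

theorem alternatingCDF_le_one (hβ₁ : β₁ < 1) (hβ₂ : β₂ < 1) (hβ : 0 < β₁ + β₂ - 1) (n : ℕ)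
    (x : ℝ) : alternatingCDF n β₁ β₂ x ≤ 1 := by
  rcases alternatingCDF_eq_or n β₁ β₂ with h | h <;> rw [h]
  · exact hittingCDF_le_one hβ₁ hβ (by linarith) x
  · exact hittingCDF_le_one hβ₂ (by linarith) (by linarith) x

theorem alternatingCDF_of_nonpos (n : ℕ) {x : ℝ} (hx : x ≤ 0) : alternatingCDF n β₁ β₂ x = 0 := by
  rcases alternatingCDF_eq_or n β₁ β₂ with h | h <;> rw [h] <;> exact hittingCDF_of_nonpos _ _ hx

/-- The function itself changes with `n`, but only between two orders of the indices; the constant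
`C + C'` bounds both tails. -/
theorem tendsto_alternatingCDF (hβ₁ : β₁ ∈ Set.Ioo (0 : ℝ) 1) (hβ₂ : β₂ ∈ Set.Ioo (0 : ℝ) 1)
    (hβ : 0 < β₁ + β₂ - 1) {x : ℕ → ℝ} (hx : Filter.Tendsto x Filter.atTop Filter.atTop) :
    Filter.Tendsto (fun n => alternatingCDF n β₁ β₂ (x n)) Filter.atTop (nhds 1) := by
  obtain ⟨r, hr0, hr⟩ := exists_between hβ
  obtain ⟨C, hC, h1⟩ := one_le_hittingCDF_add (β₂ := β₂) hβ₁ (by linarith [hβ₁.2, hβ₂.2]) hr0.le hr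
  obtain ⟨C', hC', h2⟩ := one_le_hittingCDF_add (β₂ := β₁) hβ₂ (by linarith [hβ₁.2, hβ₂.2]) hr0.le
    (by linarith)
  have hbound : ∀ n, ∀ y > 0, 1 - ENNReal.ofReal ((C + C') * y ^ (-r)) ≤
      alternatingCDF n β₁ β₂ y := by
    intro n y hy
    have hyr : 0 ≤ y ^ (-r) := Real.rpow_nonneg hy.le _
    rw [tsub_le_iff_right]
    rcases alternatingCDF_eq_or n β₁ β₂ with h | h <;> rw [h]
    · refine (h1 y hy).trans ?_
      gcongr
      linarith
    · refine (h2 y hy).trans ?_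
      gcongr
      linarith
  have hlow : Filter.Tendsto (fun n => 1 - ENNReal.ofReal ((C + C') * x n ^ (-r))) Filter.atTop
      (nhds 1) := by
    have h0 := ((tendsto_rpow_neg_atTop hr0).comp hx).const_mul (C + C')
    rw [mul_zero] at h0
    have h3 := ENNReal.tendsto_ofReal h0
    rw [ENNReal.ofReal_zero] at h3
    simpa using ENNReal.Tendsto.sub (tendsto_const_nhds (x := (1 : ℝ≥0∞))) h3
      (Or.inl ENNReal.one_ne_top)
  refine tendsto_of_tendsto_of_tendsto_of_le_of_le' hlow tendsto_const_nhds ?_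
    (Filter.Eventually.of_forall fun n => alternatingCDF_le_one hβ₁.2 hβ₂.2 hβ n _)
  filter_upwards [hx.eventually_gt_atTop 0] with n hn using hbound n _ hn

/-- If `meetingTime a F < z`, the numerator `z - position` keeps a positive limit while the gap
tends to `0`, so `Φ n F → 1`. Fatou's lemma applies since every `Φ n` has the same integral. -/
theorem measure_meetingTime_lt_le (hβ₁ : β₁ ∈ Set.Ioo (0 : ℝ) 1) (hβ₂ : β₂ ∈ Set.Ioo (0 : ℝ) 1)
    (hβ : 0 < β₁ + β₂ - 1) (h₁ : IsStableRegenerativeLaw β₁ ρ₁)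
    (h₂ : IsStableRegenerativeLaw β₂ ρ₂) {a : ℝ} (ha : 0 < a) (z : ℝ) :
    (ρ₁.prod ρ₂) {F | meetingTime a F < z} ≤ hittingCDF β₁ β₂ (z / a) := by
  set Φ : ℕ → TopologicalSpace.Closeds ℝ × TopologicalSpace.Closeds ℝ → ℝ≥0∞ := fun n F =>
    alternatingCDF n β₁ β₂ ((z - (leap^[n] ((0, a), F)).1.1) / (leap^[n] ((0, a), F)).1.2) with hΦ
  have hΦm : ∀ n, Measurable (Φ n) := fun n => by
    have hm := (measurable_leap.iterate n).comp
      (measurable_const.prodMk measurable_id : Measurable fun F => (((0 : ℝ), a), F))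
    exact (measurable_alternatingCDF hβ₁.2 hβ₂.2 n).comp
      ((hm.fst.fst.const_sub z).div hm.fst.snd)
  have hΦi : ∀ n, ∫⁻ F, Φ n F ∂(ρ₁.prod ρ₂) = hittingCDF β₁ β₂ (z / a) := fun n => by
    simpa using lintegral_alternatingCDF_iterate_leap n hβ₁ hβ₂ h₁ h₂ z 0 ha
  have hfatou := lintegral_liminf_le (u := Filter.atTop) (μ := ρ₁.prod ρ₂) hΦm
  simp_rw [hΦi, Filter.liminf_const] at hfatou
  refine le_trans ?_ hfatou
  have hnull : NullMeasurableSet {F | meetingTime a F < z} (ρ₁.prod ρ₂) :=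
    nullMeasurableSet_lt (aemeasurable_meetingTime hβ₁ hβ₂ hβ h₁ h₂ ha) aemeasurable_const
  rw [← lintegral_indicator_one₀ hnull]
  refine lintegral_mono_ae ?_
  filter_upwards [ae_tendsto_iterate_leap hβ₁ hβ₂ hβ h₁ h₂ ha] with F hF
  obtain ⟨hpos, -, h0, hlim, -⟩ := hF
  refine Set.indicator_apply_le' (fun hlt => ?_) fun _ => zero_le
  have hlt : meetingTime a F < z := hlt
  have : Filter.Tendsto (fun n => (z - (leap^[n] ((0, a), F)).1.1) / (leap^[n] ((0, a), F)).1.2)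
      Filter.atTop Filter.atTop := by
    simp_rw [div_eq_mul_inv]
    refine (hlim.const_sub z).pos_mul_atTop (sub_pos.mpr hlt) ?_
    exact (tendsto_nhdsWithin_iff.mpr
      ⟨h0, Filter.Eventually.of_forall hpos⟩).inv_tendsto_nhdsGT_zero
  exact (tendsto_alternatingCDF hβ₁ hβ₂ hβ this).liminf_eq.ge

/-- If `meetingTime a F > z`, the positions eventually exceed `z` and `Φ n F = 0`; the reverse Fatou
lemma applies thanks to the bound `1`. -/
theorem le_measure_meetingTime_le (hβ₁ : β₁ ∈ Set.Ioo (0 : ℝ) 1) (hβ₂ : β₂ ∈ Set.Ioo (0 : ℝ) 1)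
    (hβ : 0 < β₁ + β₂ - 1) (h₁ : IsStableRegenerativeLaw β₁ ρ₁)
    (h₂ : IsStableRegenerativeLaw β₂ ρ₂) {a : ℝ} (ha : 0 < a) (z : ℝ) :
    hittingCDF β₁ β₂ (z / a) ≤ (ρ₁.prod ρ₂) {F | meetingTime a F ≤ z} := by
  have := h₁.isProbabilityMeasure
  have := h₂.isProbabilityMeasure
  set Φ : ℕ → TopologicalSpace.Closeds ℝ × TopologicalSpace.Closeds ℝ → ℝ≥0∞ := fun n F =>
    alternatingCDF n β₁ β₂ ((z - (leap^[n] ((0, a), F)).1.1) / (leap^[n] ((0, a), F)).1.2) with hΦ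
  have hΦm : ∀ n, Measurable (Φ n) := fun n => by
    have hm := (measurable_leap.iterate n).comp
      (measurable_const.prodMk measurable_id : Measurable fun F => (((0 : ℝ), a), F))
    exact (measurable_alternatingCDF hβ₁.2 hβ₂.2 n).comp
      ((hm.fst.fst.const_sub z).div hm.fst.snd)
  have hΦi : ∀ n, ∫⁻ F, Φ n F ∂(ρ₁.prod ρ₂) = hittingCDF β₁ β₂ (z / a) := fun n => by
    simpa using lintegral_alternatingCDF_iterate_leap n hβ₁ hβ₂ h₁ h₂ z 0 ha
  have hfatou := limsup_lintegral_le (μ := ρ₁.prod ρ₂) (f := Φ) (fun _ => 1) hΦm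
    (fun n => Filter.Eventually.of_forall fun F => alternatingCDF_le_one hβ₁.2 hβ₂.2 hβ n _)
    (by simp)
  simp_rw [hΦi, Filter.limsup_const] at hfatou
  refine hfatou.trans ?_
  have hnull : NullMeasurableSet {F | meetingTime a F ≤ z} (ρ₁.prod ρ₂) :=
    nullMeasurableSet_le (aemeasurable_meetingTime hβ₁ hβ₂ hβ h₁ h₂ ha) aemeasurable_const
  rw [← lintegral_indicator_one₀ hnull]
  refine lintegral_mono_ae ?_
  filter_upwards [ae_tendsto_iterate_leap hβ₁ hβ₂ hβ h₁ h₂ ha] with F hF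
  obtain ⟨hpos, -, -, hlim, -⟩ := hF
  by_cases hz : meetingTime a F ≤ z
  · rw [Set.indicator_of_mem (by exact hz)]
    exact Filter.limsup_le_of_le (by isBoundedDefault)
      (Filter.Eventually.of_forall fun n => alternatingCDF_le_one hβ₁.2 hβ₂.2 hβ n _)
  · have h0 : Filter.Tendsto (fun n => Φ n F) Filter.atTop (nhds 0) := by
      refine tendsto_const_nhds.congr' ?_
      filter_upwards [hlim.eventually (lt_mem_nhds (not_le.mp hz))] with n hn
      exact (alternatingCDF_of_nonpos n
        (div_nonpos_of_nonpos_of_nonneg (by linarith) (hpos n).le)).symm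
    rw [h0.limsup_eq]
    exact zero_le

theorem measure_meetingTime_le (hβ₁ : β₁ ∈ Set.Ioo (0 : ℝ) 1) (hβ₂ : β₂ ∈ Set.Ioo (0 : ℝ) 1)
    (hβ : 0 < β₁ + β₂ - 1) (h₁ : IsStableRegenerativeLaw β₁ ρ₁)
    (h₂ : IsStableRegenerativeLaw β₂ ρ₂) {a : ℝ} (ha : 0 < a) (z : ℝ) :
    (ρ₁.prod ρ₂) {F | meetingTime a F ≤ z} = hittingCDF β₁ β₂ (z / a) := by
  rcases le_or_gt z 0 with hz | hz
  · rw [hittingCDF_of_nonpos _ _ (div_nonpos_of_nonpos_of_nonneg hz ha.le)]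
    refine measure_mono_null (fun F hF => ?_) (ae_iff.mp (ae_meetingTime_pos hβ₁ hβ₂ hβ h₁ h₂ ha))
    have hF : meetingTime a F ≤ z := hF
    exact not_lt.mpr (hF.trans hz)
  · refine le_antisymm ?_ (le_measure_meetingTime_le hβ₁ hβ₂ hβ h₁ h₂ ha z)
    -- The bound with strict inequality is used at levels `w > z`, and `w ↓ z` by continuity.
    -- Continuity is known only at positive points, so `z ≤ 0` is treated separately.
    have hc : ContinuousAt (fun w => hittingCDF β₁ β₂ (w / a)) z :=
      ContinuousAt.comp (f := fun w : ℝ => w / a) (g := hittingCDF β₁ β₂)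
        (continuousAt_hittingCDF hβ₁.2 hβ (by linarith [hβ₁.2, hβ₂.2]) (div_pos hz ha))
        (by fun_prop)
    refine ge_of_tendsto (hc.tendsto.mono_left (nhdsWithin_le_nhds (s := Set.Ioi z))) ?_
    filter_upwards [self_mem_nhdsWithin] with w hw
    have hw : z < w := hw
    exact (measure_mono fun F (hF : meetingTime a F ≤ z) => hF.trans_lt hw).trans
      (measure_meetingTime_lt_le hβ₁ hβ₂ hβ h₁ h₂ ha w)

end Meeting

/-! ### First intersection times of independent stable regenerative sets -/

section Transfer

variable {Ω : Type*} [MeasurableSpace Ω] {P : Measure Ω} {β β₁ β₂ : ℝ}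
  {R R₁ R₂ : Ω → TopologicalSpace.Closeds ℝ}

theorem IsStableRegenerativeSet.isStableRegenerativeLaw (hβ : β ∈ Set.Ioo (0 : ℝ) 1)
    (hR : IsStableRegenerativeSet β R P) : IsStableRegenerativeLaw β (P.map R) := by
  obtain ⟨Ω₀, _, P₀, X, _, hX, hid⟩ := hR
  rw [hid.map_eq]
  exact hX.isStableRegenerativeLaw hβ.1 hβ.2

theorem IsStableRegenerativeSet.aemeasurable (hR : IsStableRegenerativeSet β R P) :
    AEMeasurable R P := by
  obtain ⟨Ω₀, _, P₀, X, _, hX, hid⟩ := hR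
  exact hid.aemeasurable_fst

theorem IsStableOvershoot.map_eq {B : Ω → ℝ} (hβ : β ∈ Set.Ioo (0 : ℝ) 1)
    (hB : IsStableOvershoot β 1 B P) : P.map B = overshootLaw β := by
  obtain ⟨Ω₀, _, P₀, X, _, hX, hid⟩ := hB
  rw [hid.map_eq, ← hX.map_overshoot_div hβ.1 hβ.2 one_pos]
  simp

theorem IsStableOvershoot.aemeasurable {a : ℝ} {B : Ω → ℝ} (hB : IsStableOvershoot β a B P) :
    AEMeasurable B P := by
  obtain ⟨Ω₀, _, P₀, X, _, hX, hid⟩ := hB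
  exact hid.aemeasurable_fst

theorem ae_isLeast_firstIntersectionTime [IsProbabilityMeasure P]
    (hβ₁ : β₁ ∈ Set.Ioo (0 : ℝ) 1) (hβ₂ : β₂ ∈ Set.Ioo (0 : ℝ) 1) (hβ : 0 < β₁ + β₂ - 1)
    (hR₁ : IsStableRegenerativeSet β₁ R₁ P) (hR₂ : IsStableRegenerativeSet β₂ R₂ P)
    (hR : IndepFun R₁ R₂ P) {a : ℝ} (ha : 0 < a) :
    ∀ᵐ ω ∂P, IsLeast (shiftedIntersection R₁ R₂ a ω) (a + firstIntersectionTime R₁ R₂ a ω) := by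
  have h := ae_isLeast_meetingTime hβ₁ hβ₂ hβ (hR₁.isStableRegenerativeLaw hβ₁)
    (hR₂.isStableRegenerativeLaw hβ₂) ha
  rw [← (indepFun_iff_map_prod_eq_prod_map_map hR₁.aemeasurable hR₂.aemeasurable).mp hR] at h
  exact ae_of_ae_map (hR₁.aemeasurable.prodMk hR₂.aemeasurable) h

theorem aemeasurable_firstIntersectionTime [IsProbabilityMeasure P]
    (hβ₁ : β₁ ∈ Set.Ioo (0 : ℝ) 1) (hβ₂ : β₂ ∈ Set.Ioo (0 : ℝ) 1) (hβ : 0 < β₁ + β₂ - 1)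
    (hR₁ : IsStableRegenerativeSet β₁ R₁ P) (hR₂ : IsStableRegenerativeSet β₂ R₂ P)
    (hR : IndepFun R₁ R₂ P) {a : ℝ} (ha : 0 < a) :
    AEMeasurable (firstIntersectionTime R₁ R₂ a) P := by
  have h := aemeasurable_meetingTime hβ₁ hβ₂ hβ (hR₁.isStableRegenerativeLaw hβ₁)
    (hR₂.isStableRegenerativeLaw hβ₂) ha
  rw [← (indepFun_iff_map_prod_eq_prod_map_map hR₁.aemeasurable hR₂.aemeasurable).mp hR] at h
  exact h.comp_aemeasurable (hR₁.aemeasurable.prodMk hR₂.aemeasurable)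

theorem measure_firstIntersectionTime_le [IsProbabilityMeasure P]
    (hβ₁ : β₁ ∈ Set.Ioo (0 : ℝ) 1) (hβ₂ : β₂ ∈ Set.Ioo (0 : ℝ) 1) (hβ : 0 < β₁ + β₂ - 1)
    (hR₁ : IsStableRegenerativeSet β₁ R₁ P) (hR₂ : IsStableRegenerativeSet β₂ R₂ P)
    (hR : IndepFun R₁ R₂ P) {a : ℝ} (ha : 0 < a) (z : ℝ) :
    P {ω | firstIntersectionTime R₁ R₂ a ω ≤ z} = hittingCDF β₁ β₂ (z / a) := by
  have hlaw := (indepFun_iff_map_prod_eq_prod_map_map hR₁.aemeasurable hR₂.aemeasurable).mp hR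
  have hm := aemeasurable_meetingTime hβ₁ hβ₂ hβ (hR₁.isStableRegenerativeLaw hβ₁)
    (hR₂.isStableRegenerativeLaw hβ₂) ha
  rw [← measure_meetingTime_le hβ₁ hβ₂ hβ (hR₁.isStableRegenerativeLaw hβ₁)
    (hR₂.isStableRegenerativeLaw hβ₂) ha]
  rw [← hlaw] at hm ⊢
  rw [Measure.map_apply₀ (hR₁.aemeasurable.prodMk hR₂.aemeasurable)
    (nullMeasurableSet_le hm aemeasurable_const)]
  rfl

theorem map_firstIntersectionTime_Iic [IsProbabilityMeasure P]
    (hβ₁ : β₁ ∈ Set.Ioo (0 : ℝ) 1) (hβ₂ : β₂ ∈ Set.Ioo (0 : ℝ) 1) (hβ : 0 < β₁ + β₂ - 1)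
    (hR₁ : IsStableRegenerativeSet β₁ R₁ P) (hR₂ : IsStableRegenerativeSet β₂ R₂ P)
    (hR : IndepFun R₁ R₂ P) (z : ℝ) :
    P.map (firstIntersectionTime R₁ R₂ 1) (Set.Iic z) = hittingCDF β₁ β₂ z := by
  rw [Measure.map_apply_of_aemeasurable
    (aemeasurable_firstIntersectionTime hβ₁ hβ₂ hβ hR₁ hR₂ hR one_pos) measurableSet_Iic]
  have h := measure_firstIntersectionTime_le hβ₁ hβ₂ hβ hR₁ hR₂ hR one_pos z
  rwa [div_one] at h

theorem identDistrib_firstIntersectionTime_div [IsProbabilityMeasure P]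
    (hβ₁ : β₁ ∈ Set.Ioo (0 : ℝ) 1) (hβ₂ : β₂ ∈ Set.Ioo (0 : ℝ) 1) (hβ : 0 < β₁ + β₂ - 1)
    (hR₁ : IsStableRegenerativeSet β₁ R₁ P) (hR₂ : IsStableRegenerativeSet β₂ R₂ P)
    (hR : IndepFun R₁ R₂ P) {a : ℝ} (ha : 0 < a) :
    IdentDistrib (fun ω => firstIntersectionTime R₁ R₂ a ω / a) (firstIntersectionTime R₁ R₂ 1)
      P P := by
  have hm := (aemeasurable_firstIntersectionTime hβ₁ hβ₂ hβ hR₁ hR₂ hR ha).div_const a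
  refine ⟨hm, aemeasurable_firstIntersectionTime hβ₁ hβ₂ hβ hR₁ hR₂ hR one_pos, ?_⟩
  have := Measure.isProbabilityMeasure_map hm
  refine Measure.ext_of_Iic _ _ fun z => ?_
  rw [map_firstIntersectionTime_Iic hβ₁ hβ₂ hβ hR₁ hR₂ hR,
    Measure.map_apply_of_aemeasurable hm measurableSet_Iic]
  have h := measure_firstIntersectionTime_le hβ₁ hβ₂ hβ hR₁ hR₂ hR ha (z * a)
  rw [mul_div_assoc, div_self ha.ne', mul_one] at h
  rw [← h]
  congr 1
  ext ω
  exact div_le_iff₀ ha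

theorem identDistrib_firstIntersectionTime_recursion [IsProbabilityMeasure P]
    (hβ₁ : β₁ ∈ Set.Ioo (0 : ℝ) 1) (hβ₂ : β₂ ∈ Set.Ioo (0 : ℝ) 1) (hβ : 0 < β₁ + β₂ - 1)
    (hR₁ : IsStableRegenerativeSet β₁ R₁ P) (hR₂ : IsStableRegenerativeSet β₂ R₂ P)
    (hR : IndepFun R₁ R₂ P) {Ω' : Type*} [MeasurableSpace Ω'] {P' : Measure Ω'}
    [IsProbabilityMeasure P'] {S₁ S₂ : Ω' → TopologicalSpace.Closeds ℝ} {B : Ω' → ℝ}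
    (hS₁ : IsStableRegenerativeSet β₁ S₁ P') (hS₂ : IsStableRegenerativeSet β₂ S₂ P')
    (hS : IndepFun S₂ S₁ P') (hB : IsStableOvershoot β₁ 1 B P')
    (hBS : IndepFun B (firstIntersectionTime S₂ S₁ 1) P') :
    IdentDistrib (firstIntersectionTime R₁ R₂ 1)
      (fun ω => B ω * (1 + firstIntersectionTime S₂ S₁ 1 ω)) P P' := by
  have hβ' : 0 < β₂ + β₁ - 1 := by linarith
  have hmR := aemeasurable_firstIntersectionTime hβ₁ hβ₂ hβ hR₁ hR₂ hR one_pos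
  have hmS := aemeasurable_firstIntersectionTime hβ₂ hβ₁ hβ' hS₂ hS₁ hS one_pos
  have hmp := hB.aemeasurable.prodMk hmS
  have hg : Measurable fun p : ℝ × ℝ => p.1 * (1 + p.2) := by fun_prop
  have := Measure.isProbabilityMeasure_map hmR
  have := Measure.isProbabilityMeasure_map hmS
  refine ⟨hmR, hg.comp_aemeasurable hmp, ?_⟩
  have e : P'.map (fun ω => B ω * (1 + firstIntersectionTime S₂ S₁ 1 ω)) =
      ((overshootLaw β₁).prod (P'.map (firstIntersectionTime S₂ S₁ 1))).map
        fun p => p.1 * (1 + p.2) := by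
    rw [← hB.map_eq hβ₁, ← (indepFun_iff_map_prod_eq_prod_map_map hB.aemeasurable hmS).mp hBS,
      AEMeasurable.map_map_of_aemeasurable hg.aemeasurable hmp]
    rfl
  rw [e]
  refine Measure.ext_of_Iic _ _ fun x => ?_
  rw [map_firstIntersectionTime_Iic hβ₁ hβ₂ hβ hR₁ hR₂ hR,
    Measure.map_apply hg measurableSet_Iic, Measure.prod_apply (hg measurableSet_Iic),
    -- For fixed `b > 0` the event `b * (1 + d) ≤ x` is `d ≤ x / b - 1`, so the product law has the
    -- distribution function given by the recursion; no coupling of the two sides is needed.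
    ← lintegral_hittingCDF_overshootLaw hβ₁]
  refine lintegral_congr_ae ?_
  filter_upwards [ae_overshootLaw_pos β₁] with b hb
  rw [← map_firstIntersectionTime_Iic hβ₂ hβ₁ hβ' hS₂ hS₁ hS]
  congr 1
  ext d
  simp only [Set.mem_preimage, Set.mem_Iic]
  rw [le_sub_iff_add_le, le_div_iff₀ hb, mul_comm, add_comm d]

end Transfer

theorem theoremB1 {Ω : Type*} [MeasurableSpace Ω] (P : Measure Ω) [IsProbabilityMeasure P]
    (β₁ β₂ : ℝ) (hβ₁ : β₁ ∈ Set.Ioo (0 : ℝ) 1) (hβ₂ : β₂ ∈ Set.Ioo (0 : ℝ) 1)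
    (hβ : 0 < β₁ + β₂ - 1)
    (R₁ R₂ : Ω → TopologicalSpace.Closeds ℝ)
    (hR₁ : IsStableRegenerativeSet β₁ R₁ P) (hR₂ : IsStableRegenerativeSet β₂ R₂ P)
    (hR : IndepFun R₁ R₂ P) :
    -- the minimum defining the first intersection time is almost surely attained
    (∀ a : ℝ, 0 < a → ∀ᵐ ω ∂P,
      IsLeast (shiftedIntersection R₁ R₂ a ω) (a + firstIntersectionTime R₁ R₂ a ω)) ∧
    -- recursion
    (∀ (Ω' : Type*) [MeasurableSpace Ω'] (P' : Measure Ω') [IsProbabilityMeasure P']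
      (S₁ S₂ : Ω' → TopologicalSpace.Closeds ℝ) (B : Ω' → ℝ),
      IsStableRegenerativeSet β₁ S₁ P' → IsStableRegenerativeSet β₂ S₂ P' → IndepFun S₂ S₁ P' →
      IsStableOvershoot β₁ 1 B P' → IndepFun B (firstIntersectionTime S₂ S₁ 1) P' →
      IdentDistrib (firstIntersectionTime R₁ R₂ 1)
        (fun ω => B ω * (1 + firstIntersectionTime S₂ S₁ 1 ω)) P P') ∧
    -- scaling
    (∀ a : ℝ, 0 < a →
      IdentDistrib (fun ω => firstIntersectionTime R₁ R₂ a ω / a)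
        (firstIntersectionTime R₁ R₂ 1) P P) ∧
    -- distribution function
    (∀ x : ℝ, 0 < x →
      P.real {ω | firstIntersectionTime R₁ R₂ 1 ω ≤ x} = intersectionCDF β₁ β₂ x 1) ∧
    -- hypergeometric form of the distribution function
    (∃ F : ℂ → ℂ, IsGaussHypergeometric (1 - β₁ : ℝ) (β₂ : ℝ) (2 - β₁ : ℝ) F ∧
      ∀ x a : ℝ, 0 < x → 0 < a →
        (intersectionCDF β₁ β₂ x a : ℂ) =
          (Real.Gamma β₂ / (Real.Gamma (β₁ + β₂ - 1) * Real.Gamma (2 - β₁)) *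
            (a / x) ^ (β₁ - 1) : ℝ) * F (-(x / a) : ℝ)) := by
  refine ⟨fun a ha => ae_isLeast_firstIntersectionTime hβ₁ hβ₂ hβ hR₁ hR₂ hR ha, ?_,
    fun a ha => identDistrib_firstIntersectionTime_div hβ₁ hβ₂ hβ hR₁ hR₂ hR ha,
    fun x hx => ?_, ?_⟩
  · intro Ω' _ P' _ S₁ S₂ B hS₁ hS₂ hS hB hBS
    exact identDistrib_firstIntersectionTime_recursion hβ₁ hβ₂ hβ hR₁ hR₂ hR hS₁ hS₂ hS hB hBS
  · rw [Measure.real, measure_firstIntersectionTime_le hβ₁ hβ₂ hβ hR₁ hR₂ hR one_pos, div_one,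
      intersectionCDF_eq_toReal hβ (by linarith [hβ₁.2, hβ₂.2]) hx]
  · refine ⟨_, isGaussHypergeometric_eulerHypergeometric hβ₂.1 (by linarith [hβ₁.2, hβ₂.2]), ?_⟩
    intro x a hx ha
    exact intersectionCDF_eq_eulerHypergeometric hβ₁.2 hβ₂.1 (by linarith [hβ₁.2, hβ₂.2]) hx ha
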